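/- Let $M>0$, $T>0$, and let $n\ge 4$ be an integer. All functions of $x$ are real-valued and $M$-periodic (equivalently, defined on $X=[0,M]$ with periodic boundary conditions), $C^k$ and $W^{k,\infty}$ are the usual spaces of such functions, and for real $s\ge 0$, $H^s$ is the periodic Sobolev space with norm $$\|f\|_{H^s}^2 = M\sum_{k\in\mathbf Z}\Bigl(1+\bigl(\tfrac{2\pi k}{M}\bigr)^2\Bigr)^{s}|\hat f(k)|^2,\qquad \hat f(k)=\frac1M\int_0^M f(x)e^{-2\pi i kx/M}\,dx .$$ For a Banach space $B$ write $B_T=L^\infty([0,T];B)$. Consider the linear equation $$u_t = a(x,t)u_{xxx}+b(x,t)u_{xx}+c(x,t)u_x+d(x,t)u+e(x,t),\qquad t\in[0,T]. \tag{$*$}$$ A function $u:[0,T]\to L^2$ is said to solve $(*)$ if for almost every $t$ the weak derivatives $u_x(t),u_{xx}(t),u_{xxx}(t)$ lie in $L^2$, the right-hand side of $(*)$ is integrable in time with values in $L^2$, and $$u(t)=u(0)+\int_0^t\bigl(a u_{xxx}+b u_{xx}+c u_x+d u+e\bigr)(s)\,ds\quad\text{in }L^2\text{ for every }t\in[0,T].$$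 Assume: (i) $a\in C([0,T];C^{n+3})$, $a_t\in C([0,T];C^{n})$, $b\in C([0,T];C^{n+2})$, $b_t\in C([0,T];C^{n})$, $c,d\in C([0,T];C^{n})$, and $e\in L^\infty([0,T];H^n)$; (ii) there is a constant $a_0$ with $0<a_0\le |a(x,t)|$ for all $x\in X$, $t\in[0,T]$; (iii) $\displaystyle \frac1M\int_0^M \frac{b(y,t)}{|a(y,t)|}\,dy\ge 0$ for all $t\in[0,T]$. Then there is a constant $K>0$, depending only on $$\tilde K = M+T+n+\|a\|_{W^{n+3,\infty}_T}+\|a_t\|_{W^{1,\infty}_T}+\|a^{-1}\|_{L^\infty_T}+\|b\|_{W^{n,\infty}_T}+\|b_t\|_{L^\infty_T}+\|c\|_{W^{n,\infty}_T}+\|d\|_{W^{n,\infty}_T}+\|e\|_{H^n_T},$$ and there is a continuous map $\Psi:H^n\to L^\infty([0,T];H^n)$ such that for every $u_0\in H^n$ $$\|\Psi(u_0)\|_{L^\infty([0,T];H^n)}\le K\bigl(\|u_0\|_{H^n}+1\bigr),$$ and such that (a representative, in the almost-everywhere sense in time, of) $u=\Psi(u_0)$ satisfies the following. 1. For every real $n'$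 with $0\le n'<n$, $u\in C([0,T];H^{n'})$ and $\|u(t)\|_{H^{n'}}\le K(\|u_0\|_{H^n}+1)$ for all $t\in[0,T]$. 2. $u(\cdot,0)=u_0$. 3. $u$ solves $(*)$ on $[0,T]$. 4. $u$ is the only function $[0,T]\to L^2$ for which 2 and 3 hold simultaneously. -/

import Mathlib

open MeasureTheory Set Filter Topology
open scoped ENNReal ContDiff

noncomputable section

/-- Real square-integrable functions on the circle `ℝ / Mℤ` (that is, on `[0, M]` with periodic
boundary conditions), for the Lebesgue measure of total mass `M`. -/
abbrev L2per (M : ℝ) [Fact (0 < M)] : Type := Lp ℝ 2 (volume : Measure (AddCircle M))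

/-- The `k`-th Fourier coefficient `(1/M) ∫₀ᴹ f(x) exp(-2πikx/M) dx` of a real `L²` function. -/
def fcoef {M : ℝ} [Fact (0 < M)] (f : L2per M) (k : ℤ) : ℂ :=
  fourierCoeff (fun x : AddCircle M => ((f x : ℝ) : ℂ)) k

/-- The Bessel weight `(1 + |ξ_k|²)^s`, where `ξ_k = 2πk/M`. -/
def besselWeight (M s : ℝ) (k : ℤ) : ℝ := (1 + (2 * Real.pi * k / M) ^ 2) ^ s

theorem besselWeight_pos (M s : ℝ) (k : ℤ) : 0 < besselWeight M s k :=
  Real.rpow_pos_of_pos (by positivity) _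

section Fourier

variable {M : ℝ} [Fact (0 < M)]

theorem haar_eq_smul_volume :
    (AddCircle.haarAddCircle : Measure (AddCircle M)) = (ENNReal.ofReal M)⁻¹ • volume := by
  have h0 : ENNReal.ofReal M ≠ 0 := by simpa using (Fact.out : 0 < M)
  rw [AddCircle.volume_eq_smul_haarAddCircle, smul_smul,
    ENNReal.inv_mul_cancel h0 ENNReal.ofReal_ne_top, one_smul]

theorem inv_ofReal_period_ne_top : (ENNReal.ofReal M)⁻¹ ≠ ⊤ := by
  simpa using (Fact.out : 0 < M)

theorem L2per.memLp_ofReal (f : L2per M) :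
    MemLp (fun x : AddCircle M => ((f x : ℝ) : ℂ)) 2 AddCircle.haarAddCircle := by
  have h : MemLp (fun x : AddCircle M => ((f x : ℝ) : ℂ)) 2 volume := (Lp.memLp f).ofReal
  rw [haar_eq_smul_volume]
  exact h.smul_measure inv_ofReal_period_ne_top

theorem L2per.integrable_ofReal (f : L2per M) :
    Integrable (fun x : AddCircle M => ((f x : ℝ) : ℂ)) AddCircle.haarAddCircle :=
  (L2per.memLp_ofReal f).integrable (by norm_num)

theorem L2per.ae_haar {p : AddCircle M → Prop} (h : ∀ᵐ x : AddCircle M, p x) :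
    ∀ᵐ x ∂(AddCircle.haarAddCircle : Measure (AddCircle M)), p x := by
  rw [haar_eq_smul_volume]
  exact Measure.ae_smul_measure h _

theorem fcoef_add (f g : L2per M) (k : ℤ) : fcoef (f + g) k = fcoef f k + fcoef g k := by
  unfold fcoef fourierCoeff
  have hf := (L2per.integrable_ofReal f)
  have hg := (L2per.integrable_ofReal g)
  have key : ∀ h : AddCircle M → ℂ, Integrable h AddCircle.haarAddCircle →
      Integrable (fun t => fourier (-k) t • h t) AddCircle.haarAddCircle := fun h hh =>
    hh.bdd_mul (c := 1) (fourier (-k)).continuous.aestronglyMeasurable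
      (Eventually.of_forall fun t => by rw [fourier_apply]; exact (Circle.norm_coe _).le)
  rw [← integral_add (key _ hf) (key _ hg)]
  refine integral_congr_ae ?_
  filter_upwards [L2per.ae_haar (Lp.coeFn_add f g)] with x hx
  rw [hx, Pi.add_apply, Complex.ofReal_add, smul_add]

theorem fcoef_smul (r : ℝ) (f : L2per M) (k : ℤ) : fcoef (r • f) k = (r : ℂ) * fcoef f k := by
  unfold fcoef fourierCoeff
  rw [← integral_const_mul]
  refine integral_congr_ae ?_
  filter_upwards [L2per.ae_haar (Lp.coeFn_smul r f)] with x hx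
  simp [hx]
  ring

/-- A real `L²` function with vanishing Fourier coefficients is zero. -/
theorem eq_zero_of_fcoef (f : L2per M) (h : ∀ k, fcoef f k = 0) : f = 0 := by
  have hm := L2per.memLp_ofReal f
  have hz : fourierBasis.repr hm.toLp = 0 := by
    ext k
    have h1 : fourierBasis.repr hm.toLp k = fcoef f k := by
      rw [fourierBasis_repr]
      unfold fcoef fourierCoeff
      refine integral_congr_ae ?_
      filter_upwards [hm.coeFn_toLp] with x hx
      rw [hx]
    rw [h1, h k]
    rfl
  have hz' : hm.toLp = 0 := by simpa using hz
  have hae := (hm.coeFn_toLp).symm.trans ((Lp.eq_zero_iff_ae_eq_zero).1 hz')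
  have hv : ∀ᵐ x : AddCircle M, ((f x : ℝ) : ℂ) = 0 := by
    have := Measure.ae_smul_measure hae (ENNReal.ofReal M)
    rwa [← AddCircle.volume_eq_smul_haarAddCircle] at this
  apply (Lp.eq_zero_iff_ae_eq_zero).2
  filter_upwards [hv] with x hx
  simpa using hx

end Fourier

/-- The sequence `√M (1 + |ξ_k|²)^{s/2} f̂(k)`, whose `ℓ²` norm is the `H^s` norm of `f`. -/
def besselSeq {M : ℝ} [Fact (0 < M)] (s : ℝ) (f : L2per M) (k : ℤ) : ℂ :=
  ((Real.sqrt (M * besselWeight M s k) : ℝ) : ℂ) * fcoef f k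

theorem norm_besselSeq_sq {M : ℝ} [Fact (0 < M)] (s : ℝ) (f : L2per M) (k : ℤ) :
    ‖besselSeq s f k‖ ^ 2 = M * (besselWeight M s k * ‖fcoef f k‖ ^ 2) := by
  have hM : 0 < M := Fact.out
  rw [besselSeq, norm_mul, mul_pow, Complex.norm_real, Real.norm_eq_abs, sq_abs,
    Real.sq_sqrt (mul_pos hM (besselWeight_pos M s k)).le, mul_assoc]

theorem memℓp_besselSeq_iff {M : ℝ} [Fact (0 < M)] (s : ℝ) (f : L2per M) :
    Memℓp (besselSeq s f) 2 ↔ Summable fun k => besselWeight M s k * ‖fcoef f k‖ ^ 2 := by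
  have hM : 0 < M := Fact.out
  rw [memℓp_gen_iff (by norm_num)]
  simp only [ENNReal.toReal_ofNat, Real.rpow_ofNat, norm_besselSeq_sq]
  exact summable_mul_left_iff hM.ne'

/-- The periodic Sobolev space `H^s` (`s ≥ 0`) as a linear subspace of `L²`: those `f` with
`∑_k (1 + |ξ_k|²)^s |f̂(k)|² < ∞`. -/
def sobSubmodule (M : ℝ) [Fact (0 < M)] (s : ℝ) : Submodule ℝ (L2per M) where
  carrier := {f | Summable fun k => besselWeight M s k * ‖fcoef f k‖ ^ 2}
  zero_mem' := by
    have : ∀ k, fcoef (0 : L2per M) k = 0 := fun k => by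
      simpa using fcoef_smul (0 : ℝ) (0 : L2per M) k
    simp [this, summable_zero]
  add_mem' := by
    intro f g hf hg
    have hf' := (memℓp_besselSeq_iff s f).2 hf
    have hg' := (memℓp_besselSeq_iff s g).2 hg
    refine (memℓp_besselSeq_iff s (f + g)).1 ?_
    convert hf'.add hg' using 1
    funext k
    simp [besselSeq, fcoef_add, mul_add]
  smul_mem' := by
    intro r f hf
    have hf' := (memℓp_besselSeq_iff s f).2 hf
    refine (memℓp_besselSeq_iff s (r • f)).1 ?_
    convert hf'.const_smul (r : ℂ) using 1
    funext k
    simp [besselSeq, fcoef_smul]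
    ring

/-- The periodic Sobolev space `H^s` as a type of its own; its norm is not the `L²` norm, but the
`H^s` norm, given explicitly by `Sob.norm_sq`. -/
def Sob (M : ℝ) [Fact (0 < M)] (s : ℝ) : Type := sobSubmodule M s

namespace Sob

variable {M : ℝ} [Fact (0 < M)] {s : ℝ}

instance : AddCommGroup (Sob M s) := inferInstanceAs (AddCommGroup (sobSubmodule M s))

instance : Module ℝ (Sob M s) := inferInstanceAs (Module ℝ (sobSubmodule M s))

/-- The inclusion `H^s ⊆ L²`. -/
def toL2 : Sob M s →ₗ[ℝ] L2per M := (sobSubmodule M s).subtype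

/-- The linear embedding of `H^s` into `ℓ²` that defines the norm. -/
def toSeq : Sob M s →ₗ[ℝ] lp (fun _ : ℤ => ℂ) 2 where
  toFun f := ⟨besselSeq s (toL2 f), (memℓp_besselSeq_iff s (toL2 f)).2 f.2⟩
  map_add' f g := by
    ext k
    change besselSeq s (toL2 (f + g)) k = besselSeq s (toL2 f) k + besselSeq s (toL2 g) k
    simp [besselSeq, fcoef_add, mul_add]
  map_smul' r f := by
    ext k
    simp [besselSeq, fcoef_smul]
    ring

theorem toL2_injective : Function.Injective (toL2 : Sob M s → L2per M) :=
  Subtype.val_injective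

theorem toSeq_injective : Function.Injective (toSeq : Sob M s → lp (fun _ : ℤ => ℂ) 2) := by
  refine (injective_iff_map_eq_zero toSeq).2 fun f hf => ?_
  apply toL2_injective
  rw [map_zero]
  refine eq_zero_of_fcoef _ fun k => ?_
  have h1 : besselSeq s (toL2 f) k = 0 := by
    have := congrArg (fun z : lp (fun _ : ℤ => ℂ) 2 => z k) hf
    simpa [toSeq] using this
  have hM : 0 < M := Fact.out
  have h2 : Real.sqrt (M * besselWeight M s k) ≠ 0 :=
    (Real.sqrt_pos.2 (mul_pos hM (besselWeight_pos M s k))).ne'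
  rcases mul_eq_zero.1 h1 with h3 | h3
  · exact absurd (Complex.ofReal_eq_zero.1 h3) h2
  · exact h3

instance : NormedAddCommGroup (Sob M s) :=
  NormedAddCommGroup.induced (Sob M s) (lp (fun _ : ℤ => ℂ) 2) toSeq toSeq_injective

instance : NormedSpace ℝ (Sob M s) :=
  NormedSpace.induced ℝ (Sob M s) (lp (fun _ : ℤ => ℂ) 2) toSeq

/-- `‖f‖²_{H^s} = M ∑_k (1 + |ξ_k|²)^s |f̂(k)|²`. -/
theorem norm_sq (f : Sob M s) :
    ‖f‖ ^ 2 = M * ∑' k, besselWeight M s k * ‖fcoef (toL2 f) k‖ ^ 2 := by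
  have h : ‖f‖ = ‖toSeq f‖ := rfl
  have h2 := lp.norm_rpow_eq_tsum (p := 2) (by norm_num) (toSeq f)
  simp only [ENNReal.toReal_ofNat, Real.rpow_ofNat] at h2
  rw [h, h2, ← tsum_mul_left]
  exact tsum_congr fun k => norm_besselSeq_sq s (toL2 f) k

end Sob

/-- The periodic function on the line that corresponds to a function on the circle. -/
def circleLift {M : ℝ} (f : AddCircle M → ℝ) (x : ℝ) : ℝ := f (x : AddCircle M)

/-- `g ∈ L²` is the `j`-th weak derivative of `f ∈ L²` on the circle: for all smooth `M`-periodic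
`φ`, `∫₀ᴹ f φ^{(j)} dx = (-1)^j ∫₀ᴹ g φ dx`. -/
def IsWeakDeriv {M : ℝ} [Fact (0 < M)] (j : ℕ) (f g : L2per M) : Prop :=
  ∀ φ : ℝ → ℝ, ContDiff ℝ ∞ φ → Function.Periodic φ M →
    ∫ x in (0 : ℝ)..M, f (x : AddCircle M) * iteratedDeriv j φ x =
      (-1) ^ j * ∫ x in (0 : ℝ)..M, g (x : AddCircle M) * φ x

/-- Lebesgue measure on the time interval `[0, T]`. -/
def timeMeasure (T : ℝ) : Measure ℝ := volume.restrict (Icc 0 T)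

/-- `f ∈ C([0,T]; C^k)`: each `f(t)` is a `C^k` function on the circle, and `t ↦ f(t)` is
continuous for uniform convergence of the space derivatives up to order `k`. -/
def MemCCk {M : ℝ} (T : ℝ) (k : ℕ) (f : ℝ → AddCircle M → ℝ) : Prop :=
  (∀ t ∈ Icc 0 T, ContDiff ℝ k (circleLift (f t))) ∧
  ∀ j ≤ k, ∀ t₀ ∈ Icc 0 T,
    TendstoUniformly (fun t => iteratedDeriv j (circleLift (f t))) (iteratedDeriv j (circleLift (f t₀)))
      (𝓝[Icc 0 T] t₀)

/-- `f'` is the time derivative of `f` on `[0, T]` (one-sided at the end points). -/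
def IsTimeDeriv {M : ℝ} (T : ℝ) (f f' : ℝ → AddCircle M → ℝ) : Prop :=
  ∀ t ∈ Icc 0 T, ∀ x, HasDerivWithinAt (fun s => f s x) (f' t x) (Icc 0 T) t

/-- The norm of `L^∞([0,T]; W^{k,∞})` on `C([0,T]; C^k)`:
`sup_{t ∈ [0,T]} ∑_{j ≤ k} sup_x |∂_x^j f(x,t)|`. -/
def wNorm {M : ℝ} (T : ℝ) (k : ℕ) (f : ℝ → AddCircle M → ℝ) : ℝ :=
  ⨆ t : Icc 0 T, ∑ j ∈ Finset.range (k + 1), ⨆ x : ℝ, |iteratedDeriv j (circleLift (f t)) x|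

/-- The number on which the constants may depend: the sum of `M`, `T`, `n` and the norms of the
coefficients, of `1/a`, and of the time derivatives `a'`, `b'` of `a`, `b`. -/
def sizeOfData {M : ℝ} [Fact (0 < M)] (T : ℝ) (n : ℕ) (a a' b b' c d : ℝ → AddCircle M → ℝ)
    (e : Lp (Sob M n) ∞ (timeMeasure T)) : ℝ :=
  M + T + n + wNorm T (n + 3) a + wNorm T 1 a' + wNorm T 0 (fun t x => (a t x)⁻¹)
    + wNorm T n b + wNorm T 0 b' + wNorm T n c + wNorm T n d + ‖e‖

/-- `u` solves `u_t = a u_xxx + b u_xx + c u_x + d u + e` on `[0, T]`: for almost every `t` the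
weak derivatives `u_x(t), u_xx(t), u_xxx(t)` exist in `L²`, the right-hand side `F(t)` is integrable
in time with values in `L²`, and `u(t) = u(0) + ∫₀ᵗ F(s) ds` for every `t ∈ [0, T]`. Since `e` is
only `L^∞` in time, this is the natural meaning of the equation; it says that `u` is absolutely
continuous into `L²` and that the equation holds for almost every `t`. -/
def IsSolution {M : ℝ} [Fact (0 < M)] (T : ℝ) (a b c d : ℝ → AddCircle M → ℝ)
    (e u : ℝ → L2per M) : Prop :=
  ∃ u₁ u₂ u₃ F : ℝ → L2per M,
    (∀ᵐ t ∂(timeMeasure T),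
      IsWeakDeriv 1 (u t) (u₁ t) ∧ IsWeakDeriv 2 (u t) (u₂ t) ∧ IsWeakDeriv 3 (u t) (u₃ t) ∧
      ∀ᵐ x : AddCircle M,
        F t x = a t x * u₃ t x + b t x * u₂ t x + c t x * u₁ t x + d t x * u t x + e t x) ∧
    Integrable F (timeMeasure T) ∧
    ∀ t ∈ Icc 0 T, u t = u 0 + ∫ s in (0 : ℝ)..t, F s

end

set_option linter.unusedSectionVars false

/-! The difficulty is the loss of derivatives. Apply `∂ₓᵖ` to the equation, put `v = ∂ₓᵖ u` and
multiply by `w v` with a positive periodic weight `w`. The two leading terms become `a v_xxx + (b +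
p a_x) v_xx`. After integration by parts they contribute to the energy the dangerous term `∫
((3/2)(w a)_x - w (b + p a_x)) v_x²`, plus multiples of `v²`. Requiring the coefficient to vanish is
a first order equation for `log w` whose solution is periodic only if `b/a` has mean zero.
Subtracting the mean `λ` of `b/a` restores periodicity and leaves `-λ ∫ w a v_x²`. This is
non-positive, because `a` has one sign and the average of `b/|a|` is non-negative. Hence the
weighted energy obeys a Grönwall inequality at every level `p ≤ n`. The weight is `wt`, the identity
is `integral_weighted_energy_le`, and the levels in use are `p = 0` (`Coeffs.base_energy`) and `p =
n` (`Coeffs.top_energy`). Level `n` closes because `∂ₓⁿ` of the operator has only three terms with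
more than `n` derivatives of `u`, and all of these fit the weighted identity.

Existence comes from backward Euler in time. One step solves `u - τ L u = f`, which is a third order
periodic linear ODE. It has a solution because the homogeneous equation has none but zero (by the
energy estimate), and its solution gains three derivatives because `a` does not vanish. The implicit
step is stable in the weighted energy whatever the order of `L`, which gives bounds in `H^n` uniform
in `τ` (`TimeCoeffs.exists_scheme`).

Interpolating the scheme in time gives functions bounded in `H^n` that solve the equation up to an
arbitrarily small residual in `L²` (`TimeCoeffs.exists_approx`). This uses that on bounded sets of
`H^n`, `n ≥ 4`, smallness in `L²` implies smallness of three derivatives. The energy inequality of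
order zero in `L²` (`TimeCoeffs.norm_sq_le_of_residual`) makes them Cauchy in `L²`. Balls of `H^n`
are closed in `L²`, so the limit keeps the bound and solves the equation
(`TimeCoeffs.exists_solution`).

The same `L²` inequality gives uniqueness among all functions with three weak derivatives in `L²`.
Since the difference of two solutions solves the homogeneous equation, uniqueness and the bound in
`H^n` make the solution map Lipschitz. Continuity into `H^{n'}`, `n' < n`, is interpolation between
the `H^n` bound and `L²` continuity. -/

noncomputable section

/-! ### Periodic functions on the line as elements of `L²` of the circle -/

section CircleFunctions

variable {M : ℝ} [hM : Fact (0 < M)]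

/-- The angular frequency `ξ_k = 2πk/M`. -/
def freq (M : ℝ) (k : ℤ) : ℝ := 2 * Real.pi * k / M

/-- The function on the circle that agrees with `φ` on `[0, M)`. -/
def onCircle (M : ℝ) [Fact (0 < M)] (φ : ℝ → ℝ) : AddCircle M → ℝ :=
  fun x => φ (AddCircle.equivIco M 0 x)

theorem onCircle_coe {φ : ℝ → ℝ} (h : Function.Periodic φ M) (x : ℝ) :
    onCircle M φ (x : AddCircle M) = φ x := by
  unfold onCircle
  have h1 : ((AddCircle.equivIco M 0 (x : AddCircle M) : ℝ) : AddCircle M) = (x : AddCircle M) :=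
    AddCircle.coe_equivIco
  obtain ⟨z, hz⟩ := (QuotientAddGroup.eq.1 h1)
  have h2 : x = (AddCircle.equivIco M 0 (x : AddCircle M) : ℝ) + z * M := by
    have hz' : (z : ℝ) * M = -(AddCircle.equivIco M 0 (x : AddCircle M) : ℝ) + x := by
      rw [← zsmul_eq_mul]
      exact hz
    linarith
  conv_rhs => rw [h2]
  exact ((h.int_mul z) _).symm

theorem onCircle_circleLift (f : AddCircle M → ℝ) : onCircle M (circleLift f) = f := by
  funext x
  simp [onCircle, circleLift, AddCircle.coe_equivIco]

theorem circleLift_periodic (f : AddCircle M → ℝ) : Function.Periodic (circleLift f) M := by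
  intro x
  simp [circleLift]

theorem onCircle_eq_lift {φ : ℝ → ℝ} (h : Function.Periodic φ M) : onCircle M φ = h.lift := by
  funext x
  induction x using QuotientAddGroup.induction_on with
  | H x => rw [h.lift_coe]; exact onCircle_coe h x

theorem continuous_onCircle {φ : ℝ → ℝ} (h : Function.Periodic φ M) (hc : Continuous φ) :
    Continuous (onCircle M φ) := by
  rw [onCircle_eq_lift h]
  exact continuous_coinduced_dom.2 hc

theorem intervalIntegral_onCircle {φ : ℝ → ℝ} (h : Function.Periodic φ M) :
    ∫ x, onCircle M φ x = ∫ x in (0 : ℝ)..M, φ x := by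
  have := AddCircle.intervalIntegral_preimage M 0 (onCircle M φ)
  rw [← this, zero_add]
  simp_rw [onCircle_coe h]

/-- `φ` is an `M`-periodic function of class `C^k`. -/
structure PerC (M : ℝ) (k : ℕ) (φ : ℝ → ℝ) : Prop where
  per : Function.Periodic φ M
  smooth : ContDiff ℝ k φ

namespace PerC

variable {k : ℕ} {φ ψ : ℝ → ℝ}

theorem cont (h : PerC M k φ) : Continuous φ := h.smooth.continuous

theorem mono {l : ℕ} (h : PerC M k φ) (hl : l ≤ k) : PerC M l φ :=
  ⟨h.per, h.smooth.of_le (by exact_mod_cast hl)⟩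

theorem add (h : PerC M k φ) (h' : PerC M k ψ) : PerC M k (fun x => φ x + ψ x) :=
  ⟨h.per.add h'.per, h.smooth.add h'.smooth⟩

theorem sub (h : PerC M k φ) (h' : PerC M k ψ) : PerC M k (fun x => φ x - ψ x) :=
  ⟨h.per.sub h'.per, h.smooth.sub h'.smooth⟩

theorem mul (h : PerC M k φ) (h' : PerC M k ψ) : PerC M k (fun x => φ x * ψ x) :=
  ⟨h.per.mul h'.per, h.smooth.mul h'.smooth⟩

theorem const_mul (h : PerC M k φ) (c : ℝ) : PerC M k (fun x => c * φ x) :=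
  ⟨fun x => by simp only [h.per x], contDiff_const.mul h.smooth⟩

theorem const (c : ℝ) : PerC M k (fun _ => c) := ⟨fun _ => rfl, contDiff_const⟩

theorem iterDeriv_periodic (h : Function.Periodic φ M) (j : ℕ) :
    Function.Periodic (iteratedDeriv j φ) M := by
  induction j with
  | zero => simpa using h
  | succ j ih =>
    intro x
    rw [iteratedDeriv_succ]
    have : (fun y => iteratedDeriv j φ (y + M)) = iteratedDeriv j φ := funext ih
    rw [← deriv_comp_add_const, this]

theorem iter {j l : ℕ} (h : PerC M k φ) (hj : l + j ≤ k) : PerC M l (iteratedDeriv j φ) := by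
  refine ⟨iterDeriv_periodic h.per j, ?_⟩
  have h1 := contDiff_nat_iff_iteratedDeriv.1 h.smooth
  have h2 : ∀ m, iteratedDeriv m (iteratedDeriv j φ) = iteratedDeriv (m + j) φ := fun m => by
    simp only [iteratedDeriv_eq_iterate, Function.iterate_add_apply]
  refine contDiff_nat_iff_iteratedDeriv.2 ⟨fun m hm => ?_, fun m hm => ?_⟩
  · rw [h2]
    exact h1.1 (m + j) (by lia)
  · rw [h2]
    exact h1.2 (m + j) (by lia)

theorem hasDerivAt_iter {j : ℕ} (h : PerC M k φ) (hj : j < k) (x : ℝ) :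
    HasDerivAt (iteratedDeriv j φ) (iteratedDeriv (j + 1) φ x) x := by
  have := (h.smooth.differentiable_iteratedDeriv j (by exact_mod_cast hj)) x
  rw [iteratedDeriv_succ]
  exact this.hasDerivAt

end PerC

/-- Every integration by parts in space is an instance of this: a periodic primitive leaves no
boundary terms. -/
theorem integral_deriv_periodic {E : Type*} [NormedAddCommGroup E] [NormedSpace ℝ E]
    [CompleteSpace E] {P P' : ℝ → E} (hP : Function.Periodic P M)
    (h : ∀ x, HasDerivAt P (P' x) x) (hc : Continuous P') : ∫ x in (0 : ℝ)..M, P' x = 0 := by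
  rw [intervalIntegral.integral_eq_sub_of_hasDerivAt (fun x _ => h x) (hc.intervalIntegrable _ _)]
  have := hP 0
  rw [zero_add] at this
  rw [this, sub_self]

theorem memLp_onCircle {φ : ℝ → ℝ} (h : Function.Periodic φ M) (hc : Continuous φ) :
    MemLp (onCircle M φ) 2 (volume : Measure (AddCircle M)) :=
  (continuous_onCircle h hc).memLp_of_hasCompactSupport (HasCompactSupport.of_compactSpace _)

open Classical in
/-- A continuous periodic function as an element of `L²`. -/
def perL2 (M : ℝ) [Fact (0 < M)] (φ : ℝ → ℝ) : L2per M :=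
  if h : MemLp (onCircle M φ) 2 (volume : Measure (AddCircle M)) then h.toLp else 0

theorem coeFn_perL2 {φ : ℝ → ℝ} (h : Function.Periodic φ M) (hc : Continuous φ) :
    perL2 M φ =ᵐ[volume] onCircle M φ := by
  rw [perL2, dif_pos (memLp_onCircle h hc)]
  exact MemLp.coeFn_toLp _

theorem inner_perL2 {φ ψ : ℝ → ℝ} (h : PerC M 0 φ) (h' : PerC M 0 ψ) :
    inner ℝ (perL2 M φ) (perL2 M ψ) = ∫ x in (0 : ℝ)..M, φ x * ψ x := by
  rw [L2.inner_def, ← intervalIntegral_onCircle (h.mul h').per]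
  refine integral_congr_ae ?_
  filter_upwards [coeFn_perL2 h.per h.cont, coeFn_perL2 h'.per h'.cont] with x h1 h2
  rw [h1, h2]
  simp [onCircle, mul_comm]

theorem norm_sq_perL2 {φ : ℝ → ℝ} (h : PerC M 0 φ) :
    ‖perL2 M φ‖ ^ 2 = ∫ x in (0 : ℝ)..M, φ x ^ 2 := by
  rw [← real_inner_self_eq_norm_sq, inner_perL2 h h]
  simp_rw [sq]

theorem perL2_add {φ ψ : ℝ → ℝ} (h : PerC M 0 φ) (h' : PerC M 0 ψ) :
    perL2 M (fun x => φ x + ψ x) = perL2 M φ + perL2 M ψ := by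
  apply Lp.ext
  filter_upwards [coeFn_perL2 h.per h.cont, coeFn_perL2 h'.per h'.cont,
    coeFn_perL2 (h.add h').per (h.add h').cont, Lp.coeFn_add (perL2 M φ) (perL2 M ψ)] with x h1 h2 h3 h4
  rw [h3, h4, Pi.add_apply, h1, h2]
  rfl

theorem perL2_const_mul {φ : ℝ → ℝ} (h : PerC M 0 φ) (c : ℝ) :
    perL2 M (fun x => c * φ x) = c • perL2 M φ := by
  apply Lp.ext
  filter_upwards [coeFn_perL2 h.per h.cont,
    coeFn_perL2 (h.const_mul c).per (h.const_mul c).cont, Lp.coeFn_smul c (perL2 M φ)] with x h1 h3 h4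
  rw [h3, h4, Pi.smul_apply, h1]
  rfl

theorem perL2_sub {φ ψ : ℝ → ℝ} (h : PerC M 0 φ) (h' : PerC M 0 ψ) :
    perL2 M (fun x => φ x - ψ x) = perL2 M φ - perL2 M ψ := by
  have : (fun x => φ x - ψ x) = fun x => φ x + (-1) * ψ x := by funext x; ring
  rw [this, perL2_add h (h'.const_mul _), perL2_const_mul h', sub_eq_add_neg, neg_one_smul]

theorem fcoef_perL2 {φ : ℝ → ℝ} (h : PerC M 0 φ) (k : ℤ) :
    fcoef (perL2 M φ) k =
      (1 / M : ℝ) • ∫ x in (0 : ℝ)..M, fourier (-k) (x : AddCircle M) * (φ x : ℂ) := by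
  have h1 : fcoef (perL2 M φ) k = fourierCoeff (fun x : AddCircle M => ((onCircle M φ x : ℝ) : ℂ)) k := by
    unfold fcoef
    refine congrFun (fourierCoeff_congr_ae ?_) _
    filter_upwards [L2per.ae_haar (coeFn_perL2 h.per h.cont)] with x hx
    rw [hx]
  rw [h1, fourierCoeff_eq_intervalIntegral _ _ 0, zero_add]
  simp_rw [onCircle_coe h.per, smul_eq_mul]

theorem hasDerivAt_fourier_neg_freq (k : ℤ) (x : ℝ) :
    HasDerivAt (fun y : ℝ => (fourier (-k) (y : AddCircle M) : ℂ))
      (-(Complex.I * freq M k) * fourier (-k) (x : AddCircle M)) x := by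
  convert hasDerivAt_fourier_neg M k x using 1
  simp [freq]
  ring

/-- The product `exp(-i ξ_k x) φ` is periodic, so the integral of its derivative vanishes. -/
theorem fcoef_perL2_deriv {φ φ' : ℝ → ℝ} (h : PerC M 0 φ) (h' : PerC M 0 φ')
    (hd : ∀ x, HasDerivAt φ (φ' x) x) (k : ℤ) :
    fcoef (perL2 M φ') k = (Complex.I * freq M k) * fcoef (perL2 M φ) k := by
  rw [fcoef_perL2 h, fcoef_perL2 h']
  have hcf : Continuous fun y : ℝ => (fourier (-k) (y : AddCircle M) : ℂ) :=
    (map_continuous _).comp (AddCircle.continuous_mk' M)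
  have hc1 : Continuous fun y : ℝ => ((φ y : ℝ) : ℂ) := Complex.continuous_ofReal.comp h.cont
  have hc2 : Continuous fun y : ℝ => ((φ' y : ℝ) : ℂ) := Complex.continuous_ofReal.comp h'.cont
  have key := integral_deriv_periodic (M := M)
    (P := fun y : ℝ => (fourier (-k) (y : AddCircle M) : ℂ) * (φ y : ℂ))
    (P' := fun y => -(Complex.I * freq M k) * fourier (-k) (y : AddCircle M) * (φ y : ℂ)
      + fourier (-k) (y : AddCircle M) * (φ' y : ℂ)) (fun x => by simp [h.per x])
    (fun x => (hasDerivAt_fourier_neg_freq k x).mul (hd x).ofReal_comp)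
    (((continuous_const.mul hcf).mul hc1).add (hcf.mul hc2))
  have hi1 : IntervalIntegrable (fun y : ℝ => -(Complex.I * freq M k) *
      (fourier (-k) (y : AddCircle M) : ℂ) * (φ y : ℂ)) volume 0 M :=
    ((continuous_const.mul hcf).mul hc1).intervalIntegrable _ _
  have hi2 : IntervalIntegrable (fun y : ℝ => (fourier (-k) (y : AddCircle M) : ℂ) * (φ' y : ℂ))
      volume 0 M := (hcf.mul hc2).intervalIntegrable _ _
  rw [intervalIntegral.integral_add hi1 hi2] at key
  simp_rw [mul_assoc, intervalIntegral.integral_const_mul] at key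
  have : ∫ x in (0 : ℝ)..M, fourier (-k) (x : AddCircle M) * (φ' x : ℂ)
      = (Complex.I * freq M k) * ∫ x in (0 : ℝ)..M, fourier (-k) (x : AddCircle M) * (φ x : ℂ) := by
    linear_combination key
  rw [this]
  simp only [Complex.real_smul]
  ring

theorem fcoef_perL2_iter {φ : ℝ → ℝ} {k j : ℕ} (h : PerC M k φ) (hj : j ≤ k) (l : ℤ) :
    fcoef (perL2 M (iteratedDeriv j φ)) l = (Complex.I * freq M l) ^ j * fcoef (perL2 M φ) l := by
  induction j with
  | zero => simp
  | succ j ih =>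
    rw [fcoef_perL2_deriv (h.iter (l := 0) (j := j) (by lia)) (h.iter (l := 0) (by lia))
      (h.hasDerivAt_iter (by lia)), ih (by lia)]
    ring

end CircleFunctions

/-! ### Parseval and Riesz–Fischer for real functions -/

section Parseval

variable {M : ℝ} [hM : Fact (0 < M)]

theorem fcoef_sub (f g : L2per M) (k : ℤ) : fcoef (f - g) k = fcoef f k - fcoef g k := by
  have h := fcoef_add f ((-1 : ℝ) • g) k
  rw [fcoef_smul] at h
  simpa [sub_eq_add_neg] using h

theorem ext_fcoef {f g : L2per M} (h : ∀ k, fcoef f k = fcoef g k) : f = g :=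
  sub_eq_zero.1 (eq_zero_of_fcoef _ fun k => by rw [fcoef_sub, h, sub_self])

theorem fcoef_neg_index (f : L2per M) (k : ℤ) : fcoef f (-k) = starRingEnd ℂ (fcoef f k) := by
  unfold fcoef fourierCoeff
  rw [← integral_conj]
  refine integral_congr_ae (Eventually.of_forall fun x => ?_)
  simp

/-- Parseval; the factor `M` appears because the coefficients are normalised by the probability
measure while the `L²` norm uses Lebesgue measure of mass `M`. -/
theorem hasSum_norm_sq_fcoef (f : L2per M) : HasSum (fun k => M * ‖fcoef f k‖ ^ 2) (‖f‖ ^ 2) := by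
  have hm := L2per.memLp_ofReal f
  have h1 := hasSum_sq_fourierCoeff hm.toLp
  have h2 : ∀ k, fourierCoeff hm.toLp k = fcoef f k := fun k =>
    congrFun (fourierCoeff_congr_ae hm.coeFn_toLp) k
  have hpos : 0 < M := hM.out
  have h3 : M * ∫ t : AddCircle M, ‖(hm.toLp _ : Lp ℂ 2 AddCircle.haarAddCircle) t‖ ^ 2 ∂AddCircle.haarAddCircle = ‖f‖ ^ 2 := by
    have hv : ∀ g : AddCircle M → ℝ, ∫ x, g x = M * ∫ x, g x ∂AddCircle.haarAddCircle := fun g => by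
      rw [AddCircle.volume_eq_smul_haarAddCircle, integral_smul_measure,
        ENNReal.toReal_ofReal hpos.le, smul_eq_mul]
    rw [← real_inner_self_eq_norm_sq, L2.inner_def, hv]
    congr 1
    refine integral_congr_ae ?_
    filter_upwards [hm.coeFn_toLp] with x hx
    rw [hx]
    simp
  rw [← h3]
  simp_rw [h2] at h1
  exact h1.mul_left M

theorem norm_fcoef_le (f : L2per M) (k : ℤ) : M * ‖fcoef f k‖ ^ 2 ≤ ‖f‖ ^ 2 :=
  le_hasSum (hasSum_norm_sq_fcoef f) k fun _ _ => mul_nonneg hM.out.le (sq_nonneg _)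

/-- The Hilbert basis provides a complex function with these coefficients. The symmetry `hc` says
that it equals its conjugate, so passing to its real part changes no coefficient. -/
theorem exists_fcoef_eq {c : ℤ → ℂ} (hs : Summable fun k => ‖c k‖ ^ 2)
    (hc : ∀ k, c (-k) = starRingEnd ℂ (c k)) : ∃ f : L2per M, ∀ k, fcoef f k = c k := by
  have hmem : Memℓp c 2 := by
    rw [memℓp_gen_iff (by norm_num)]
    simpa using hs
  set F : Lp ℂ 2 (AddCircle.haarAddCircle : Measure (AddCircle M)) :=
    fourierBasis.repr.symm (⟨c, hmem⟩ : lp (fun _ : ℤ => ℂ) 2) with hF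
  have hFc : ∀ k, fourierCoeff F k = c k := fun k => by
    rw [← fourierBasis_repr, hF, LinearIsometryEquiv.apply_symm_apply]
  have hR : MemLp (fun x => (F x).re) 2 (volume : Measure (AddCircle M)) := by
    rw [AddCircle.volume_eq_smul_haarAddCircle]
    exact ((Lp.memLp F).re).smul_measure ENNReal.ofReal_ne_top
  refine ⟨hR.toLp, fun k => ?_⟩
  have hint : Integrable F AddCircle.haarAddCircle := (Lp.memLp F).integrable (by norm_num)
  have hint' : Integrable (fun x => starRingEnd ℂ (F x)) AddCircle.haarAddCircle :=
    (ContinuousLinearMap.integrable_comp (Complex.conjCLE : ℂ →L[ℝ] ℂ) hint)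
  have h1 : fcoef hR.toLp k = fourierCoeff (fun x => ((1 / 2 : ℂ)) * (F x + starRingEnd ℂ (F x))) k := by
    unfold fcoef
    refine congrFun (fourierCoeff_congr_ae ?_) _
    filter_upwards [L2per.ae_haar hR.coeFn_toLp] with x hx
    rw [hx, Complex.add_conj]
    push_cast
    ring
  have h2 : fourierCoeff (fun x => starRingEnd ℂ (F x)) k = c k := by
    have h3 := hFc (-k)
    rw [hc] at h3
    rw [← starRingEnd_self_apply (c k), ← h3]
    unfold fourierCoeff
    rw [← integral_conj]
    refine integral_congr_ae (Eventually.of_forall fun x => ?_)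
    simp
  have h4 := congrFun (fourierCoeff.add hint hint') k
  rw [h1, fourierCoeff.const_mul]
  change _ * fourierCoeff (⇑F + fun x => starRingEnd ℂ (F x)) k = _
  rw [h4, Pi.add_apply, hFc, h2]
  ring

end Parseval

/-! ### Multiplication operators on `L²` -/

section Multiplication

variable {M : ℝ} [hM : Fact (0 < M)]

open Classical in
/-- The essentially bounded function on the circle given by a continuous periodic function. -/
def perLinf (M : ℝ) [Fact (0 < M)] (φ : ℝ → ℝ) : Lp ℝ ∞ (volume : Measure (AddCircle M)) :=
  if h : MemLp (onCircle M φ) ∞ (volume : Measure (AddCircle M)) then h.toLp else 0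

/-- Multiplication by a continuous periodic function, as an operator on `L²`. -/
def mulP (M : ℝ) [Fact (0 < M)] (φ : ℝ → ℝ) : L2per M →L[ℝ] L2per M :=
  LinearMap.mkContinuous
    { toFun := fun f => perLinf M φ • f
      map_add' := fun f g => by
        apply Lp.ext
        filter_upwards [Lp.coeFn_lpSMul (r := 2) (perLinf M φ) (f + g),
          Lp.coeFn_lpSMul (r := 2) (perLinf M φ) f, Lp.coeFn_lpSMul (r := 2) (perLinf M φ) g,
          Lp.coeFn_add f g, Lp.coeFn_add ((perLinf M φ • f : L2per M)) ((perLinf M φ • g : L2per M))]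
          with x h1 h2 h3 h4 h5
        rw [h1, h5, Pi.add_apply, h2, h3]
        simp only [Pi.smul_apply', smul_eq_mul]
        rw [h4, Pi.add_apply, mul_add]
      map_smul' := fun c f => by
        apply Lp.ext
        filter_upwards [Lp.coeFn_lpSMul (r := 2) (perLinf M φ) (c • f),
          Lp.coeFn_lpSMul (r := 2) (perLinf M φ) f,
          Lp.coeFn_smul c f, Lp.coeFn_smul c ((perLinf M φ • f : L2per M))]
          with x h1 h2 h4 h5
        simp only [RingHom.id_apply]
        rw [h1, h5, Pi.smul_apply, h2]
        simp [h4]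
        ring }
    ‖perLinf M φ‖ (fun f => Lp.norm_smul_le (r := 2) _ _)

theorem coeFn_mulP {φ : ℝ → ℝ} (h : PerC M 0 φ) (f : L2per M) :
    mulP M φ f =ᵐ[volume] fun x => onCircle M φ x * f x := by
  have hm : MemLp (onCircle M φ) ∞ (volume : Measure (AddCircle M)) :=
    (continuous_onCircle h.per h.cont).memLp_of_hasCompactSupport (HasCompactSupport.of_compactSpace _)
  have h1 : perLinf M φ =ᵐ[volume] onCircle M φ := by
    rw [perLinf, dif_pos hm]
    exact hm.coeFn_toLp
  filter_upwards [h1, Lp.coeFn_lpSMul (r := 2) (perLinf M φ) f] with x h2 h3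
  change (perLinf M φ • f : L2per M) x = _
  rw [h3]
  simp [h2]

theorem norm_mulP_le {φ : ℝ → ℝ} (h : PerC M 0 φ) {C : ℝ} (hC : ∀ x, |φ x| ≤ C) (f : L2per M) :
    ‖mulP M φ f‖ ≤ C * ‖f‖ := by
  refine Lp.norm_le_mul_norm_of_ae_le_mul ?_
  filter_upwards [coeFn_mulP h f] with x hx
  rw [hx, norm_mul]
  exact mul_le_mul_of_nonneg_right (hC _) (norm_nonneg _)

theorem mulP_perL2 {φ ψ : ℝ → ℝ} (h : PerC M 0 φ) (h' : PerC M 0 ψ) :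
    mulP M φ (perL2 M ψ) = perL2 M (fun x => φ x * ψ x) := by
  apply Lp.ext
  filter_upwards [coeFn_mulP h (perL2 M ψ), coeFn_perL2 h'.per h'.cont,
    coeFn_perL2 (h.mul h').per (h.mul h').cont] with x h1 h2 h3
  rw [h1, h2, h3]
  rfl

theorem mulP_sub_left {φ ψ : ℝ → ℝ} (h : PerC M 0 φ) (h' : PerC M 0 ψ) (f : L2per M) :
    mulP M (fun x => φ x - ψ x) f = mulP M φ f - mulP M ψ f := by
  apply Lp.ext
  filter_upwards [coeFn_mulP h f, coeFn_mulP h' f, coeFn_mulP (h.sub h') f,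
    Lp.coeFn_sub (mulP M φ f) (mulP M ψ f)] with x h1 h2 h3 h4
  rw [h3, h4, Pi.sub_apply, h1, h2]
  simp [onCircle, sub_mul]

theorem inner_mulP_comm {φ : ℝ → ℝ} (h : PerC M 0 φ) (f g : L2per M) :
    inner ℝ (mulP M φ f) g = inner ℝ f (mulP M φ g) := by
  rw [L2.inner_def, L2.inner_def]
  refine integral_congr_ae ?_
  filter_upwards [coeFn_mulP h f, coeFn_mulP h g] with x h1 h2
  rw [h1, h2]
  simp
  ring

theorem inner_mulP_self_mono {φ ψ : ℝ → ℝ} (h : PerC M 0 φ) (h' : PerC M 0 ψ)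
    (hle : ∀ x, φ x ≤ ψ x) (f : L2per M) : inner ℝ (mulP M φ f) f ≤ inner ℝ (mulP M ψ f) f := by
  rw [L2.inner_def, L2.inner_def]
  refine integral_mono_ae (L2.integrable_inner _ _) (L2.integrable_inner _ _) ?_
  filter_upwards [coeFn_mulP h f, coeFn_mulP h' f] with x h1 h2
  rw [h1, h2]
  simp only [RCLike.inner_apply, conj_trivial]
  have : 0 ≤ (f x) ^ 2 := sq_nonneg _
  have := mul_le_mul_of_nonneg_right (hle (AddCircle.equivIco M 0 x)) this
  simp only [onCircle]
  nlinarith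

theorem mulP_const (c : ℝ) (f : L2per M) : mulP M (fun _ => c) f = c • f := by
  apply Lp.ext
  filter_upwards [coeFn_mulP (PerC.const (k := 0) c) f, Lp.coeFn_smul c f] with x h1 h2
  rw [h1, h2]
  rfl

theorem inner_mulP_self_const (c : ℝ) (f : L2per M) :
    inner ℝ (mulP M (fun _ => c) f) f = c * ‖f‖ ^ 2 := by
  rw [mulP_const, real_inner_smul_left, real_inner_self_eq_norm_sq]

end Multiplication

/-! ### Real trigonometric polynomials and truncated Fourier series -/

section Truncation

variable {M : ℝ} [hM : Fact (0 < M)]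

/-- The real trigonometric monomial `Re (c exp(i ξ_k x))`. -/
def trigMono (M : ℝ) (k : ℤ) (c : ℂ) (x : ℝ) : ℝ := (c * fourier k (x : AddCircle M)).re

theorem trigMono_periodic (k : ℤ) (c : ℂ) : Function.Periodic (trigMono M k c) M := by
  intro x
  simp [trigMono]

theorem hasDerivAt_trigMono (k : ℤ) (c : ℂ) (x : ℝ) :
    HasDerivAt (trigMono M k c) (trigMono M k (Complex.I * freq M k * c) x) x := by
  have h := (hasDerivAt_fourier M k x).const_mul c
  have h2 := (Complex.reCLM.hasFDerivAt (x := c * fourier k (x : AddCircle M))).comp_hasDerivAt x h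
  have e : trigMono M k (Complex.I * freq M k * c) x = Complex.reCLM
      (c * (2 * Real.pi * Complex.I * k / M * fourier k (x : AddCircle M))) := by
    change (_ : ℂ).re = (_ : ℂ).re
    congr 1
    simp only [freq]
    push_cast
    ring
  rw [e]
  exact h2

theorem iteratedDeriv_trigMono (j : ℕ) (k : ℤ) (c : ℂ) :
    iteratedDeriv j (trigMono M k c) = trigMono M k ((Complex.I * freq M k) ^ j * c) := by
  induction j with
  | zero => simp
  | succ j ih =>
    rw [iteratedDeriv_succ, ih]
    funext x
    rw [(hasDerivAt_trigMono _ _ _).deriv]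
    congr 1
    ring

theorem contDiff_trigMono (k : ℤ) (c : ℂ) : ContDiff ℝ ∞ (trigMono M k c) := by
  refine contDiff_infty.2 fun n => contDiff_nat_iff_iteratedDeriv.2 ⟨fun m _ => ?_, fun m _ => ?_⟩
  · rw [iteratedDeriv_trigMono]
    exact continuous_iff_continuousAt.2 fun x => (hasDerivAt_trigMono _ _ x).continuousAt
  · rw [iteratedDeriv_trigMono]
    exact fun x => (hasDerivAt_trigMono _ _ x).differentiableAt

theorem perC_trigMono (n : ℕ) (k : ℤ) (c : ℂ) : PerC M n (trigMono M k c) :=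
  ⟨trigMono_periodic k c, (contDiff_trigMono k c).of_le (by exact_mod_cast le_top)⟩

theorem onCircle_trigMono (k : ℤ) (c : ℂ) (x : AddCircle M) :
    onCircle M (trigMono M k c) x = (c * fourier k x).re := by
  induction x using QuotientAddGroup.induction_on with
  | H x => exact onCircle_coe (trigMono_periodic k c) x

/-- `Re z = (z + conj z) / 2` splits the monomial between the frequencies `k` and `-k`. For `k = 0`
both branches contribute. -/
theorem fcoef_trigMono (k l : ℤ) (c : ℂ) : fcoef (perL2 M (trigMono M k c)) l =
    (1 / 2) * ((if l = k then c else 0) + if l = -k then starRingEnd ℂ c else 0) := by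
  have hp := perC_trigMono (M := M) 0 k c
  have h1 : fcoef (perL2 M (trigMono M k c)) l = fourierCoeff
      (fun x : AddCircle M => (1 / 2 * c) * fourier k x + (1 / 2 * starRingEnd ℂ c) * fourier (-k) x) l := by
    unfold fcoef
    refine congrFun (fourierCoeff_congr_ae ?_) _
    filter_upwards [L2per.ae_haar (coeFn_perL2 hp.per hp.cont)] with x hx
    rw [hx, onCircle_trigMono, Complex.re_eq_add_conj]
    simp
    ring
  have hi : ∀ (k : ℤ) (c : ℂ), Integrable (fun x : AddCircle M => c * fourier k x)
      AddCircle.haarAddCircle := fun k c =>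
    (continuous_const.mul (map_continuous _)).integrable_of_hasCompactSupport
      (HasCompactSupport.of_compactSpace _)
  have h4 := congrFun (fourierCoeff.add (hi k (1 / 2 * c)) (hi (-k) (1 / 2 * starRingEnd ℂ c))) l
  rw [h1]
  refine h4.trans ?_
  rw [Pi.add_apply, fourierCoeff.const_mul, fourierCoeff.const_mul, fourierCoeff_fourier,
    fourierCoeff_fourier]
  simp only [Pi.single_apply]
  split_ifs <;> ring

theorem perC_sum {ι : Type*} {n : ℕ} (s : Finset ι) {F : ι → ℝ → ℝ} (h : ∀ i, PerC M n (F i)) :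
    PerC M n (fun x => ∑ i ∈ s, F i x) :=
  ⟨fun x => Finset.sum_congr rfl fun i _ => (h i).per x, ContDiff.sum fun i _ => (h i).smooth⟩

theorem fcoef_perL2_sum {ι : Type*} (s : Finset ι) {F : ι → ℝ → ℝ} (h : ∀ i, PerC M 0 (F i))
    (k : ℤ) : fcoef (perL2 M (fun x => ∑ i ∈ s, F i x)) k = ∑ i ∈ s, fcoef (perL2 M (F i)) k := by
  classical
  induction s using Finset.induction_on with
  | empty =>
    simp only [Finset.sum_empty]
    have := perL2_const_mul (M := M) (PerC.const (k := 0) (0 : ℝ)) 0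
    simp only [mul_zero, zero_smul] at this
    rw [this]
    simpa using fcoef_smul (0 : ℝ) (0 : L2per M) k
  | insert a s ha ih =>
    simp only [Finset.sum_insert ha]
    rw [perL2_add (h a) (perC_sum s h), fcoef_add, ih]

/-- The truncated Fourier series of `f`. -/
def trunc (K : ℕ) (f : L2per M) (x : ℝ) : ℝ :=
  ∑ k ∈ Finset.Icc (-K : ℤ) K, trigMono M k (fcoef f k) x

theorem perC_trunc (n K : ℕ) (f : L2per M) : PerC M n (trunc K f) :=
  perC_sum _ fun k => perC_trigMono n k _

/-- The terms with indices `l` and `-l` each supply half of the coefficient; the halves agree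
because `f` is real. -/
theorem fcoef_trunc (K : ℕ) (f : L2per M) (l : ℤ) :
    fcoef (perL2 M (trunc K f)) l = if l ∈ Finset.Icc (-K : ℤ) K then fcoef f l else 0 := by
  have h := fcoef_perL2_sum (M := M) (Finset.Icc (-K : ℤ) K)
    (F := fun k => trigMono M k (fcoef f k)) (fun k => perC_trigMono 0 k _) l
  refine h.trans ?_
  simp only [fcoef_trigMono]
  rw [← Finset.mul_sum, Finset.sum_add_distrib, Finset.sum_ite_eq]
  have h2 : ∀ k : ℤ, (if l = -k then starRingEnd ℂ (fcoef f k) else 0) =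
      if -l = k then fcoef f l else 0 := fun k => by
    by_cases hk : l = -k
    · rw [if_pos hk, if_pos (by lia), ← fcoef_neg_index, hk]
    · rw [if_neg hk, if_neg (by lia)]
  simp only [h2]
  rw [Finset.sum_ite_eq]
  have h3 : -l ∈ Finset.Icc (-K : ℤ) K ↔ l ∈ Finset.Icc (-K : ℤ) K := by
    simp only [Finset.mem_Icc]; lia
  simp only [h3]
  split_ifs <;> ring

theorem trunc_eventually_mem (l : ℤ) : ∀ᶠ K : ℕ in atTop, l ∈ Finset.Icc (-K : ℤ) K := by
  filter_upwards [eventually_ge_atTop l.natAbs] with K hK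
  simp only [Finset.mem_Icc]
  lia

end Truncation

/-! ### Weak derivatives and their Fourier description -/

section WeakDerivatives

variable {M : ℝ} [hM : Fact (0 < M)]

/-- `g` is the `j`-th derivative of `f` in terms of Fourier coefficients. -/
def IsFDeriv (j : ℕ) (f g : L2per M) : Prop :=
  ∀ k, fcoef g k = (Complex.I * freq M k) ^ j * fcoef f k

theorem IsFDeriv.sub {j : ℕ} {f g f' g' : L2per M} (h : IsFDeriv j f g) (h' : IsFDeriv j f' g') :
    IsFDeriv j (f - f') (g - g') := fun k => by
  rw [fcoef_sub, fcoef_sub, h k, h' k, mul_sub]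

theorem IsFDeriv.unique {j : ℕ} {f g g' : L2per M} (h : IsFDeriv j f g) (h' : IsFDeriv j f g') :
    g = g' := ext_fcoef fun k => by rw [h k, h' k]

theorem isFDeriv_perL2 {φ : ℝ → ℝ} {j n : ℕ} (h : PerC M n φ) (hj : j ≤ n) :
    IsFDeriv j (perL2 M φ) (perL2 M (iteratedDeriv j φ)) := fun l => fcoef_perL2_iter h hj l

/-- By Parseval the squared error is the tail of a convergent series. This density statement carries
classical identities and inequalities over to `L²` functions with derivatives. -/
theorem tendsto_perL2_iter_trunc {j : ℕ} {f g : L2per M} (h : IsFDeriv j f g) :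
    Tendsto (fun K => perL2 M (iteratedDeriv j (trunc K f))) atTop (𝓝 g) := by
  rw [tendsto_iff_norm_sub_tendsto_zero]
  have hsq : Tendsto (fun K => ‖perL2 M (iteratedDeriv j (trunc K f)) - g‖ ^ 2) atTop (𝓝 0) := by
    have h1 : ∀ K : ℕ, ‖perL2 M (iteratedDeriv j (trunc K f)) - g‖ ^ 2 =
        ∑' k, M * ‖if k ∈ Finset.Icc (-K : ℤ) K then 0 else fcoef g k‖ ^ 2 := fun K => by
      rw [← (hasSum_norm_sq_fcoef _).tsum_eq]
      refine tsum_congr fun k => ?_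
      rw [fcoef_sub, fcoef_perL2_iter (perC_trunc j K f) le_rfl, fcoef_trunc, h k]
      split_ifs <;> simp
    simp_rw [h1]
    rw [← tsum_zero (α := ℝ) (β := ℤ)]
    refine tendsto_tsum_of_dominated_convergence (bound := fun k => M * ‖fcoef g k‖ ^ 2)
      (hasSum_norm_sq_fcoef g).summable (fun k => ?_) (Eventually.of_forall fun K k => ?_)
    · refine tendsto_const_nhds.congr' ?_
      filter_upwards [trunc_eventually_mem k] with K hK
      rw [if_pos hK]
      simp
    · have : (0 : ℝ) < M := hM.out
      split_ifs
      · simp; positivity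
      · rw [Real.norm_of_nonneg (by positivity)]
  have := hsq.sqrt
  simpa [Real.sqrt_sq (norm_nonneg _)] using this

theorem integral_mul_eq_inner {φ : ℝ → ℝ} (h : PerC M 0 φ) (f : L2per M) :
    ∫ x in (0 : ℝ)..M, f (x : AddCircle M) * φ x = inner ℝ f (perL2 M φ) := by
  have := AddCircle.intervalIntegral_preimage M 0 (fun x => f x * onCircle M φ x)
  simp_rw [onCircle_coe h.per, zero_add] at this
  rw [this, L2.inner_def]
  refine integral_congr_ae ?_
  filter_upwards [coeFn_perL2 h.per h.cont] with x hx
  rw [hx]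
  simp [mul_comm]

theorem inner_perL2_iter {φ ψ : ℝ → ℝ} {j : ℕ} (h : PerC M j φ) (h' : PerC M j ψ) :
    inner ℝ (perL2 M φ) (perL2 M (iteratedDeriv j ψ)) =
      (-1) ^ j * inner ℝ (perL2 M (iteratedDeriv j φ)) (perL2 M ψ) := by
  have key : ∀ i ≤ j, inner ℝ (perL2 M φ) (perL2 M (iteratedDeriv j ψ)) =
      (-1) ^ i * inner ℝ (perL2 M (iteratedDeriv i φ)) (perL2 M (iteratedDeriv (j - i) ψ)) := by
    intro i
    induction i with
    | zero => simp
    | succ i ih =>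
      intro hi
      rw [ih (by lia)]
      obtain ⟨l, hl⟩ : ∃ l, j - i = l + 1 := ⟨j - i - 1, by lia⟩
      have hl' : j - (i + 1) = l := by lia
      rw [hl, hl']
      have p1 := h.iter (l := 0) (j := i) (by lia)
      have p2 := h.iter (l := 0) (j := i + 1) (by lia)
      have q1 := h'.iter (l := 0) (j := l) (by lia)
      have q2 := h'.iter (l := 0) (j := l + 1) (by lia)
      rw [inner_perL2 p1 q2, inner_perL2 p2 q1]
      have := integral_deriv_periodic (M := M) (p1.mul q1).per
        (fun x => (h.hasDerivAt_iter (by lia) x).mul (h'.hasDerivAt_iter (by lia) x))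
        ((p2.mul q1).cont.add (p1.mul q2).cont)
      rw [intervalIntegral.integral_add ((p2.mul q1).cont.intervalIntegrable _ _)
        ((p1.mul q2).cont.intervalIntegrable _ _)] at this
      rw [pow_succ]
      linear_combination (-1) ^ i * this
  simpa using key j le_rfl

/-- The identity is classical for truncated series, and both sides are continuous in `L²`. -/
theorem isWeakDeriv_of_isFDeriv {j : ℕ} {f g : L2per M} (h : IsFDeriv j f g) :
    IsWeakDeriv j f g := by
  intro φ hφ hper
  have hp : PerC M j φ := ⟨hper, hφ.of_le (by exact_mod_cast le_top)⟩
  rw [integral_mul_eq_inner (hp.iter (l := 0) (by lia)), integral_mul_eq_inner (hp.mono (Nat.zero_le _))]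
  have h0 : IsFDeriv 0 f f := fun k => by simp
  have h1 := (tendsto_perL2_iter_trunc h0).inner (𝕜 := ℝ) (tendsto_const_nhds (x := perL2 M (iteratedDeriv j φ)))
  have h2 := ((tendsto_perL2_iter_trunc h).inner (𝕜 := ℝ) (tendsto_const_nhds (x := perL2 M φ))).const_mul
    ((-1 : ℝ) ^ j)
  refine tendsto_nhds_unique h1 (h2.congr fun K => ?_)
  rw [iteratedDeriv_zero, inner_perL2_iter (perC_trunc j K f) hp]

theorem inner_trigMono (f : L2per M) (k : ℤ) (c : ℂ) :
    ∫ x in (0 : ℝ)..M, f (x : AddCircle M) * trigMono M (-k) c x = M * (c * fcoef f k).re := by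
  have h1 := AddCircle.intervalIntegral_preimage M 0 (fun x => f x * (c * fourier (-k) x).re)
  rw [zero_add] at h1
  change ∫ x in (0 : ℝ)..M, f (x : AddCircle M) * (c * fourier (-k) (x : AddCircle M)).re = _
  rw [h1]
  have hv : ∀ g : AddCircle M → ℝ, ∫ x, g x = M * ∫ x, g x ∂AddCircle.haarAddCircle := fun g => by
    rw [AddCircle.volume_eq_smul_haarAddCircle, integral_smul_measure,
      ENNReal.toReal_ofReal hM.out.le, smul_eq_mul]
  have hi : Integrable (fun x : AddCircle M => c * (fourier (-k) x • ((f x : ℝ) : ℂ)))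
      AddCircle.haarAddCircle := 
    Integrable.const_mul (Integrable.fourier_smul (L2per.integrable_ofReal f) _) c
  rw [hv, fcoef, fourierCoeff, ← integral_const_mul c]
  congr 1
  have := integral_re hi
  simp only [RCLike.re_to_complex] at this
  rw [← this]
  refine integral_congr_ae (Eventually.of_forall fun x => ?_)
  simp only [smul_eq_mul, Complex.mul_re, Complex.ofReal_re, Complex.ofReal_im, Complex.mul_im]
  ring

/-- The test functions are the real monomials `Re (c exp(-i ξ_k x))`. The choices `c = 1` and `c =
-i` recover the real and imaginary parts of the coefficient. -/
theorem isFDeriv_of_isWeakDeriv {j : ℕ} {f g : L2per M} (h : IsWeakDeriv j f g) :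
    IsFDeriv j f g := by
  intro k
  have h1 : ∀ c : ℂ, (c * ((Complex.I * freq M k) ^ j * fcoef f k)).re = (c * fcoef g k).re := by
    intro c
    have := h (trigMono M (-k) c) (contDiff_trigMono _ _) (trigMono_periodic _ _)
    rw [iteratedDeriv_trigMono, inner_trigMono, inner_trigMono] at this
    have hf : (Complex.I * freq M (-k)) ^ j = (((-1) ^ j : ℝ) : ℂ) * (Complex.I * freq M k) ^ j := by
      simp only [freq]
      push_cast
      rw [← mul_pow]
      ring
    rw [hf] at this
    have h2 : (-1 : ℝ) ^ j * (-1) ^ j = 1 := by rw [← mul_pow]; simp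
    have h3 : (((-1) ^ j : ℝ) : ℂ) * (Complex.I * freq M k) ^ j * c * fcoef f k =
        (((-1) ^ j : ℝ) : ℂ) * (c * ((Complex.I * freq M k) ^ j * fcoef f k)) := by ring
    rw [h3, Complex.re_ofReal_mul] at this
    have hMne : M ≠ 0 := hM.out.ne'
    apply mul_left_cancel₀ hMne
    linear_combination (-1) ^ j * this + (M * (c * fcoef g k).re - M * (c * ((Complex.I * freq M k) ^ j * fcoef f k)).re) * h2
  apply Complex.ext
  · have := h1 1
    simpa using this.symm
  · have := h1 (-Complex.I)
    simpa using this.symm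

end WeakDerivatives

/-! ### Periodic Sobolev spaces: closed balls, interpolation, completeness -/

section SobolevSpaces

variable {M : ℝ} [hM : Fact (0 < M)] {s : ℝ}

theorem besselWeight_eq (M s : ℝ) (k : ℤ) : besselWeight M s k = (1 + freq M k ^ 2) ^ s := rfl

theorem one_le_besselBase (M : ℝ) (k : ℤ) : 1 ≤ 1 + freq M k ^ 2 := by
  linarith [sq_nonneg (freq M k)]

theorem besselWeight_mono {s s' : ℝ} (h : s' ≤ s) (k : ℤ) : besselWeight M s' k ≤ besselWeight M s k :=
  Real.rpow_le_rpow_of_exponent_le (one_le_besselBase M k) h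

theorem freq_pow_le_besselWeight {j : ℕ} (h : (j : ℝ) ≤ s) (k : ℤ) :
    (freq M k ^ j) ^ 2 ≤ besselWeight M s k := by
  refine le_trans ?_ (besselWeight_mono h k)
  rw [besselWeight_eq, Real.rpow_natCast, ← pow_mul, mul_comm, pow_mul]
  exact pow_le_pow_left₀ (sq_nonneg _) (by linarith [sq_nonneg (freq M k)]) _

theorem norm_I_freq_pow_sq (j : ℕ) (k : ℤ) :
    ‖(Complex.I * freq M k) ^ j‖ ^ 2 = (freq M k ^ j) ^ 2 := by
  rw [norm_pow, norm_mul, Complex.norm_I, one_mul, Complex.norm_real, Real.norm_eq_abs, ← abs_pow,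
    sq_abs]

namespace Sob

theorem hasSum_norm_sq (g : Sob M s) :
    HasSum (fun k => M * (besselWeight M s k * ‖fcoef (toL2 g) k‖ ^ 2)) (‖g‖ ^ 2) := by
  have h : Summable fun k => besselWeight M s k * ‖fcoef (toL2 g) k‖ ^ 2 := g.2
  rw [norm_sq]
  exact h.hasSum.mul_left M

/-- Membership and the norm bound are expressed through finite partial sums, since these survive
limits taken coefficient by coefficient. -/
theorem exists_of_bound {f : L2per M} {B : ℝ} (hB : 0 ≤ B)
    (h : ∀ S : Finset ℤ, ∑ k ∈ S, M * (besselWeight M s k * ‖fcoef f k‖ ^ 2) ≤ B ^ 2) :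
    ∃ g : Sob M s, toL2 g = f ∧ ‖g‖ ≤ B := by
  have hpos : ∀ k, 0 ≤ M * (besselWeight M s k * ‖fcoef f k‖ ^ 2) := fun k =>
    mul_nonneg hM.out.le (mul_nonneg (besselWeight_pos M s k).le (sq_nonneg _))
  have hs := summable_of_sum_le hpos h
  have hs' : Summable fun k => besselWeight M s k * ‖fcoef f k‖ ^ 2 :=
    (summable_mul_left_iff hM.out.ne').1 hs
  let g : Sob M s := (⟨f, hs'⟩ : sobSubmodule M s)
  have hg : toL2 g = f := rfl
  refine ⟨g, hg, le_of_sq_le_sq ?_ hB⟩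
  rw [← (hasSum_norm_sq g).tsum_eq, hg]
  exact hs.tsum_le_of_sum_le h

theorem sum_le_norm_sq (g : Sob M s) (S : Finset ℤ) :
    ∑ k ∈ S, M * (besselWeight M s k * ‖fcoef (toL2 g) k‖ ^ 2) ≤ ‖g‖ ^ 2 :=
  sum_le_hasSum S (fun k _ => mul_nonneg hM.out.le
    (mul_nonneg (besselWeight_pos M s k).le (sq_nonneg _))) (hasSum_norm_sq g)

theorem norm_le_of_fcoef {f : L2per M} {g : Sob M s} {C : ℝ} (hC : 0 ≤ C)
    (h : ∀ k, ‖fcoef f k‖ ^ 2 ≤ C ^ 2 * (besselWeight M s k * ‖fcoef (toL2 g) k‖ ^ 2)) :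
    ‖f‖ ≤ C * ‖g‖ := by
  refine le_of_sq_le_sq ?_ (by positivity)
  rw [mul_pow]
  refine hasSum_le (fun k => ?_) (hasSum_norm_sq_fcoef f) ((hasSum_norm_sq g).mul_left (C ^ 2))
  have := mul_le_mul_of_nonneg_left (h k) hM.out.le
  linarith

theorem norm_toL2_le (hs : 0 ≤ s) (g : Sob M s) : ‖toL2 g‖ ≤ ‖g‖ := by
  have := norm_le_of_fcoef (f := toL2 g) (g := g) zero_le_one fun k => by
    rw [one_pow, one_mul]
    refine le_mul_of_one_le_left (sq_nonneg _) ?_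
    simpa [besselWeight_eq] using besselWeight_mono (M := M) hs k
  simpa using this

/-- The inclusion `H^s ⊆ L²` as a bounded operator. -/
def toL2L (hs : 0 ≤ s) : Sob M s →L[ℝ] L2per M :=
  LinearMap.mkContinuous toL2 1 fun g => by simpa using norm_toL2_le hs g

/-- Fatou for Fourier series: each coefficient converges, so each finite partial sum obeys the bound
in the limit. Thus balls of `H^s` are closed in `L²`. -/
theorem exists_of_tendsto {ι : Type*} {l : Filter ι} [l.NeBot] {g : ι → Sob M s} {f : L2per M}
    {B : ℝ} (hB : ∀ᶠ i in l, ‖g i‖ ≤ B) (h : Tendsto (fun i => toL2 (g i)) l (𝓝 f)) :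
    ∃ g₀ : Sob M s, toL2 g₀ = f ∧ ‖g₀‖ ≤ B := by
  have hB0 : 0 ≤ B := by
    obtain ⟨i, hi⟩ := hB.exists
    exact (norm_nonneg _).trans hi
  have hk : ∀ k, Tendsto (fun i => fcoef (toL2 (g i)) k) l (𝓝 (fcoef f k)) := fun k => by
    rw [tendsto_iff_norm_sub_tendsto_zero] at h ⊢
    have h1 : ∀ i, ‖fcoef (toL2 (g i)) k - fcoef f k‖ ≤ (Real.sqrt M)⁻¹ * ‖toL2 (g i) - f‖ := fun i => by
      have h2 := norm_fcoef_le (toL2 (g i) - f) k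
      rw [fcoef_sub] at h2
      have hMs : 0 < Real.sqrt M := Real.sqrt_pos.2 hM.out
      rw [inv_mul_eq_div, le_div_iff₀ hMs]
      refine le_of_sq_le_sq ?_ (norm_nonneg _)
      rw [mul_pow, Real.sq_sqrt hM.out.le, mul_comm]
      exact h2
    exact squeeze_zero (fun _ => norm_nonneg _) h1 (by simpa using h.const_mul (Real.sqrt M)⁻¹)
  refine exists_of_bound hB0 fun S => ?_
  refine le_of_tendsto (tendsto_finsetSum S fun k _ =>
    (((hk k).norm.pow 2).const_mul (besselWeight M s k)).const_mul M) ?_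
  filter_upwards [hB] with i hi
  exact (sum_le_norm_sq (g i) S).trans (pow_le_pow_left₀ (norm_nonneg _) hi 2)

theorem exists_incl {s' : ℝ} (h : s' ≤ s) (g : Sob M s) :
    ∃ g' : Sob M s', toL2 g' = toL2 g ∧ ‖g'‖ ≤ ‖g‖ := by
  refine exists_of_bound (norm_nonneg _) fun S => le_trans ?_ (sum_le_norm_sq g S)
  exact Finset.sum_le_sum fun k _ => mul_le_mul_of_nonneg_left
    (mul_le_mul_of_nonneg_right (besselWeight_mono h k) (sq_nonneg _)) hM.out.le

/-- Frequencies are split where `1 + ξ²` equals `R`, with `R^(s - s') = 1/ε`. Below the threshold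
the weight of order `s'` is at most `R^s'`; above it, at most `ε` times the weight of order `s`. -/
theorem interpolation {s' : ℝ} (h0 : 0 ≤ s') (h : s' < s) {ε : ℝ} (hε : 0 < ε) :
    ∃ C : ℝ, 0 ≤ C ∧ ∀ (g : Sob M s) (g' : Sob M s'), toL2 g' = toL2 g →
      ‖g'‖ ^ 2 ≤ ε * ‖g‖ ^ 2 + C * ‖toL2 g‖ ^ 2 := by
  set R : ℝ := ε ^ (-(1 / (s - s'))) with hR
  have hRpos : 0 < R := Real.rpow_pos_of_pos hε _
  have hsub : 0 < s - s' := by linarith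
  refine ⟨R ^ s', (Real.rpow_pos_of_pos hRpos _).le, fun g g' hg => ?_⟩
  refine hasSum_le (fun k => ?_) (hasSum_norm_sq g')
    (((hasSum_norm_sq g).mul_left ε).add ((hasSum_norm_sq_fcoef (toL2 g)).mul_left (R ^ s')))
  rw [hg]
  have key : besselWeight M s' k ≤ ε * besselWeight M s k + R ^ s' := by
    have hw : 0 < 1 + freq M k ^ 2 := by linarith [one_le_besselBase M k]
    rw [besselWeight_eq, besselWeight_eq]
    rcases le_total (1 + freq M k ^ 2) R with hc | hc
    · have := Real.rpow_le_rpow hw.le hc h0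
      have : 0 ≤ ε * (1 + freq M k ^ 2) ^ s := by positivity
      linarith
    · have h1 : 1 ≤ ε * (1 + freq M k ^ 2) ^ (s - s') := by
        have h2 := Real.rpow_le_rpow hRpos.le hc hsub.le
        rw [hR, ← Real.rpow_mul hε.le] at h2
        have h3 : -(1 / (s - s')) * (s - s') = -1 := by field_simp
        rw [h3, Real.rpow_neg_one] at h2
        have := mul_le_mul_of_nonneg_left h2 hε.le
        rwa [mul_inv_cancel₀ hε.ne'] at this
      have h4 : (1 + freq M k ^ 2) ^ s = (1 + freq M k ^ 2) ^ (s - s') * (1 + freq M k ^ 2) ^ s' := by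
        rw [← Real.rpow_add hw]; congr 1; ring
      have h5 : 0 < (1 + freq M k ^ 2) ^ s' := Real.rpow_pos_of_pos hw _
      have h6 : 0 < R ^ s' := Real.rpow_pos_of_pos hRpos _
      rw [h4]
      nlinarith
  have := mul_le_mul_of_nonneg_right key (mul_nonneg hM.out.le (sq_nonneg ‖fcoef (toL2 g) k‖))
  linarith

theorem exists_deriv {j : ℕ} (h : (j : ℝ) ≤ s) (g : Sob M s) :
    ∃ d : L2per M, IsFDeriv j (toL2 g) d ∧ ‖d‖ ≤ ‖g‖ := by
  have hle : ∀ k, ‖(Complex.I * freq M k) ^ j * fcoef (toL2 g) k‖ ^ 2 ≤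
      besselWeight M s k * ‖fcoef (toL2 g) k‖ ^ 2 := fun k => by
    rw [norm_mul, mul_pow, norm_I_freq_pow_sq]
    exact mul_le_mul_of_nonneg_right (freq_pow_le_besselWeight h k) (sq_nonneg _)
  obtain ⟨d, hd⟩ := exists_fcoef_eq (M := M) (c := fun k => (Complex.I * freq M k) ^ j * fcoef (toL2 g) k)
    (Summable.of_nonneg_of_le (fun _ => sq_nonneg _) hle g.2) (fun k => by
      rw [fcoef_neg_index, map_mul, map_pow, map_mul, Complex.conj_I, Complex.conj_ofReal]
      simp only [freq]
      push_cast
      ring)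
  refine ⟨d, hd, ?_⟩
  simpa using norm_le_of_fcoef (f := d) (g := g) zero_le_one fun k => by
    rw [hd k, one_pow, one_mul]; exact hle k

/-- The `L²` limit lies in `H^s` because balls are closed in `L²`; applying the same closedness to
the tails `g n - g m` upgrades the convergence to `H^s`. Completeness is needed for time integrals
of the forcing with values in `H^n`. -/
theorem completeSpace (hs : 0 ≤ s) : CompleteSpace (Sob M s) := by
  refine Metric.complete_of_cauchySeq_tendsto fun g hg => ?_
  obtain ⟨f, hf⟩ := cauchySeq_tendsto_of_complete ((toL2L hs).uniformContinuous.comp_cauchySeq hg)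
  obtain ⟨B, _, hB⟩ := cauchySeq_bdd hg
  have hbd : ∀ᶠ n in atTop, ‖g n‖ ≤ B + ‖g 0‖ := Eventually.of_forall fun n => by
    have := (hB n 0).le
    rw [dist_eq_norm] at this
    linarith [norm_le_norm_sub_add (g n) (g 0)]
  obtain ⟨g₀, hg₀, -⟩ := exists_of_tendsto hbd hf
  refine ⟨g₀, Metric.tendsto_atTop.2 fun ε hε => ?_⟩
  obtain ⟨N, hN⟩ := Metric.cauchySeq_iff.1 hg (ε / 2) (half_pos hε)
  refine ⟨N, fun n hn => ?_⟩
  have hb : ∀ᶠ m in atTop, ‖g n - g m‖ ≤ ε / 2 := by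
    filter_upwards [eventually_ge_atTop N] with m hm
    rw [← dist_eq_norm]
    exact (hN n hn m hm).le
  obtain ⟨h, hh, hh'⟩ := exists_of_tendsto (f := toL2 (g n) - f) hb (by
    simp only [map_sub]
    exact tendsto_const_nhds.sub hf)
  have : h = g n - g₀ := toL2_injective (by rw [hh, map_sub, hg₀])
  rw [dist_eq_norm, ← this]
  linarith

end Sob

open Classical in
/-- The `j`-th derivative of `f` in `L²`, when there is one. -/
def fder (j : ℕ) (f : L2per M) : L2per M := if h : ∃ g, IsFDeriv j f g then h.choose else 0

theorem IsFDeriv.fder_eq {j : ℕ} {f g : L2per M} (h : IsFDeriv j f g) : fder j f = g := by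
  have h' : ∃ g, IsFDeriv j f g := ⟨g, h⟩
  rw [fder, dif_pos h']
  exact h'.choose_spec.unique h

namespace Sob

theorem isFDeriv_fder {j : ℕ} (h : (j : ℝ) ≤ s) (g : Sob M s) :
    IsFDeriv j (toL2 g) (fder j (toL2 g)) := by
  obtain ⟨d, hd, -⟩ := exists_deriv h g
  rwa [hd.fder_eq]

theorem norm_fder_le {j : ℕ} (h : (j : ℝ) ≤ s) (g : Sob M s) : ‖fder j (toL2 g)‖ ≤ ‖g‖ := by
  obtain ⟨d, hd, hd'⟩ := exists_deriv h g
  rwa [hd.fder_eq]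

theorem fder_interpolation {j : ℕ} (h : (j : ℝ) < s) {ε : ℝ} (hε : 0 < ε) :
    ∃ C : ℝ, 0 ≤ C ∧ ∀ g : Sob M s, ‖fder j (toL2 g)‖ ^ 2 ≤ ε * ‖g‖ ^ 2 + C * ‖toL2 g‖ ^ 2 := by
  obtain ⟨C, hC, H⟩ := interpolation (M := M) (Nat.cast_nonneg j) h hε
  refine ⟨C, hC, fun g => ?_⟩
  obtain ⟨g', hg', -⟩ := exists_incl h.le g
  refine le_trans ?_ (H g g' hg')
  rw [← hg']
  exact pow_le_pow_left₀ (norm_nonneg _) (norm_fder_le le_rfl g') 2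

end Sob

/-- Truncation of the Fourier series as an operator on `L²`. -/
def truncL (M : ℝ) [Fact (0 < M)] (K : ℕ) : L2per M →L[ℝ] L2per M :=
  LinearMap.mkContinuous
    { toFun := fun f => perL2 M (trunc K f)
      map_add' := fun f g => ext_fcoef fun k => by
        rw [fcoef_add, fcoef_trunc, fcoef_trunc, fcoef_trunc, fcoef_add]
        split_ifs <;> simp
      map_smul' := fun c f => ext_fcoef fun k => by
        rw [RingHom.id_apply, fcoef_smul, fcoef_trunc, fcoef_trunc, fcoef_smul]
        split_ifs <;> simp }
    1 fun f => by
      rw [one_mul]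
      refine le_of_sq_le_sq ?_ (norm_nonneg _)
      refine hasSum_le (fun k => ?_) (hasSum_norm_sq_fcoef _) (hasSum_norm_sq_fcoef f)
      refine mul_le_mul_of_nonneg_left ?_ (Fact.out : 0 < M).le
      change ‖fcoef (perL2 M (trunc K f)) k‖ ^ 2 ≤ _
      rw [fcoef_trunc]
      split_ifs
      · exact le_rfl
      · simp

theorem truncL_apply (K : ℕ) (f : L2per M) : truncL M K f = perL2 M (trunc K f) := rfl

theorem norm_perL2_iter_trunc_le {j : ℕ} (h : (j : ℝ) ≤ s) (K : ℕ) (g : Sob M s) :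
    ‖perL2 M (iteratedDeriv j (trunc K (Sob.toL2 g)))‖ ≤ ‖g‖ := by
  have := Sob.norm_le_of_fcoef (f := perL2 M (iteratedDeriv j (trunc K (Sob.toL2 g)))) (g := g)
    zero_le_one fun k => by
      rw [fcoef_perL2_iter (perC_trunc j K _) le_rfl, fcoef_trunc, norm_mul, mul_pow,
        norm_I_freq_pow_sq, one_pow, one_mul]
      refine mul_le_mul (freq_pow_le_besselWeight h k) ?_ (sq_nonneg _) (besselWeight_pos M s k).le
      split_ifs
      · exact le_rfl
      · simp
  simpa using this

theorem exists_truncL (K : ℕ) (g : Sob M s) :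
    ∃ g' : Sob M s, Sob.toL2 g' = truncL M K (Sob.toL2 g) ∧ ‖g'‖ ≤ ‖g‖ := by
  refine Sob.exists_of_bound (norm_nonneg _) fun S => le_trans ?_ (Sob.sum_le_norm_sq g S)
  refine Finset.sum_le_sum fun k _ => mul_le_mul_of_nonneg_left
    (mul_le_mul_of_nonneg_left ?_ (besselWeight_pos M s k).le) hM.out.le
  rw [truncL_apply, fcoef_trunc]
  split_ifs
  · exact le_rfl
  · simp

/-- Outside the cut-off `|ξ_k| ≥ K / M`, because `2π ≥ 1`. The rate depends on `g` only through its
norm, so one `K` serves all times of a bounded forcing. -/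
theorem norm_truncL_sub_le (hs : 1 ≤ s) {K : ℕ} (hK : 0 < K) (g : Sob M s) :
    ‖truncL M K (Sob.toL2 g) - Sob.toL2 g‖ ≤ M / K * ‖g‖ := by
  have hM0 : 0 < M := hM.out
  have hK0 : (0 : ℝ) < K := by exact_mod_cast hK
  refine Sob.norm_le_of_fcoef (by positivity) fun k => ?_
  rw [fcoef_sub, truncL_apply, fcoef_trunc]
  split_ifs with hk
  · have := besselWeight_pos M s k
    simp; positivity
  · rw [zero_sub, norm_neg, ← mul_assoc]
    refine le_mul_of_one_le_left (sq_nonneg _) ?_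
    have h1 := freq_pow_le_besselWeight (M := M) (s := s) (j := 1) (by simpa using hs) k
    have h2 : (K : ℝ) ^ 2 ≤ (k : ℝ) ^ 2 := by
      have : (K : ℤ) ≤ |k| := by
        simp only [Finset.mem_Icc] at hk
        by_contra hcon
        apply hk
        constructor <;> (have := abs_lt.1 (not_le.1 hcon); lia)
      have h3 : (K : ℝ) ≤ |(k : ℝ)| := by exact_mod_cast this
      rw [← sq_abs (k : ℝ)]
      exact pow_le_pow_left₀ hK0.le h3 2
    have h4 : (K : ℝ) ^ 2 / M ^ 2 ≤ (freq M k ^ 1) ^ 2 := by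
      rw [pow_one, freq, div_pow]
      refine div_le_div_of_nonneg_right (h2.trans ?_) (by positivity)
      have : (1 : ℝ) ≤ 2 * Real.pi := by linarith [Real.pi_gt_three]
      nlinarith [sq_nonneg (k : ℝ), mul_pow (2 * Real.pi) (k : ℝ) 2, one_le_pow₀ this (n := 2)]
    calc (1 : ℝ) = (M / K) ^ 2 * (K ^ 2 / M ^ 2) := by field_simp
      _ ≤ _ := mul_le_mul_of_nonneg_left (h4.trans h1) (by positivity)

/-- Since `(1 + ξ²)^n ≤ 2^n (1 + ξ^(2n))`, the function and its `n`-th derivative alone control the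
full norm. This is why the energies follow only these two. -/
theorem exists_sob_perL2 {n : ℕ} {φ : ℝ → ℝ} (h : PerC M n φ) :
    ∃ g : Sob M n, Sob.toL2 g = perL2 M φ ∧
      ‖g‖ ^ 2 ≤ 2 ^ n * ((∫ x in (0 : ℝ)..M, φ x ^ 2) + ∫ x in (0 : ℝ)..M, iteratedDeriv n φ x ^ 2) := by
  have h0 := h.mono (Nat.zero_le n)
  have hn := h.iter (l := 0) (j := n) (by lia)
  rw [← norm_sq_perL2 h0, ← norm_sq_perL2 hn]
  have hB : 0 ≤ 2 ^ n * (‖perL2 M φ‖ ^ 2 + ‖perL2 M (iteratedDeriv n φ)‖ ^ 2) := by positivity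
  have hsum := ((hasSum_norm_sq_fcoef (perL2 M φ)).add
    (hasSum_norm_sq_fcoef (perL2 M (iteratedDeriv n φ)))).mul_left (2 ^ n)
  obtain ⟨g, hg, hg'⟩ := Sob.exists_of_bound (s := n) (f := perL2 M φ) (Real.sqrt_nonneg _) fun S => by
    rw [Real.sq_sqrt hB]
    refine le_trans (Finset.sum_le_sum fun k _ => ?_) (sum_le_hasSum S (fun k _ => ?_) hsum)
    · rw [fcoef_perL2_iter h le_rfl, norm_mul, mul_pow, norm_I_freq_pow_sq]
      have h1 : besselWeight M n k ≤ 2 ^ n * (1 + (freq M k ^ n) ^ 2) := by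
        rw [besselWeight_eq, Real.rpow_natCast]
        refine (add_pow_le zero_le_one (sq_nonneg _) n).trans ?_
        rw [one_pow, ← pow_mul, ← pow_mul, mul_comm 2 n]
        have h2 : 0 ≤ freq M k ^ (n * 2) := by rw [pow_mul]; positivity
        exact mul_le_mul_of_nonneg_right (pow_le_pow_right₀ one_le_two (Nat.sub_le n 1)) (by linarith)
      have := mul_le_mul_of_nonneg_left
        (mul_le_mul_of_nonneg_right h1 (sq_nonneg ‖fcoef (perL2 M φ) k‖)) hM.out.le
      linarith
    · have := hM.out.le
      positivity
  exact ⟨g, hg, by rw [← Real.sq_sqrt hB]; exact pow_le_pow_left₀ (norm_nonneg _) hg' 2⟩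

/-- On the Fourier side this is `ξ^(2j) ≤ 1 + ξ^(2n)`. -/
theorem integral_iter_sq_le {n j : ℕ} (hj : j ≤ n) {φ : ℝ → ℝ} (h : PerC M n φ) :
    ∫ x in (0 : ℝ)..M, iteratedDeriv j φ x ^ 2 ≤
      (∫ x in (0 : ℝ)..M, φ x ^ 2) + ∫ x in (0 : ℝ)..M, iteratedDeriv n φ x ^ 2 := by
  rw [← norm_sq_perL2 (h.mono (Nat.zero_le n)), ← norm_sq_perL2 (h.iter (l := 0) (by lia)),
    ← norm_sq_perL2 (h.iter (l := 0) (j := n) (by lia))]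
  refine hasSum_le (fun k => ?_) (hasSum_norm_sq_fcoef _)
    ((hasSum_norm_sq_fcoef (perL2 M φ)).add (hasSum_norm_sq_fcoef (perL2 M (iteratedDeriv n φ))))
  rw [fcoef_perL2_iter h le_rfl, fcoef_perL2_iter h hj, norm_mul, mul_pow, norm_I_freq_pow_sq,
    norm_mul, mul_pow, norm_I_freq_pow_sq]
  have h1 : (freq M k ^ j) ^ 2 ≤ 1 + (freq M k ^ n) ^ 2 := by
    rw [← pow_mul, ← pow_mul, mul_comm j, mul_comm n, pow_mul, pow_mul]
    rcases le_total (freq M k ^ 2) 1 with hc | hc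
    · have := pow_le_one₀ (n := j) (sq_nonneg _) hc
      have : 0 ≤ (freq M k ^ 2) ^ n := by positivity
      linarith
    · have := pow_le_pow_right₀ hc hj
      linarith
  have := mul_le_mul_of_nonneg_left
    (mul_le_mul_of_nonneg_right h1 (sq_nonneg ‖fcoef (perL2 M φ) k‖)) hM.out.le
  linarith

end SobolevSpaces

/-! ### The weighted integration by parts and the choice of the weight -/

section WeightedEnergy

variable {M : ℝ} [hM : Fact (0 < M)]

theorem abs_intervalIntegral_le {f : ℝ → ℝ} {C : ℝ} (h : ∀ x, |f x| ≤ C) (z : ℝ) :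
    |∫ x in (0 : ℝ)..z, f x| ≤ C * |z| := by
  have := intervalIntegral.norm_integral_le_of_norm_le_const (a := 0) (b := z) (f := f) (C := C)
    (fun x _ => h x)
  rwa [sub_zero, Real.norm_eq_abs] at this

theorem abs_mul_le_of_le {x y A B : ℝ} (hx : |x| ≤ A) (hy : |y| ≤ B) : |x * y| ≤ A * B := by
  rw [abs_mul]
  exact mul_le_mul hx hy (abs_nonneg _) ((abs_nonneg _).trans hx)

theorem abs_add_le_of_le {x y A B : ℝ} (hx : |x| ≤ A) (hy : |y| ≤ B) : |x + y| ≤ A + B :=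
  (abs_add_le _ _).trans (add_le_add hx hy)

theorem abs_sub_le_of_le {x y A B : ℝ} (hx : |x| ≤ A) (hy : |y| ≤ B) : |x - y| ≤ A + B :=
  (abs_sub _ _).trans (add_le_add hx hy)

/-- Integration by parts in the weighted energy of a third order operator whose second order
coefficient is tied to the weight by `w β = (3/2) (w a)' + λ w a`, with `g = w a`. -/
theorem integral_weighted_energy_le {g g₁ g₂ g₃ s s₁ v v₁ v₂ v₃ : ℝ → ℝ} {lam C : ℝ}
    (hg : ∀ x, HasDerivAt g (g₁ x) x) (hg₁ : ∀ x, HasDerivAt g₁ (g₂ x) x)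
    (hg₂ : ∀ x, HasDerivAt g₂ (g₃ x) x) (hs : ∀ x, HasDerivAt s (s₁ x) x)
    (hv : ∀ x, HasDerivAt v (v₁ x) x) (hv₁ : ∀ x, HasDerivAt v₁ (v₂ x) x)
    (hv₂ : ∀ x, HasDerivAt v₂ (v₃ x) x)
    (pg : Function.Periodic g M) (pg₁ : Function.Periodic g₁ M) (pg₂ : Function.Periodic g₂ M)
    (ps : Function.Periodic s M) (pv : Function.Periodic v M) (pv₁ : Function.Periodic v₁ M)
    (pv₂ : Function.Periodic v₂ M)
    (cg₃ : Continuous g₃) (cs₁ : Continuous s₁) (cv₃ : Continuous v₃)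
    (hlam : ∀ x, 0 ≤ lam * g x) (hC : ∀ x, |1 / 4 * g₃ x + lam / 2 * g₂ x - 1 / 2 * s₁ x| ≤ C) :
    ∫ x in (0 : ℝ)..M, (g x * v₃ x + (3 / 2 * g₁ x + lam * g x) * v₂ x + s x * v₁ x) * v x ≤
      C * ∫ x in (0 : ℝ)..M, v x ^ 2 := by
  have cont : ∀ {f f' : ℝ → ℝ}, (∀ x, HasDerivAt f (f' x) x) → Continuous f := fun h =>
    continuous_iff_continuousAt.2 fun x => (h x).continuousAt
  have cg := cont hg
  have cg₁ := cont hg₁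
  have cg₂ := cont hg₂
  have cs := cont hs
  have cv := cont hv
  have cv₁ := cont hv₁
  have cv₂ := cont hv₂
  -- The coefficients of `P` are such that the integrand minus `P'` equals `-lam g v₁² + (g₃/4 + lam
  -- g₂/2 - s₁/2) v²`. The factor `3/2` in the second order coefficient is what leaves no multiple
  -- of `g₁ v₁²`.
  set P : ℝ → ℝ := fun x => g x * (v x * v₂ x) - 1 / 2 * (g x * (v₁ x * v₁ x))
    + 1 / 2 * (g₁ x * (v x * v₁ x)) - 1 / 4 * (g₂ x * (v x * v x)) + lam * (g x * (v x * v₁ x))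
    - lam / 2 * (g₁ x * (v x * v x)) + 1 / 2 * (s x * (v x * v x)) with hP
  set P' : ℝ → ℝ := fun x => (g₁ x * (v x * v₂ x) + g x * (v₁ x * v₂ x + v x * v₃ x))
    - 1 / 2 * (g₁ x * (v₁ x * v₁ x) + g x * (v₂ x * v₁ x + v₁ x * v₂ x))
    + 1 / 2 * (g₂ x * (v x * v₁ x) + g₁ x * (v₁ x * v₁ x + v x * v₂ x))
    - 1 / 4 * (g₃ x * (v x * v x) + g₂ x * (v₁ x * v x + v x * v₁ x))
    + lam * (g₁ x * (v x * v₁ x) + g x * (v₁ x * v₁ x + v x * v₂ x))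
    - lam / 2 * (g₂ x * (v x * v x) + g₁ x * (v₁ x * v x + v x * v₁ x))
    + 1 / 2 * (s₁ x * (v x * v x) + s x * (v₁ x * v x + v x * v₁ x)) with hP'
  have hd : ∀ x, HasDerivAt P (P' x) x := fun x =>
    (((((((hg x).mul ((hv x).mul (hv₂ x))).sub
      (((hg x).mul ((hv₁ x).mul (hv₁ x))).const_mul (1 / 2))).add
      (((hg₁ x).mul ((hv x).mul (hv₁ x))).const_mul (1 / 2))).sub
      (((hg₂ x).mul ((hv x).mul (hv x))).const_mul (1 / 4))).add
      (((hg x).mul ((hv x).mul (hv₁ x))).const_mul lam)).sub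
      (((hg₁ x).mul ((hv x).mul (hv x))).const_mul (lam / 2))).add
      (((hs x).mul ((hv x).mul (hv x))).const_mul (1 / 2))
  have pP : Function.Periodic P M := fun x => by
    simp only [hP, pg x, pg₁ x, pg₂ x, ps x, pv x, pv₁ x, pv₂ x]
  have cP' : Continuous P' := by fun_prop
  have h0 := integral_deriv_periodic (M := M) pP hd cP'
  have c1 : Continuous fun x =>
      (g x * v₃ x + (3 / 2 * g₁ x + lam * g x) * v₂ x + s x * v₁ x) * v x := by fun_prop
  have c2 : Continuous fun x => C * v x ^ 2 := by fun_prop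
  have hsub := intervalIntegral.integral_sub (μ := volume) (c1.intervalIntegrable 0 M)
    (cP'.intervalIntegrable 0 M)
  rw [h0, sub_zero] at hsub
  rw [← intervalIntegral.integral_const_mul, ← hsub]
  refine intervalIntegral.integral_mono_on hM.out.le ((c1.sub cP').intervalIntegrable _ _)
    (c2.intervalIntegrable _ _) fun x _ => ?_
  have h1 := mul_le_mul_of_nonneg_right ((le_abs_self _).trans (hC x)) (sq_nonneg (v x))
  have h2 := mul_nonneg (hlam x) (sq_nonneg (v₁ x))
  simp only [hP']
  linarith

/-- The logarithm of the weight that turns the `p` times differentiated operator into one with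
non-negative diffusion. -/
def wtLog (M : ℝ) (p : ℕ) (a b : ℝ → ℝ) (x : ℝ) : ℝ :=
  (2 * p / 3 - 1) * Real.log (a x)
    + 2 / 3 * ((∫ y in (0 : ℝ)..x, b y / a y) - x / M * ∫ y in (0 : ℝ)..M, b y / a y)

/-- The weight of the `p`-th order energy. -/
def wt (M : ℝ) (p : ℕ) (a b : ℝ → ℝ) (x : ℝ) : ℝ := Real.exp (wtLog M p a b x)

/-- Coefficients of the equation at a fixed time, with bounds by `R`. -/
structure Coeffs (M : ℝ) (n : ℕ) (R : ℝ) (a b c d : ℝ → ℝ) : Prop where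
  ha : PerC M (n + 3) a
  hb : PerC M (n + 2) b
  hc : PerC M n c
  hd : PerC M n d
  a_le : ∀ j ≤ n + 3, ∀ x, |iteratedDeriv j a x| ≤ R
  b_le : ∀ j ≤ n, ∀ x, |iteratedDeriv j b x| ≤ R
  c_le : ∀ j ≤ n, ∀ x, |iteratedDeriv j c x| ≤ R
  d_le : ∀ j ≤ n, ∀ x, |iteratedDeriv j d x| ≤ R
  a_ne : ∀ x, a x ≠ 0
  inv_le : ∀ x, |(a x)⁻¹| ≤ R
  avg : 0 ≤ ∫ y in (0 : ℝ)..M, b y / |a y|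
  one_le : 1 ≤ R
  period_le : M ≤ R
  four_le : 4 ≤ n
  n_le : (n : ℝ) ≤ R

namespace Coeffs

variable {n p : ℕ} {R : ℝ} {a b c d : ℝ → ℝ}

theorem pos_or_neg (h : Coeffs M n R a b c d) : (∀ x, 0 < a x) ∨ ∀ x, a x < 0 := by
  by_contra hcon
  push Not at hcon
  obtain ⟨⟨x, hx⟩, y, hy⟩ := hcon
  obtain ⟨z, hz⟩ := mem_range_of_exists_le_of_exists_ge h.ha.cont ⟨x, hx⟩ ⟨y, hy⟩
  exact h.a_ne z hz

/-- The average of `b / a`. -/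
def lam (M : ℝ) (a b : ℝ → ℝ) : ℝ := 1 / M * ∫ y in (0 : ℝ)..M, b y / a y

/-- The sign condition on the average of `b / |a|` enters here. As `a` has constant sign, `b / a` is
plus or minus `b / |a|` throughout, so its mean is zero or has the sign of `a`. -/
theorem lam_mul_nonneg (h : Coeffs M n R a b c d) (x : ℝ) : 0 ≤ lam M a b * a x := by
  have hM0 : 0 < 1 / M := one_div_pos.2 hM.out
  have havg := h.avg
  rcases h.pos_or_neg with hp | hp
  · simp_rw [abs_of_pos (hp _)] at havg
    exact mul_nonneg (mul_nonneg hM0.le havg) (hp x).le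
  · simp_rw [abs_of_neg (hp _), div_neg] at havg
    rw [intervalIntegral.integral_neg] at havg
    exact mul_nonneg_of_nonpos_of_nonpos (mul_nonpos_of_nonneg_of_nonpos hM0.le (by linarith)) (hp x).le

theorem cont_ratio (h : Coeffs M n R a b c d) : Continuous fun y => b y / a y :=
  h.hb.cont.div h.ha.cont h.a_ne

theorem abs_a_le (h : Coeffs M n R a b c d) (x : ℝ) : |a x| ≤ R := by
  simpa using h.a_le 0 (by lia) x

theorem abs_b_le (h : Coeffs M n R a b c d) (x : ℝ) : |b x| ≤ R := by
  simpa using h.b_le 0 (by lia) x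

theorem abs_ratio_le (h : Coeffs M n R a b c d) (x : ℝ) : |b x / a x| ≤ R * R := by
  rw [div_eq_mul_inv]
  exact abs_mul_le_of_le (h.abs_b_le x) (h.inv_le x)

theorem abs_lam_le (h : Coeffs M n R a b c d) : |lam M a b| ≤ R * R := by
  have h1 := abs_intervalIntegral_le h.abs_ratio_le M
  have hM0 : 0 < M := hM.out
  rw [lam, abs_mul, abs_of_pos (one_div_pos.2 hM0), one_div, inv_mul_le_iff₀ hM0, mul_comm M]
  simpa [abs_of_pos hM0] using h1

/-- Over a period the primitive of `b / a` grows by exactly what the linear term subtracts. -/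
theorem wtLog_periodic (h : Coeffs M n R a b c d) : Function.Periodic (wtLog M p a b) M := by
  intro x
  have hM0 : M ≠ 0 := hM.out.ne'
  have hper : Function.Periodic (fun y => b y / a y) M := h.hb.per.div h.ha.per
  have h1 := hper.intervalIntegral_add_eq_add 0 x (fun t₁ t₂ => h.cont_ratio.intervalIntegrable _ _)
  simp only [zero_add] at h1
  rw [wtLog, wtLog, h.ha.per x, h1, add_div, div_self hM0]
  ring

/-- The derivative of the logarithm of the weight. -/
def wtTau (M : ℝ) (p : ℕ) (a b : ℝ → ℝ) (x : ℝ) : ℝ :=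
  (2 / 3 * (b x + p * deriv a x - lam M a b * a x) - deriv a x) * (a x)⁻¹

theorem hasDerivAt_a (h : Coeffs M n R a b c d) (x : ℝ) : HasDerivAt a (deriv a x) x := by
  have := h.ha.hasDerivAt_iter (j := 0) (by lia) x
  simpa using this

/-- With `w = exp (wtLog)` this is equivalent to `(w a)' = (2/3) w (b + p a' - λ a)`, which is the
relation between weight and second order coefficient `b + p a'` that the weighted identity asks for.
-/
theorem hasDerivAt_wtLog (h : Coeffs M n R a b c d) (x : ℝ) :
    HasDerivAt (wtLog M p a b) (wtTau M p a b x) x := by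
  have h1 : HasDerivAt (fun u => ∫ y in (0 : ℝ)..u, b y / a y) (b x / a x) x :=
    intervalIntegral.integral_hasDerivAt_right (h.cont_ratio.intervalIntegrable _ _)
      (h.cont_ratio.stronglyMeasurableAtFilter _ _) h.cont_ratio.continuousAt
  have h2 := (((h.hasDerivAt_a x).log (h.a_ne x)).const_mul (2 * (p : ℝ) / 3 - 1)).add
    ((h1.sub (((hasDerivAt_id x).div_const M).mul_const (∫ y in (0 : ℝ)..M, b y / a y))).const_mul (2 / 3))
  refine h2.congr_deriv ?_
  have := h.a_ne x
  rw [wtTau, lam]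
  field_simp
  ring

theorem perC_one_wt (h : Coeffs M n R a b c d) : PerC M 0 (wt M p a b) :=
  ⟨fun x => by rw [wt, wt, h.wtLog_periodic x], by
    have : Continuous (wtLog M p a b) :=
      continuous_iff_continuousAt.2 fun x => (h.hasDerivAt_wtLog x).continuousAt
    exact contDiff_zero.2 (Real.continuous_exp.comp this)⟩

theorem abs_log_le (h : Coeffs M n R a b c d) (x : ℝ) : |Real.log (a x)| ≤ R := by
  have hpos : 0 < |a x| := abs_pos.2 (h.a_ne x)
  rw [← Real.log_abs, abs_le]
  constructor
  · have h1 := Real.log_le_sub_one_of_pos (abs_pos.2 (inv_ne_zero (h.a_ne x)))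
    have h2 := h.inv_le x
    rw [abs_inv, Real.log_inv] at h1
    rw [abs_inv] at h2
    linarith
  · linarith [Real.log_le_sub_one_of_pos hpos, h.abs_a_le x]

theorem abs_alpha_le (h : Coeffs M n R a b c d) (hp : p ≤ n) : |2 * (p : ℝ) / 3 - 1| ≤ R := by
  have h1 : (p : ℝ) ≤ n := by exact_mod_cast hp
  have h2 : (0 : ℝ) ≤ p := Nat.cast_nonneg p
  have := h.one_le
  have := h.n_le
  rw [abs_le]
  constructor <;> linarith

/-- Periodicity allows `x` to be taken in `[0, M)`, where the integral and the linear term are both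
bounded by `M` times the bound of `b / a`. -/
theorem abs_wtLog_le (h : Coeffs M n R a b c d) (hp : p ≤ n) (x : ℝ) :
    |wtLog M p a b x| ≤ R * R + 2 / 3 * (R * (R * R) + R * (R * R)) := by
  have hM0 : 0 < M := hM.out
  obtain ⟨y, hy, hxy⟩ := (h.wtLog_periodic (p := p)).exists_mem_Ico₀ hM0 x
  rw [hxy, wtLog]
  have hR : 0 ≤ R * R := mul_self_nonneg R
  have hy0 : |y| ≤ R := by rw [abs_of_nonneg hy.1]; exact hy.2.le.trans h.period_le
  have h1 : |∫ z in (0 : ℝ)..y, b z / a z| ≤ R * (R * R) := by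
    refine (abs_intervalIntegral_le h.abs_ratio_le y).trans ?_
    rw [mul_comm]
    exact mul_le_mul_of_nonneg_right hy0 hR
  have h2 : |y / M * ∫ z in (0 : ℝ)..M, b z / a z| ≤ R * (R * R) := by
    have : y / M * ∫ z in (0 : ℝ)..M, b z / a z = y * lam M a b := by rw [lam]; ring
    rw [this]
    exact abs_mul_le_of_le hy0 h.abs_lam_le
  exact abs_add_le_of_le (abs_mul_le_of_le (h.abs_alpha_le hp) (h.abs_log_le y))
    (abs_mul_le_of_le (by norm_num) (abs_sub_le_of_le h1 h2))

theorem abs_log_sub_log_le {x y R δ : ℝ} (hx : x ≠ 0) (hy : y ≠ 0) (hx' : |x⁻¹| ≤ R)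
    (hy' : |y⁻¹| ≤ R) (h : |x - y| ≤ δ) : |Real.log x - Real.log y| ≤ R * δ := by
  have key : ∀ {x y : ℝ}, x ≠ 0 → y ≠ 0 → |y⁻¹| ≤ R → |x - y| ≤ δ →
      Real.log x - Real.log y ≤ R * δ := by
    intro x y hx hy hy' h
    rw [← Real.log_abs x, ← Real.log_abs y, ← Real.log_div (abs_ne_zero.2 hx) (abs_ne_zero.2 hy)]
    have h1 := Real.log_le_sub_one_of_pos (div_pos (abs_pos.2 hx) (abs_pos.2 hy))
    have hyp : 0 < |y| := abs_pos.2 hy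
    have h2 : |x| / |y| - 1 = |y⁻¹| * (|x| - |y|) := by
      rw [abs_inv]; field_simp
    rw [h2] at h1
    refine h1.trans ?_
    have h3 : |x| - |y| ≤ δ := (abs_sub_abs_le_abs_sub x y).trans h
    have h4 : 0 ≤ δ := (abs_nonneg _).trans h
    exact (mul_le_mul_of_nonneg_left h3 (abs_nonneg _)).trans (mul_le_mul_of_nonneg_right hy' h4)
  rw [abs_le]
  constructor
  · linarith [key hy hx hx' (by rwa [abs_sub_comm])]
  · exact key hx hy hy' h

/-- Only uniform differences of `a` and `b` enter, no derivatives in space. So Lipschitz continuity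
in time of `a` and `b` suffices to compare weights at different times. -/
theorem abs_wtLog_sub_le {a' b' c' d' : ℝ → ℝ} (h : Coeffs M n R a b c d)
    (h' : Coeffs M n R a' b' c' d') (hp : p ≤ n) {δ : ℝ} (hab : ∀ x, |a x - a' x| ≤ δ)
    (hbb : ∀ x, |b x - b' x| ≤ δ) (x : ℝ) :
    |wtLog M p a b x - wtLog M p a' b' x| ≤ (R * R + 4 * (R * R * R * R)) * δ := by
  have hM0 : 0 < M := hM.out
  have hR1 := h.one_le
  have hδ : 0 ≤ δ := (abs_nonneg _).trans (hab 0)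
  have pd : Function.Periodic (fun x => wtLog M p a b x - wtLog M p a' b' x) M :=
    fun x => by simp only [h.wtLog_periodic x, h'.wtLog_periodic x]
  obtain ⟨y, hy, hxy⟩ := pd.exists_mem_Ico₀ hM0 x
  rw [hxy]
  have hr : ∀ z, |b z / a z - b' z / a' z| ≤ 2 * (R * R * R) * δ := fun z => by
    have e : b z / a z - b' z / a' z =
        (b z - b' z) * (a z)⁻¹ - b' z * ((a z)⁻¹ * ((a z - a' z) * (a' z)⁻¹)) := by
      have := h.a_ne z
      have := h'.a_ne z
      field_simp
      ring
    rw [e]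
    refine (abs_sub_le_of_le (abs_mul_le_of_le (hbb z) (h.inv_le z)) (abs_mul_le_of_le (h'.abs_b_le z)
      (abs_mul_le_of_le (h.inv_le z) (abs_mul_le_of_le (hab z) (h'.inv_le z))))).trans ?_
    have : R ≤ R * R * R := by nlinarith [mul_self_nonneg R]
    nlinarith
  have hint : ∀ z, (∫ y in (0 : ℝ)..z, b y / a y) - (∫ y in (0 : ℝ)..z, b' y / a' y)
      = ∫ y in (0 : ℝ)..z, (b y / a y - b' y / a' y) := fun z =>
    (intervalIntegral.integral_sub (h.cont_ratio.intervalIntegrable _ _)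
      (h'.cont_ratio.intervalIntegrable _ _)).symm
  have hI : ∀ z, 0 ≤ z → |∫ y in (0 : ℝ)..z, (b y / a y - b' y / a' y)| ≤ 2 * (R * R * R) * δ * z :=
    fun z hz => by
      simpa only [abs_of_nonneg hz] using abs_intervalIntegral_le hr z
  have e : wtLog M p a b y - wtLog M p a' b' y =
      (2 * (p : ℝ) / 3 - 1) * (Real.log (a y) - Real.log (a' y)) + 2 / 3 *
        ((∫ y in (0 : ℝ)..y, (b y / a y - b' y / a' y))
          - y / M * ∫ y in (0 : ℝ)..M, (b y / a y - b' y / a' y)) := by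
    rw [← hint, ← hint, wtLog, wtLog]
    ring
  rw [e]
  have h1 := abs_mul_le_of_le (h.abs_alpha_le hp)
    (abs_log_sub_log_le (h.a_ne y) (h'.a_ne y) (h.inv_le y) (h'.inv_le y) (hab y))
  have hyM : y / M ≤ 1 := (div_le_one hM0).2 hy.2.le
  have h2 : |y / M * ∫ y in (0 : ℝ)..M, (b y / a y - b' y / a' y)| ≤ 1 * (2 * (R * R * R) * δ * M) :=
    abs_mul_le_of_le (by rw [abs_of_nonneg (div_nonneg hy.1 hM0.le)]; exact hyM) (hI M hM0.le)
  refine (abs_add_le_of_le h1 (abs_mul_le_of_le (A := 2 / 3) (by norm_num)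
    (abs_sub_le_of_le (hI y hy.1) h2))).trans ?_
  have hR3 : 0 ≤ 2 * (R * R * R) * δ := by positivity
  have h3 := mul_le_mul_of_nonneg_left (hy.2.le.trans h.period_le) hR3
  have h4 := mul_le_mul_of_nonneg_left h.period_le hR3
  have h5 : 0 ≤ R * R * R * R * δ := by positivity
  nlinarith

/-- A uniform bound for the logarithm of the weights. -/
def logBound (R : ℝ) : ℝ := R * R + 2 / 3 * (R * (R * R) + R * (R * R))

theorem wt_pos (x : ℝ) : 0 < wt M p a b x := Real.exp_pos _

theorem wt_le (h : Coeffs M n R a b c d) (hp : p ≤ n) (x : ℝ) :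
    wt M p a b x ≤ Real.exp (logBound R) :=
  Real.exp_le_exp.2 ((le_abs_self _).trans (h.abs_wtLog_le hp x))

theorem le_wt (h : Coeffs M n R a b c d) (hp : p ≤ n) (x : ℝ) :
    Real.exp (-logBound R) ≤ wt M p a b x :=
  Real.exp_le_exp.2 (neg_le_of_abs_le (h.abs_wtLog_le hp x))

theorem abs_wt_le (h : Coeffs M n R a b c d) (hp : p ≤ n) (x : ℝ) :
    |wt M p a b x| ≤ Real.exp (logBound R) := by
  rw [abs_of_pos (wt_pos x)]
  exact h.wt_le hp x

end Coeffs

end WeightedEnergy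

/-! ### Energy estimates for the spatial operator at orders `0` and `n` -/

section EnergyEstimate

variable {M : ℝ} [hM : Fact (0 < M)]

namespace Coeffs

variable {n p : ℕ} {R : ℝ} {a b c d : ℝ → ℝ}

/-- The constant of the weighted energy estimate at one level. -/
def levelConst (R Q : ℝ) : ℝ :=
  1 / 4 * (Real.exp (logBound R) * (3 * R ^ 4 * (3 * R ^ 4 * (2 * R ^ 3) + 2 * R ^ 3)
    + (6 * R ^ 6 * (2 * R ^ 3) + 3 * R ^ 4 * (2 * R ^ 3) + 2 * R ^ 3)))
  + R * R / 2 * (Real.exp (logBound R) * (3 * R ^ 4 * (2 * R ^ 3) + 2 * R ^ 3))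
  + 1 / 2 * (Real.exp (logBound R) * (3 * R ^ 4 * Q + Q))

theorem hasDerivAt_wt (h : Coeffs M n R a b c d) (x : ℝ) :
    HasDerivAt (wt M p a b) (wt M p a b x * wtTau M p a b x) x :=
  (h.hasDerivAt_wtLog x).exp

/-- Here `v` stands for the `p`-th derivative of a solution; the extra `p a'` is what Leibniz' rule
adds to `b`. The constant involves at most three derivatives of `a` and two of `b`. -/
theorem level_energy (h : Coeffs M n R a b c d) (hp : p ≤ n) {v v₁ v₂ v₃ q q₁ : ℝ → ℝ} {Q : ℝ}
    (hv : ∀ x, HasDerivAt v (v₁ x) x) (hv₁ : ∀ x, HasDerivAt v₁ (v₂ x) x)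
    (hv₂ : ∀ x, HasDerivAt v₂ (v₃ x) x) (hq : ∀ x, HasDerivAt q (q₁ x) x)
    (pv : Function.Periodic v M) (pv₁ : Function.Periodic v₁ M) (pv₂ : Function.Periodic v₂ M)
    (pq : Function.Periodic q M) (cv₃ : Continuous v₃) (cq₁ : Continuous q₁)
    (q_le : ∀ x, |q x| ≤ Q) (q₁_le : ∀ x, |q₁ x| ≤ Q) :
    ∫ x in (0 : ℝ)..M, wt M p a b x *
      ((a x * v₃ x + (b x + p * iteratedDeriv 1 a x) * v₂ x + q x * v₁ x) * v x) ≤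
      levelConst R Q * ∫ x in (0 : ℝ)..M, v x ^ 2 := by
  have h4 := h.four_le
  have hR := h.one_le
  set lm := lam M a b with hlm
  -- `w k` is the derivative of `w a`. The higher derivatives of `w a` are expressed through `w`,
  -- `k` and the logarithmic derivative `τ` of `w`, each of which is bounded explicitly in `R`.
  set k : ℝ → ℝ := fun x => 2 / 3 * (b x + p * iteratedDeriv 1 a x - lm * a x) with hk
  set k₁ : ℝ → ℝ := fun x => 2 / 3 * (iteratedDeriv 1 b x + p * iteratedDeriv 2 a x
    - lm * iteratedDeriv 1 a x) with hk₁
  set k₂ : ℝ → ℝ := fun x => 2 / 3 * (iteratedDeriv 2 b x + p * iteratedDeriv 3 a x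
    - lm * iteratedDeriv 2 a x) with hk₂
  set τ := wtTau M p a b with hτ
  set τ₁ : ℝ → ℝ := fun x => (k₁ x - iteratedDeriv 2 a x) * (a x)⁻¹
    + (k x - iteratedDeriv 1 a x) * (-(iteratedDeriv 1 a x * ((a x)⁻¹ * (a x)⁻¹))) with hτ₁
  have da0 : ∀ x, HasDerivAt a (iteratedDeriv 1 a x) x := fun x => by
    simpa using h.ha.hasDerivAt_iter (j := 0) (by lia) x
  have db0 : ∀ x, HasDerivAt b (iteratedDeriv 1 b x) x := fun x => by
    simpa using h.hb.hasDerivAt_iter (j := 0) (by lia) x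
  have da1 := h.ha.hasDerivAt_iter (j := 1) (by lia)
  have da2 := h.ha.hasDerivAt_iter (j := 2) (by lia)
  have db1 := h.hb.hasDerivAt_iter (j := 1) (by lia)
  have dk : ∀ x, HasDerivAt k (k₁ x) x := fun x =>
    (((db0 x).add ((da1 x).const_mul _)).sub ((da0 x).const_mul _)).const_mul _
  have dk₁ : ∀ x, HasDerivAt k₁ (k₂ x) x := fun x =>
    (((db1 x).add ((da2 x).const_mul _)).sub ((da1 x).const_mul _)).const_mul _
  have eτ : τ = fun x => (k x - iteratedDeriv 1 a x) * (a x)⁻¹ := by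
    funext x
    simp only [hτ, wtTau, hk, iteratedDeriv_one, hlm]
  have dτ : ∀ x, HasDerivAt τ (τ₁ x) x := fun x => by
    rw [eτ]
    refine (((dk x).sub (da1 x)).mul ((da0 x).inv (h.a_ne x))).congr_deriv ?_
    simp only [hτ₁, Pi.sub_apply, Pi.inv_apply]
    have := h.a_ne x
    field_simp
  set w := wt M p a b with hw
  have dw : ∀ x, HasDerivAt w (w x * τ x) x := fun x => h.hasDerivAt_wt x
  -- bounds
  have ba : ∀ j ≤ 3, ∀ x, |iteratedDeriv j a x| ≤ R := fun j hj x => h.a_le j (by lia) x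
  have bp : |(p : ℝ)| ≤ R := by
    rw [abs_of_nonneg (Nat.cast_nonneg p)]
    exact (by exact_mod_cast hp : (p : ℝ) ≤ n).trans h.n_le
  have blm : |lm| ≤ R * R := h.abs_lam_le
  have R2 : R ≤ R ^ 3 := by nlinarith [sq_nonneg R, pow_pos (by linarith : 0 < R) 2]
  have R3 : R * R ≤ R ^ 3 := by nlinarith [sq_nonneg R, pow_pos (by linarith : 0 < R) 2]
  have bkk : ∀ {x y z : ℝ}, |x| ≤ R → |y| ≤ R → |z| ≤ R → |2 / 3 * (x + p * y - lm * z)| ≤ 2 * R ^ 3 :=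
    fun hx hy hz => (abs_mul_le_of_le (A := 2 / 3) (by norm_num)
      (abs_sub_le_of_le (abs_add_le_of_le hx (abs_mul_le_of_le bp hy)) (abs_mul_le_of_le blm hz))).trans
      (by nlinarith)
  have bk : ∀ x, |k x| ≤ 2 * R ^ 3 := fun x =>
    bkk (h.abs_b_le x) (ba 1 (by lia) x) (h.abs_a_le x)
  have bk₁ : ∀ x, |k₁ x| ≤ 2 * R ^ 3 := fun x =>
    bkk (h.b_le 1 (by lia) x) (ba 2 (by lia) x) (ba 1 (by lia) x)
  have bk₂ : ∀ x, |k₂ x| ≤ 2 * R ^ 3 := fun x =>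
    bkk (h.b_le 2 (by lia) x) (ba 3 (by lia) x) (ba 2 (by lia) x)
  have bτ : ∀ x, |τ x| ≤ 3 * R ^ 4 := fun x => by
    rw [eτ]
    refine (abs_mul_le_of_le (abs_sub_le_of_le (bk x) (ba 1 (by lia) x)) (h.inv_le x)).trans ?_
    nlinarith
  have R4 : R ^ 4 ≤ R ^ 6 := pow_le_pow_right₀ hR (by lia)
  have bτ₁ : ∀ x, |τ₁ x| ≤ 6 * R ^ 6 := fun x => by
    refine (abs_add_le_of_le
      (abs_mul_le_of_le (abs_sub_le_of_le (bk₁ x) (ba 2 (by lia) x)) (h.inv_le x))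
      (abs_mul_le_of_le (abs_sub_le_of_le (bk x) (ba 1 (by lia) x)) (B := R * (R * R)) ?_)).trans ?_
    · rw [abs_neg]
      exact abs_mul_le_of_le (ba 1 (by lia) x) (abs_mul_le_of_le (h.inv_le x) (h.inv_le x))
    · nlinarith [pow_pos (by linarith : 0 < R) 3]
  have bw : ∀ x, |w x| ≤ Real.exp (logBound R) := h.abs_wt_le hp
  -- periodicity
  have pa := h.ha.per
  have pw : Function.Periodic w M := h.perC_one_wt.per
  have pa1 := PerC.iterDeriv_periodic pa 1
  have pa2 := PerC.iterDeriv_periodic pa 2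
  have pb1 := PerC.iterDeriv_periodic h.hb.per 1
  have pk : Function.Periodic k M := fun x => by simp only [hk, h.hb.per x, pa x, pa1 x]
  have pk₁ : Function.Periodic k₁ M := fun x => by simp only [hk₁, pb1 x, pa2 x, pa1 x]
  have pτ : Function.Periodic τ M := fun x => by simp only [eτ, pk x, pa1 x, pa x]
  -- continuity
  have cw : Continuous w := h.perC_one_wt.cont
  have cont : ∀ {f f' : ℝ → ℝ}, (∀ x, HasDerivAt f (f' x) x) → Continuous f := fun h =>
    continuous_iff_continuousAt.2 fun x => (h x).continuousAt
  have ck := cont dk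
  have ck₁ := cont dk₁
  have cτ := cont dτ
  have cq := cont hq
  have ca := cont da0
  have ca1 := cont da1
  have ca2 := cont da2
  have ca3 : Continuous (iteratedDeriv 3 a) := (h.ha.iter (l := 0) (j := 3) (by lia)).cont
  have cb2 : Continuous (iteratedDeriv 2 b) := (h.hb.iter (l := 0) (j := 2) (by lia)).cont
  have ck₂ : Continuous k₂ := by fun_prop
  have cinv : Continuous fun x => (a x)⁻¹ := ca.inv₀ h.a_ne
  have cτ₁ : Continuous τ₁ := by fun_prop
  have key := integral_weighted_energy_le (M := M) (lam := lm)
    (g := fun x => w x * a x) (g₁ := fun x => w x * k x) (g₂ := fun x => w x * (τ x * k x + k₁ x))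
    (g₃ := fun x => w x * (τ x * (τ x * k x + k₁ x) + (τ₁ x * k x + τ x * k₁ x + k₂ x)))
    (s := fun x => w x * q x) (s₁ := fun x => w x * (τ x * q x + q₁ x))
    (v := v) (v₁ := v₁) (v₂ := v₂) (v₃ := v₃) (C := levelConst R Q)
    (fun x => ((dw x).mul (da0 x)).congr_deriv (by
      simp only [eτ]
      have := h.a_ne x
      field_simp
      ring))
    (fun x => ((dw x).mul (dk x)).congr_deriv (by ring))
    (fun x => ((dw x).mul (((dτ x).mul (dk x)).add (dk₁ x))).congr_deriv (by
      simp only [Pi.mul_apply, Pi.add_apply]; ring))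
    (fun x => ((dw x).mul (hq x)).congr_deriv (by ring))
    hv hv₁ hv₂
    (fun x => by simp only [pw x, pa x]) (fun x => by simp only [pw x, pk x])
    (fun x => by simp only [pw x, pτ x, pk x, pk₁ x]) (fun x => by simp only [pw x, pq x])
    pv pv₁ pv₂ (by fun_prop) (by fun_prop) cv₃
    (fun x => by
      have h1 := mul_nonneg (wt_pos (M := M) (p := p) (a := a) (b := b) x).le (h.lam_mul_nonneg x)
      rw [← hlm, ← hw] at h1
      linarith)
    (fun x => abs_sub_le_of_le (abs_add_le_of_le (abs_mul_le_of_le (by norm_num)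
      (abs_mul_le_of_le (bw x) (abs_add_le_of_le (abs_mul_le_of_le (bτ x) (abs_add_le_of_le
        (abs_mul_le_of_le (bτ x) (bk x)) (bk₁ x))) (abs_add_le_of_le (abs_add_le_of_le
        (abs_mul_le_of_le (bτ₁ x) (bk x)) (abs_mul_le_of_le (bτ x) (bk₁ x))) (bk₂ x)))))
      (abs_mul_le_of_le (by
          rw [abs_div, abs_two]
          exact div_le_div_of_nonneg_right blm zero_le_two)
        (abs_mul_le_of_le (bw x) (abs_add_le_of_le (abs_mul_le_of_le (bτ x) (bk x)) (bk₁ x)))))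
      (abs_mul_le_of_le (by norm_num) (abs_mul_le_of_le (bw x)
        (abs_add_le_of_le (abs_mul_le_of_le (bτ x) (q_le x)) (q₁_le x)))))
  refine le_of_eq_of_le (intervalIntegral.integral_congr fun x _ => ?_) key
  simp only [hk]
  ring

end Coeffs

/-- The spatial operator of the equation on classical functions. -/
def spatialOp (a b c d u : ℝ → ℝ) (x : ℝ) : ℝ :=
  a x * iteratedDeriv 3 u x + b x * iteratedDeriv 2 u x + c x * iteratedDeriv 1 u x + d x * u x

/-- The subtracted terms, `i < k`, are those in which `u` carries more than `n` derivatives. In the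
others both factors carry at most `n`, and the binomial coefficients add up to at most `2^n`. -/
theorem abs_leibniz_remainder_le {n k : ℕ} {f u : ℝ → ℝ} {R S x : ℝ} (hk : k ≤ n) (hR : 0 ≤ R)
    (hf : ContDiff ℝ n f) (hu : PerC M (n + k) u)
    (f_le : ∀ j ≤ n, |iteratedDeriv j f x| ≤ R) (u_le : ∀ j ≤ n, |iteratedDeriv j u x| ≤ S) :
    |iteratedDeriv n (fun y => f y * iteratedDeriv k u y) x
      - ∑ i ∈ Finset.range k, n.choose i * iteratedDeriv i f x * iteratedDeriv (n - i + k) u x| ≤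
      2 ^ n * (R * S) := by
  have huk : ContDiff ℝ n (iteratedDeriv k u) := (hu.iter (l := n) (j := k) le_rfl).smooth
  have hcomp : ∀ m, iteratedDeriv m (iteratedDeriv k u) = iteratedDeriv (m + k) u := fun m => by
    simp only [iteratedDeriv_eq_iterate, Function.iterate_add_apply]
  rw [iteratedDeriv_fun_mul hf.contDiffAt huk.contDiffAt,
    ← Finset.sum_range_add_sum_Ico _ (show k ≤ n + 1 by lia)]
  simp only [hcomp]
  rw [add_sub_cancel_left]
  have hS : 0 ≤ S := (abs_nonneg _).trans (u_le 0 (by lia))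
  calc |∑ i ∈ Finset.Ico k (n + 1), (n.choose i : ℝ) * iteratedDeriv i f x * iteratedDeriv (n - i + k) u x|
      ≤ ∑ i ∈ Finset.Ico k (n + 1), (n.choose i : ℝ) * (R * S) := by
        refine (Finset.abs_sum_le_sum_abs _ _).trans (Finset.sum_le_sum fun i hi => ?_)
        rw [Finset.mem_Ico] at hi
        rw [mul_assoc, abs_mul, Nat.abs_cast]
        exact mul_le_mul_of_nonneg_left (abs_mul_le_of_le (f_le i (by lia)) (u_le _ (by lia)))
          (Nat.cast_nonneg _)
    _ ≤ ∑ i ∈ Finset.range (n + 1), (n.choose i : ℝ) * (R * S) := by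
        refine Finset.sum_le_sum_of_subset_of_nonneg (fun i hi => ?_) fun i _ _ => by positivity
        simp only [Finset.mem_Ico, Finset.mem_range] at *
        lia
    _ = 2 ^ n * (R * S) := by
        rw [← Finset.sum_mul]
        congr 1
        exact_mod_cast Nat.sum_range_choose n

namespace Coeffs

variable {n : ℕ} {R : ℝ} {a b c d : ℝ → ℝ}

theorem perC_spatialOp (h : Coeffs M n R a b c d) {u : ℝ → ℝ} {l : ℕ} (hl : l ≤ n)
    (hu : PerC M (l + 3) u) : PerC M l (spatialOp a b c d u) :=
  ((((h.ha.mono (by lia)).mul (hu.iter (j := 3) (by lia))).add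
    ((h.hb.mono (by lia)).mul (hu.iter (j := 2) (by lia)))).add
    ((h.hc.mono (by lia)).mul (hu.iter (j := 1) (by lia)))).add
    ((h.hd.mono (by lia)).mul (hu.mono (by lia)))

/-- Leibniz' rule applied to the four terms, with `k = 3, 2, 1, 0`. Collecting the terms of orders
`n + 3`, `n + 2` and `n + 1` gives the displayed third order expression in the `n`-th derivative of
`u`. -/
theorem abs_iter_spatialOp_sub_le (h : Coeffs M n R a b c d) {u : ℝ → ℝ} (hu : PerC M (n + 3) u)
    (x : ℝ) :
    |iteratedDeriv n (spatialOp a b c d u) x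
      - (a x * iteratedDeriv (n + 3) u x + (b x + n * iteratedDeriv 1 a x) * iteratedDeriv (n + 2) u x
        + (c x + n * iteratedDeriv 1 b x + n.choose 2 * iteratedDeriv 2 a x)
          * iteratedDeriv (n + 1) u x)| ≤
      4 * (2 ^ n * (R * ∑ j ∈ Finset.range (n + 1), |iteratedDeriv j u x|)) := by
  have h4 := h.four_le
  have hR : 0 ≤ R := zero_le_one.trans h.one_le
  have hS : ∀ j ≤ n, |iteratedDeriv j u x| ≤ ∑ j ∈ Finset.range (n + 1), |iteratedDeriv j u x| :=
    fun j hj => Finset.single_le_sum (f := fun j => |iteratedDeriv j u x|) (fun _ _ => abs_nonneg _)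
      (Finset.mem_range.2 (by lia))
  generalize ∑ j ∈ Finset.range (n + 1), |iteratedDeriv j u x| = S at hS ⊢
  have ta := h.ha.mono (l := n) (by lia)
  have tb := h.hb.mono (l := n) (by lia)
  have r3 := abs_leibniz_remainder_le (k := 3) (by lia) hR ta.smooth hu
    (fun j hj => h.a_le j (by lia) x) hS
  have r2 := abs_leibniz_remainder_le (k := 2) (by lia) hR tb.smooth (hu.mono (by lia))
    (fun j hj => h.b_le j hj x) hS
  have r1 := abs_leibniz_remainder_le (k := 1) (by lia) hR h.hc.smooth (hu.mono (by lia))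
    (fun j hj => h.c_le j hj x) hS
  have r0 := abs_leibniz_remainder_le (k := 0) (by lia) hR h.hd.smooth (hu.mono (by lia))
    (fun j hj => h.d_le j hj x) hS
  have e1 : iteratedDeriv n (spatialOp a b c d u) x =
      iteratedDeriv n (fun y => a y * iteratedDeriv 3 u y) x
      + iteratedDeriv n (fun y => b y * iteratedDeriv 2 u y) x
      + iteratedDeriv n (fun y => c y * iteratedDeriv 1 u y) x
      + iteratedDeriv n (fun y => d y * iteratedDeriv 0 u y) x := by
    have s3 := (ta.mul (hu.iter (l := n) (j := 3) (by lia))).smooth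
    have s2 := (tb.mul (hu.iter (l := n) (j := 2) (by lia))).smooth
    have s1 := (h.hc.mul (hu.iter (l := n) (j := 1) (by lia))).smooth
    have s0 := (h.hd.mul (hu.iter (l := n) (j := 0) (by lia))).smooth
    rw [← iteratedDeriv_fun_add s3.contDiffAt s2.contDiffAt,
      ← iteratedDeriv_fun_add (s3.add s2).contDiffAt s1.contDiffAt,
      ← iteratedDeriv_fun_add ((s3.add s2).add s1).contDiffAt s0.contDiffAt]
    rfl
  have i1 : n - 1 + 3 = n + 2 := by lia
  have i2 : n - 2 + 3 = n + 1 := by lia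
  have i3 : n - 1 + 2 = n + 1 := by lia
  simp only [Finset.sum_range_succ, Finset.sum_range_zero, Nat.choose_zero_right, Nat.choose_one_right,
    Nat.sub_zero, i1, i2, i3, iteratedDeriv_zero, Nat.cast_one, one_mul, zero_add, add_zero,
    sub_zero] at r3 r2 r1 r0
  have e0 : iteratedDeriv n (fun y => d y * iteratedDeriv 0 u y) x =
      iteratedDeriv n (fun y => d y * u y) x := by simp only [iteratedDeriv_zero]
  rw [e1, e0]
  have := abs_add_le_of_le (abs_add_le_of_le (abs_add_le_of_le r3 r2) r1) r0
  refine le_of_eq_of_le (congrArg abs ?_) (this.trans (le_of_eq ?_)) <;> ring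

/-- The constant of the `L²` energy estimate. -/
def baseConst (R : ℝ) : ℝ := levelConst R R + Real.exp (logBound R) * R

/-- The level estimate with `p = 0` and `q = c`; the zeroth order term is bounded directly. -/
theorem base_energy (h : Coeffs M n R a b c d) {u : ℝ → ℝ} (hu : PerC M 3 u) :
    ∫ x in (0 : ℝ)..M, wt M 0 a b x * (spatialOp a b c d u x * u x) ≤
      baseConst R * ∫ x in (0 : ℝ)..M, u x ^ 2 := by
  have h4 := h.four_le
  have du : ∀ x, HasDerivAt u (iteratedDeriv 1 u x) x := fun x => by
    simpa using hu.hasDerivAt_iter (j := 0) (by lia) x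
  have dc : ∀ x, HasDerivAt c (iteratedDeriv 1 c x) x := fun x => by
    simpa using h.hc.hasDerivAt_iter (j := 0) (by lia) x
  have u3 := hu.iter (l := 0) (j := 3) (by lia)
  have u2 := hu.iter (l := 0) (j := 2) (by lia)
  have u1 := hu.iter (l := 0) (j := 1) (by lia)
  have u0 := hu.mono (l := 0) (by lia)
  have key := h.level_energy (p := 0) (by lia) du (hu.hasDerivAt_iter (j := 1) (by lia))
    (hu.hasDerivAt_iter (j := 2) (by lia)) dc hu.per u1.per u2.per h.hc.per u3.cont
    (h.hc.iter (l := 0) (j := 1) (by lia)).cont (fun x => by simpa using h.c_le 0 (by lia) x)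
    (h.c_le 1 (by lia))
  have cw : Continuous (wt M 0 a b) := h.perC_one_wt.cont
  have ca := h.ha.cont
  have cb := h.hb.cont
  have cc := h.hc.cont
  have cd := h.hd.cont
  have cu := u0.cont
  have cu1 := u1.cont
  have cu2 := u2.cont
  have cu3 := u3.cont
  have cu3' : Continuous (iteratedDeriv (2 + 1) u) := cu3
  have cu2' : Continuous (iteratedDeriv (1 + 1) u) := cu2
  have c1 : Continuous fun x => wt M 0 a b x * ((a x * iteratedDeriv (2 + 1) u x
      + (b x + (0 : ℕ) * iteratedDeriv 1 a x) * iteratedDeriv (1 + 1) u x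
      + c x * iteratedDeriv 1 u x) * u x) := by
    simp only [Nat.cast_zero, zero_mul, add_zero]
    fun_prop
  have c2 : Continuous fun x => Real.exp (logBound R) * R * u x ^ 2 := by fun_prop
  have c3 : Continuous fun x => wt M 0 a b x * (spatialOp a b c d u x * u x) := by
    unfold spatialOp
    fun_prop
  rw [baseConst, add_mul, ← intervalIntegral.integral_const_mul (Real.exp (logBound R) * R)]
  refine le_trans ?_ (add_le_add_left key _)
  rw [← intervalIntegral.integral_add (c1.intervalIntegrable _ _) (c2.intervalIntegrable _ _)]
  refine intervalIntegral.integral_mono_on hM.out.le (c3.intervalIntegrable _ _)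
    ((c1.add c2).intervalIntegrable _ _) fun x _ => ?_
  have b1 : wt M 0 a b x * d x ≤ Real.exp (logBound R) * R :=
    (le_abs_self _).trans (abs_mul_le_of_le (h.abs_wt_le (by lia) x)
      (by simpa using h.d_le 0 (by lia) x))
  have b2 := mul_le_mul_of_nonneg_right b1 (sq_nonneg (u x))
  simp only [spatialOp, Nat.cast_zero, zero_mul, add_zero]
  have e : wt M 0 a b x * ((a x * iteratedDeriv 3 u x + b x * iteratedDeriv 2 u x
      + c x * iteratedDeriv 1 u x + d x * u x) * u x) =
      wt M 0 a b x * ((a x * iteratedDeriv 3 u x + b x * iteratedDeriv 2 u x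
      + c x * iteratedDeriv 1 u x) * u x) + wt M 0 a b x * d x * u x ^ 2 := by ring
  rw [e]
  linarith

/-- The constant of the energy estimate of order `n`. -/
def topConst (R : ℝ) (n : ℕ) : ℝ :=
  levelConst R (R + R * R + 2 ^ n * R)
    + Real.exp (logBound R) * (1 / 2 * (4 * (2 ^ n * R)) ^ 2 * (n + 1) * (n + 1) + 1 / 2)

/-- The level estimate with `p = n` absorbs the three terms of order above `n`. The Leibniz
remainder contains only derivatives up to `n`; Young's inequality and control of the intermediate
derivatives by the extreme ones dispose of it. -/
theorem top_energy (h : Coeffs M n R a b c d) {u : ℝ → ℝ} (hu : PerC M (n + 3) u) :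
    ∫ x in (0 : ℝ)..M, wt M n a b x * (iteratedDeriv n (spatialOp a b c d u) x * iteratedDeriv n u x) ≤
      topConst R n * ((∫ x in (0 : ℝ)..M, u x ^ 2) + ∫ x in (0 : ℝ)..M, iteratedDeriv n u x ^ 2) := by
  have h4 := h.four_le
  have hR := h.one_le
  have u3 := hu.iter (l := 0) (j := n + 3) (by lia)
  have u2 := hu.iter (l := 0) (j := n + 2) (by lia)
  have u1 := hu.iter (l := 0) (j := n + 1) (by lia)
  have u0 := hu.iter (l := 0) (j := n) (by lia)
  set q : ℝ → ℝ := fun x => c x + n * iteratedDeriv 1 b x + n.choose 2 * iteratedDeriv 2 a x with hq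
  set q₁ : ℝ → ℝ := fun x => iteratedDeriv 1 c x + n * iteratedDeriv 2 b x
    + n.choose 2 * iteratedDeriv 3 a x with hq₁
  have dc : ∀ x, HasDerivAt c (iteratedDeriv 1 c x) x := fun x => by
    simpa using h.hc.hasDerivAt_iter (j := 0) (by lia) x
  have pq : PerC M 0 q := ((h.hc.mono (by lia)).add
    ((h.hb.iter (l := 0) (j := 1) (by lia)).const_mul _)).add
    ((h.ha.iter (l := 0) (j := 2) (by lia)).const_mul _)
  have pq₁ : PerC M 0 q₁ := ((h.hc.iter (l := 0) (j := 1) (by lia)).add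
    ((h.hb.iter (l := 0) (j := 2) (by lia)).const_mul _)).add
    ((h.ha.iter (l := 0) (j := 3) (by lia)).const_mul _)
  have dq : ∀ x, HasDerivAt q (q₁ x) x := fun x =>
    ((dc x).add ((h.hb.hasDerivAt_iter (j := 1) (by lia) x).const_mul _)).add
      ((h.ha.hasDerivAt_iter (j := 2) (by lia) x).const_mul _)
  have bch : |(n.choose 2 : ℝ)| ≤ 2 ^ n := by
    rw [Nat.abs_cast]
    exact_mod_cast Nat.choose_le_two_pow n 2
  have bn : |(n : ℝ)| ≤ R := by rw [Nat.abs_cast]; exact h.n_le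
  have bq : ∀ x, |q x| ≤ R + R * R + 2 ^ n * R := fun x =>
    abs_add_le_of_le (abs_add_le_of_le (by simpa using h.c_le 0 (by lia) x)
      (abs_mul_le_of_le bn (h.b_le 1 (by lia) x))) (abs_mul_le_of_le bch (h.a_le 2 (by lia) x))
  have bq₁ : ∀ x, |q₁ x| ≤ R + R * R + 2 ^ n * R := fun x =>
    abs_add_le_of_le (abs_add_le_of_le (h.c_le 1 (by lia) x)
      (abs_mul_le_of_le bn (h.b_le 2 (by lia) x))) (abs_mul_le_of_le bch (h.a_le 3 (by lia) x))
  have key := h.level_energy (p := n) le_rfl (hu.hasDerivAt_iter (j := n) (by lia))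
    (hu.hasDerivAt_iter (j := n + 1) (by lia)) (hu.hasDerivAt_iter (j := n + 2) (by lia)) dq
    u0.per u1.per u2.per pq.per u3.cont pq₁.cont bq bq₁
  set N : ℝ := (∫ x in (0 : ℝ)..M, u x ^ 2) + ∫ x in (0 : ℝ)..M, iteratedDeriv n u x ^ 2 with hN
  set A : ℝ := 1 / 2 * (4 * (2 ^ n * R)) ^ 2 * (n + 1) with hA
  set E : ℝ := Real.exp (logBound R) with hE
  have hE0 : 0 ≤ E := (Real.exp_pos _).le
  have hA0 : 0 ≤ A := by positivity
  have cj : ∀ j ∈ Finset.range (n + 1), Continuous fun x => iteratedDeriv j u x ^ 2 := fun j hj =>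
    (hu.iter (l := 0) (j := j) (by have := Finset.mem_range.1 hj; lia)).cont.pow 2
  have c2 : Continuous fun x => E * (A * ∑ j ∈ Finset.range (n + 1), iteratedDeriv j u x ^ 2
      + 1 / 2 * iteratedDeriv n u x ^ 2) :=
    continuous_const.mul ((continuous_const.mul (continuous_finsetSum _ cj)).add
      (continuous_const.mul (u0.cont.pow 2)))
  have hint : ∫ x in (0 : ℝ)..M, E * (A * ∑ j ∈ Finset.range (n + 1), iteratedDeriv j u x ^ 2
      + 1 / 2 * iteratedDeriv n u x ^ 2) ≤ E * (A * (n + 1) + 1 / 2) * N := by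
    have i1 : Continuous fun x => A * ∑ j ∈ Finset.range (n + 1), iteratedDeriv j u x ^ 2 :=
      continuous_const.mul (continuous_finsetSum _ cj)
    have i2 : Continuous fun x => 1 / 2 * iteratedDeriv n u x ^ 2 :=
      continuous_const.mul (u0.cont.pow 2)
    rw [intervalIntegral.integral_const_mul, intervalIntegral.integral_add
      (i1.intervalIntegrable _ _) (i2.intervalIntegrable _ _),
      intervalIntegral.integral_const_mul, intervalIntegral.integral_const_mul,
      intervalIntegral.integral_finsetSum (fun j hj => (cj j hj).intervalIntegrable _ _)]
    have h1 : ∑ j ∈ Finset.range (n + 1), ∫ x in (0 : ℝ)..M, iteratedDeriv j u x ^ 2 ≤ (n + 1) * N := by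
      refine (Finset.sum_le_card_nsmul _ _ N fun j hj => ?_).trans (by simp)
      exact integral_iter_sq_le (by have := Finset.mem_range.1 hj; lia) (hu.mono (by lia))
    have h2 : ∫ x in (0 : ℝ)..M, iteratedDeriv n u x ^ 2 ≤ N :=
      integral_iter_sq_le le_rfl (hu.mono (by lia))
    have h3 := mul_le_mul_of_nonneg_left h1 hA0
    have := mul_le_mul_of_nonneg_left
      (add_le_add h3 (mul_le_mul_of_nonneg_left h2 (by norm_num : (0 : ℝ) ≤ 1 / 2))) hE0
    linarith
  have cw : Continuous (wt M n a b) := h.perC_one_wt.cont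
  have ca := h.ha.cont
  have cb := h.hb.cont
  have ca1 : Continuous (iteratedDeriv 1 a) := (h.ha.iter (l := 0) (j := 1) (by lia)).cont
  have cq := pq.cont
  have cu0 := u0.cont
  have cu1 := u1.cont
  have cu2 : Continuous (iteratedDeriv (n + 1 + 1) u) := u2.cont
  have cu3 : Continuous (iteratedDeriv (n + 2 + 1) u) := u3.cont
  have c1 : Continuous fun x => wt M n a b x * ((a x * iteratedDeriv (n + 2 + 1) u x
      + (b x + n * iteratedDeriv 1 a x) * iteratedDeriv (n + 1 + 1) u x
      + q x * iteratedDeriv (n + 1) u x) * iteratedDeriv n u x) := by fun_prop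
  have cL : Continuous (iteratedDeriv n (spatialOp a b c d u)) :=
    ((h.perC_spatialOp le_rfl hu).iter (l := 0) (j := n) (by lia)).cont
  have c3 : Continuous fun x => wt M n a b x *
      (iteratedDeriv n (spatialOp a b c d u) x * iteratedDeriv n u x) := by fun_prop
  have hvN : ∫ x in (0 : ℝ)..M, iteratedDeriv n u x ^ 2 ≤ N :=
    integral_iter_sq_le le_rfl (hu.mono (by lia))
  have hlc : 0 ≤ levelConst R (R + R * R + 2 ^ n * R) := by
    have := (Real.exp_pos (logBound R)).le
    rw [levelConst]
    positivity
  rw [topConst, add_mul]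
  refine le_trans ?_ (add_le_add (key.trans (mul_le_mul_of_nonneg_left hvN hlc)) hint)
  rw [← intervalIntegral.integral_add (c1.intervalIntegrable _ _) (c2.intervalIntegrable _ _)]
  refine intervalIntegral.integral_mono_on hM.out.le (c3.intervalIntegrable _ _)
    ((c1.add c2).intervalIntegrable _ _) fun x _ => ?_
  have hrem := h.abs_iter_spatialOp_sub_le hu x
  set G := a x * iteratedDeriv (n + 3) u x + (b x + n * iteratedDeriv 1 a x) * iteratedDeriv (n + 2) u x
    + (c x + n * iteratedDeriv 1 b x + n.choose 2 * iteratedDeriv 2 a x) * iteratedDeriv (n + 1) u x with hG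
  set D := iteratedDeriv n (spatialOp a b c d u) x - G with hD
  set S := ∑ j ∈ Finset.range (n + 1), |iteratedDeriv j u x| with hS
  have hS2 : S ^ 2 ≤ (n + 1) * ∑ j ∈ Finset.range (n + 1), iteratedDeriv j u x ^ 2 := by
    have := sq_sum_le_card_mul_sum_sq (s := Finset.range (n + 1)) (f := fun j => |iteratedDeriv j u x|)
    simpa using this
  have hD2 : 1 / 2 * D ^ 2 ≤ A * ∑ j ∈ Finset.range (n + 1), iteratedDeriv j u x ^ 2 := by
    have h1 : D ^ 2 ≤ (4 * (2 ^ n * (R * S))) ^ 2 := by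
      rw [← sq_abs D]
      exact pow_le_pow_left₀ (abs_nonneg _) hrem 2
    have h2 : (4 * (2 ^ n * (R * S))) ^ 2 = (4 * (2 ^ n * R)) ^ 2 * S ^ 2 := by ring
    have h3 := mul_le_mul_of_nonneg_left hS2 (sq_nonneg (4 * (2 ^ n * R)))
    rw [hA]
    linarith
  have hw0 := (wt_pos (M := M) (p := n) (a := a) (b := b) x).le
  have hwE := h.wt_le (p := n) le_rfl x
  have hDv : wt M n a b x * (D * iteratedDeriv n u x) ≤
      E * (A * ∑ j ∈ Finset.range (n + 1), iteratedDeriv j u x ^ 2 + 1 / 2 * iteratedDeriv n u x ^ 2) := by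
    have h1 : D * iteratedDeriv n u x ≤ 1 / 2 * D ^ 2 + 1 / 2 * iteratedDeriv n u x ^ 2 := by
      linarith [sq_nonneg (D - iteratedDeriv n u x)]
    have h2 : 0 ≤ 1 / 2 * D ^ 2 + 1 / 2 * iteratedDeriv n u x ^ 2 := by positivity
    calc _ ≤ wt M n a b x * (1 / 2 * D ^ 2 + 1 / 2 * iteratedDeriv n u x ^ 2) :=
          mul_le_mul_of_nonneg_left h1 hw0
      _ ≤ E * (1 / 2 * D ^ 2 + 1 / 2 * iteratedDeriv n u x ^ 2) := mul_le_mul_of_nonneg_right hwE h2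
      _ ≤ _ := mul_le_mul_of_nonneg_left (by linarith) hE0
  have e : iteratedDeriv n (spatialOp a b c d u) x = G + D := by rw [hD]; ring
  rw [e]
  have e2 : wt M n a b x * ((G + D) * iteratedDeriv n u x) =
    wt M n a b x * (G * iteratedDeriv n u x) + wt M n a b x * (D * iteratedDeriv n u x) := by ring
  rw [e2]
  exact add_le_add_right hDv _

end Coeffs

end EnergyEstimate

/-! ### Global solutions of Lipschitz ordinary differential equations -/

section GlobalODE

variable {E : Type*} [NormedAddCommGroup E] [NormedSpace ℝ E] [CompleteSpace E]

theorem abs_integral_exp_abs_le {l : ℝ} (hl : 0 < l) (x : ℝ) :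
    |∫ s in (0 : ℝ)..x, Real.exp (l * |s|)| ≤ Real.exp (l * |x|) / l := by
  have pos : ∀ y : ℝ, 0 ≤ y → |∫ s in (0 : ℝ)..y, Real.exp (l * |s|)| ≤ Real.exp (l * |y|) / l := by
    intro y hy
    have h1 : ∫ s in (0 : ℝ)..y, Real.exp (l * |s|) = ∫ s in (0 : ℝ)..y, Real.exp (l * s) := by
      refine intervalIntegral.integral_congr fun s hs => ?_
      rw [uIcc_of_le hy] at hs
      simp only [abs_of_nonneg hs.1]
    have h2 : ∀ s : ℝ, HasDerivAt (fun s => Real.exp (l * s) / l) (Real.exp (l * s)) s := fun s => by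
      have := (((hasDerivAt_id s).const_mul l).exp).div_const l
      refine this.congr_deriv ?_
      simp only [id]
      field_simp
    rw [h1, intervalIntegral.integral_eq_sub_of_hasDerivAt (fun s _ => h2 s)
      ((by fun_prop : Continuous fun s => Real.exp (l * s)).intervalIntegrable _ _), abs_of_nonneg hy]
    rw [mul_zero, Real.exp_zero, abs_of_nonneg]
    · have : 0 < 1 / l := by positivity
      linarith
    · rw [← sub_div]
      exact div_nonneg (by linarith [Real.one_le_exp (mul_nonneg hl.le hy)]) hl.le
  rcases le_total 0 x with hx | hx
  · exact pos x hx
  · have h3 := intervalIntegral.integral_comp_neg (a := 0) (b := x) fun s => Real.exp (l * |s|)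
    simp only [abs_neg, neg_zero] at h3
    rw [h3, intervalIntegral.integral_symm, abs_neg, ← abs_neg x]
    exact pos (-x) (by linarith)

/-- Global existence for an ordinary differential equation with globally Lipschitz right-hand
side. -/
theorem exists_global_ode_solution {f : ℝ → E → E} (hf : Continuous (Function.uncurry f)) {K B : ℝ}
    (hK : 0 < K) (hlip : ∀ x y z, ‖f x y - f x z‖ ≤ K * ‖y - z‖) (hB : ∀ x, ‖f x 0‖ ≤ B) (y₀ : E) :
    ∃ Y : ℝ → E, Y 0 = y₀ ∧ ∀ x, HasDerivAt Y (f x (Y x)) x := by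
  -- In the norm `sup exp(-l |x|) ‖Y x‖` over the whole line, Picard's map has Lipschitz constant `K
  -- / l = 1/2`. The bounded unknown `Z` below is `Y` rescaled by `exp(-l |x|)`.
  set l : ℝ := 2 * K with hl
  have hl0 : 0 < l := by positivity
  have hB0 : 0 ≤ B := (norm_nonneg _).trans (hB 0)
  have hcont : ∀ Z : BoundedContinuousFunction ℝ E,
      Continuous fun s => f s (Real.exp (l * |s|) • Z s) := fun Z => by
    have : Continuous fun s : ℝ => (s, Real.exp (l * |s|) • Z s) := by fun_prop
    exact hf.comp this
  have hlin : ∀ s y, ‖f s y‖ ≤ K * ‖y‖ + B := fun s y => by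
    have h1 := hlip s y 0
    rw [sub_zero] at h1
    have h2 := norm_sub_norm_le (f s y) (f s 0)
    linarith [hB s]
  have hexp : ∀ x : ℝ, Real.exp (-(l * |x|)) * (Real.exp (l * |x|) / l) = 1 / l := fun x => by
    rw [Real.exp_neg]
    have := Real.exp_ne_zero (l * |x|)
    field_simp
  have hbd : ∀ (C : ℝ) (g : ℝ → E), (∀ s, ‖g s‖ ≤ C * Real.exp (l * |s|)) → 0 ≤ C → ∀ x : ℝ,
      Real.exp (-(l * |x|)) * ‖∫ s in (0 : ℝ)..x, g s‖ ≤ C / l := by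
    intro C g hg hC x
    have h1 : ‖∫ s in (0 : ℝ)..x, g s‖ ≤ |∫ s in (0 : ℝ)..x, C * Real.exp (l * |s|)| :=
      intervalIntegral.norm_integral_le_abs_of_norm_le (Eventually.of_forall fun s => hg s)
        ((by fun_prop : Continuous fun s : ℝ => C * Real.exp (l * |s|)).intervalIntegrable _ _)
    rw [intervalIntegral.integral_const_mul, abs_mul, abs_of_nonneg hC] at h1
    have h2 := mul_le_mul_of_nonneg_left (h1.trans
      (mul_le_mul_of_nonneg_left (abs_integral_exp_abs_le hl0 x) hC)) (Real.exp_pos (-(l * |x|))).le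
    refine h2.trans (le_of_eq ?_)
    rw [mul_left_comm, hexp, mul_one_div]
  let Φ : BoundedContinuousFunction ℝ E → BoundedContinuousFunction ℝ E := fun Z =>
    BoundedContinuousFunction.ofNormedAddCommGroup
      (fun x => Real.exp (-(l * |x|)) • (y₀ + ∫ s in (0 : ℝ)..x, f s (Real.exp (l * |s|) • Z s)))
      (by
        have := intervalIntegral.continuous_primitive
          (fun a b => (hcont Z).intervalIntegrable a b (μ := volume)) 0
        fun_prop)
      (‖y₀‖ + (K * ‖Z‖ + B) / l)
      (fun x => by
        rw [norm_smul, Real.norm_of_nonneg (Real.exp_pos _).le]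
        have h1 : Real.exp (-(l * |x|)) ≤ 1 := Real.exp_le_one_iff.2 (by
          have := mul_nonneg hl0.le (abs_nonneg x); linarith)
        have h2 := hbd (K * ‖Z‖ + B) (fun s => f s (Real.exp (l * |s|) • Z s)) (fun s => by
          refine (hlin _ _).trans ?_
          rw [norm_smul, Real.norm_of_nonneg (Real.exp_pos _).le]
          have h3 := Z.norm_coe_le_norm s
          have h4 : 1 ≤ Real.exp (l * |s|) := Real.one_le_exp (mul_nonneg hl0.le (abs_nonneg s))
          have h5 := mul_le_mul_of_nonneg_left h3 (mul_nonneg hK.le (Real.exp_pos (l * |s|)).le)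
          nlinarith) (by positivity) x
        have h6 := norm_add_le y₀ (∫ s in (0 : ℝ)..x, f s (Real.exp (l * |s|) • Z s))
        have h7 := mul_le_mul_of_nonneg_left h6 (Real.exp_pos (-(l * |x|))).le
        have h8 := mul_le_mul_of_nonneg_right h1 (norm_nonneg y₀)
        linarith)
  have hΦ : ContractingWith (1 / 2) Φ := by
    refine ⟨by rw [← NNReal.coe_lt_coe]; norm_num, LipschitzWith.of_dist_le_mul fun Z W => ?_⟩
    have hZW : 0 ≤ K * ‖Z - W‖ := by positivity
    rw [dist_eq_norm, dist_eq_norm]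
    refine (BoundedContinuousFunction.norm_le (by positivity)).2 fun x => ?_
    have e : (Φ Z - Φ W) x = Real.exp (-(l * |x|)) •
        ∫ s in (0 : ℝ)..x, (f s (Real.exp (l * |s|) • Z s) - f s (Real.exp (l * |s|) • W s)) := by
      rw [intervalIntegral.integral_sub ((hcont Z).intervalIntegrable _ _)
        ((hcont W).intervalIntegrable _ _)]
      change Real.exp (-(l * |x|)) • (y₀ + ∫ s in (0 : ℝ)..x, f s (Real.exp (l * |s|) • Z s)) -
        Real.exp (-(l * |x|)) • (y₀ + ∫ s in (0 : ℝ)..x, f s (Real.exp (l * |s|) • W s)) = _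
      rw [← smul_sub]
      congr 1
      abel
    rw [e, norm_smul, Real.norm_of_nonneg (Real.exp_pos _).le]
    refine (hbd (K * ‖Z - W‖) _ (fun s => ?_) hZW x).trans (le_of_eq ?_)
    · refine (hlip _ _ _).trans ?_
      rw [← smul_sub, norm_smul, Real.norm_of_nonneg (Real.exp_pos _).le]
      have h5 := mul_le_mul_of_nonneg_left ((Z - W).norm_coe_le_norm s)
        (mul_nonneg hK.le (Real.exp_pos (l * |s|)).le)
      simp only [BoundedContinuousFunction.sub_apply] at h5
      linarith
    · rw [hl]
      push_cast
      field_simp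
  set Z := hΦ.fixedPoint Φ with hZ
  have hfix : ∀ x, Z x = Real.exp (-(l * |x|)) •
      (y₀ + ∫ s in (0 : ℝ)..x, f s (Real.exp (l * |s|) • Z s)) := fun x => by
    conv_lhs => rw [hZ, ← hΦ.fixedPoint_isFixedPt]
    rfl
  have hY : ∀ x, Real.exp (l * |x|) • Z x = y₀ + ∫ s in (0 : ℝ)..x, f s (Real.exp (l * |s|) • Z s) :=
    fun x => by
      conv_lhs => rw [hfix x, smul_smul, ← Real.exp_add, add_neg_cancel, Real.exp_zero, one_smul]
  refine ⟨fun x => Real.exp (l * |x|) • Z x, by have := hY 0; simpa using this, fun x => ?_⟩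
  have hd := (intervalIntegral.integral_hasDerivAt_right ((hcont Z).intervalIntegrable 0 x)
    ((hcont Z).stronglyMeasurableAtFilter _ _) (hcont Z).continuousAt).const_add y₀
  exact hd.congr_of_eventuallyEq (Eventually.of_forall hY)

end GlobalODE

/-! ### Periodic solutions of third order linear equations -/

section PeriodicODE

variable {M : ℝ} [hM : Fact (0 < M)]

theorem exists_bound_of_periodic {φ : ℝ → ℝ} (h : PerC M 0 φ) : ∃ C, 0 ≤ C ∧ ∀ x, |φ x| ≤ C := by
  obtain ⟨C, hC⟩ := isCompact_Icc.exists_bound_of_continuousOn (s := Icc 0 M) h.cont.continuousOn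
  refine ⟨C, (norm_nonneg _).trans (hC 0 ⟨le_rfl, hM.out.le⟩), fun x => ?_⟩
  obtain ⟨y, hy, hxy⟩ := h.per.exists_mem_Ico₀ hM.out x
  rw [hxy]
  exact hC y ⟨hy.1, hy.2.le⟩

theorem contDiff_of_hasDerivAt_chain {u u₁ u₂ u₃ : ℝ → ℝ} (h : ∀ x, HasDerivAt u (u₁ x) x)
    (h₁ : ∀ x, HasDerivAt u₁ (u₂ x) x) (h₂ : ∀ x, HasDerivAt u₂ (u₃ x) x) (h₃ : Continuous u₃) :
    ContDiff ℝ 3 u ∧ iteratedDeriv 1 u = u₁ ∧ iteratedDeriv 2 u = u₂ ∧ iteratedDeriv 3 u = u₃ := by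
  have e1 : iteratedDeriv 1 u = u₁ := by
    rw [iteratedDeriv_one]; exact funext fun x => (h x).deriv
  have e2 : iteratedDeriv 2 u = u₂ := by
    rw [iteratedDeriv_succ, e1]; exact funext fun x => (h₁ x).deriv
  have e3 : iteratedDeriv 3 u = u₃ := by
    rw [iteratedDeriv_succ, e2]; exact funext fun x => (h₂ x).deriv
  have d0 : Differentiable ℝ u := fun x => (h x).differentiableAt
  have d1 : Differentiable ℝ u₁ := fun x => (h₁ x).differentiableAt
  have d2 : Differentiable ℝ u₂ := fun x => (h₂ x).differentiableAt
  refine ⟨contDiff_nat_iff_iteratedDeriv (n := 3).2 ⟨fun m hm => ?_, fun m hm => ?_⟩, e1, e2, e3⟩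
  · interval_cases m
    · simpa using d0.continuous
    · rw [e1]; exact d1.continuous
    · rw [e2]; exact d2.continuous
    · rw [e3]; exact h₃
  · interval_cases m
    · simpa using d0
    · rw [e1]; exact d1
    · rw [e2]; exact d2

/-- A linear third order equation with periodic coefficients has a periodic solution if the
homogeneous equation has only the trivial periodic solution. -/
theorem exists_periodic_third_order {p₀ p₁ p₂ r : ℝ → ℝ} (h₀ : PerC M 0 p₀) (h₁ : PerC M 0 p₁)
    (h₂ : PerC M 0 p₂) (hr : PerC M 0 r)
    (huniq : ∀ u : ℝ → ℝ, PerC M 3 u → (∀ x, iteratedDeriv 3 u x =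
      p₂ x * iteratedDeriv 2 u x + p₁ x * iteratedDeriv 1 u x + p₀ x * u x) → ∀ x, u x = 0) :
    ∃ u : ℝ → ℝ, PerC M 3 u ∧ ∀ x, iteratedDeriv 3 u x =
      p₂ x * iteratedDeriv 2 u x + p₁ x * iteratedDeriv 1 u x + p₀ x * u x + r x := by
  obtain ⟨C₀, hC₀, b₀⟩ := exists_bound_of_periodic h₀
  obtain ⟨C₁, hC₁, b₁⟩ := exists_bound_of_periodic h₁
  obtain ⟨C₂, hC₂, b₂⟩ := exists_bound_of_periodic h₂
  obtain ⟨Cr, hCr, br⟩ := exists_bound_of_periodic hr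
  have k₀ := h₀.cont
  have k₁ := h₁.cont
  have k₂ := h₂.cont
  set V : (ℝ → ℝ) → ℝ → ℝ × ℝ × ℝ → ℝ × ℝ × ℝ := fun r x y =>
    (y.2.1, y.2.2, p₂ x * y.2.2 + p₁ x * y.2.1 + p₀ x * y.1 + r x) with hV
  set K : ℝ := 1 + (C₂ + C₁ + C₀) with hK
  have hK0 : 0 < K := by positivity
  have hlip : ∀ r x y z, ‖V r x y - V r x z‖ ≤ K * ‖y - z‖ := by
    intro r x y z
    have n1 : |y.1 - z.1| ≤ ‖y - z‖ := norm_fst_le (y - z)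
    have n2 : |y.2.1 - z.2.1| ≤ ‖y - z‖ := (norm_fst_le (y - z).2).trans (norm_snd_le (y - z))
    have n3 : |y.2.2 - z.2.2| ≤ ‖y - z‖ := (norm_snd_le (y - z).2).trans (norm_snd_le (y - z))
    have hK1 : ‖y - z‖ ≤ K * ‖y - z‖ := le_mul_of_one_le_left (norm_nonneg _) (by rw [hK]; linarith)
    refine norm_prod_le_iff.2 ⟨n2.trans hK1, norm_prod_le_iff.2 ⟨n3.trans hK1, ?_⟩⟩
    have e : (V r x y - V r x z).2.2 =
        p₂ x * (y.2.2 - z.2.2) + p₁ x * (y.2.1 - z.2.1) + p₀ x * (y.1 - z.1) := by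
      simp only [hV, Prod.snd_sub]; ring
    rw [e, Real.norm_eq_abs]
    refine (abs_add_le_of_le (abs_add_le_of_le (abs_mul_le_of_le (b₂ x) n3)
      (abs_mul_le_of_le (b₁ x) n2)) (abs_mul_le_of_le (b₀ x) n1)).trans ?_
    rw [hK]
    linarith [norm_nonneg (y - z)]
  have hex : ∀ (r : ℝ → ℝ) (C : ℝ), Continuous r → (∀ x, |r x| ≤ C) → ∀ y₀ : ℝ × ℝ × ℝ,
      ∃ Y : ℝ → ℝ × ℝ × ℝ, Y 0 = y₀ ∧ ∀ x, HasDerivAt Y (V r x (Y x)) x := by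
    intro r C hr hb y₀
    refine exists_global_ode_solution (K := K) (B := C) ?_ hK0 (hlip r) (fun x => ?_) y₀
    · simp only [hV, Function.uncurry_def]
      fun_prop
    · have hC : 0 ≤ C := (abs_nonneg _).trans (hb 0)
      simp only [hV]
      refine norm_prod_le_iff.2 ⟨by simpa using hC, norm_prod_le_iff.2 ⟨by simpa using hC, ?_⟩⟩
      simpa using hb x
  have huni : ∀ (r : ℝ → ℝ) (Y Z : ℝ → ℝ × ℝ × ℝ), (∀ x, HasDerivAt Y (V r x (Y x)) x) →
      (∀ x, HasDerivAt Z (V r x (Z x)) x) → Y 0 = Z 0 → Y = Z := by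
    intro r Y Z hY hZ h0
    refine ODE_solution_unique_univ (v := V r) (s := fun _ => univ) (K := ⟨K, hK0.le⟩) (t₀ := 0)
      (fun t => (LipschitzWith.of_dist_le_mul fun y z => ?_).lipschitzOnWith)
      (fun t => ⟨hY t, trivial⟩) (fun t => ⟨hZ t, trivial⟩) h0
    rw [dist_eq_norm, dist_eq_norm]
    exact hlip r t y z
  have hper : ∀ (r : ℝ → ℝ), Function.Periodic r M → ∀ Y : ℝ → ℝ × ℝ × ℝ,
      (∀ x, HasDerivAt Y (V r x (Y x)) x) → Y M = Y 0 → Function.Periodic Y M := by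
    intro r pr Y hY h0
    refine fun x => congrFun (huni r (fun x => Y (x + M)) Y (fun x => ?_) hY (by simpa using h0)) x
    have := (hY (x + M)).comp_add_const x M
    simpa only [hV, h₀.per x, h₁.per x, h₂.per x, pr x] using this
  have hext : ∀ (r : ℝ → ℝ), PerC M 0 r → ∀ Y : ℝ → ℝ × ℝ × ℝ, (∀ x, HasDerivAt Y (V r x (Y x)) x) →
      Y M = Y 0 → PerC M 3 (fun x => (Y x).1) ∧ (∀ x, iteratedDeriv 3 (fun x => (Y x).1) x =
        p₂ x * iteratedDeriv 2 (fun x => (Y x).1) x + p₁ x * iteratedDeriv 1 (fun x => (Y x).1) x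
          + p₀ x * (Y x).1 + r x) ∧ iteratedDeriv 1 (fun x => (Y x).1) = (fun x => (Y x).2.1) ∧
        iteratedDeriv 2 (fun x => (Y x).1) = (fun x => (Y x).2.2) := by
    intro r hr Y hY h0
    have pY := hper r hr.per Y hY h0
    have cY : Continuous Y := continuous_iff_continuousAt.2 fun x => (hY x).continuousAt
    have cr := hr.cont
    have d1 : ∀ x, HasDerivAt (fun x => (Y x).1) (Y x).2.1 x := fun x => (hY x).fst
    have d2 : ∀ x, HasDerivAt (fun x => (Y x).2.1) (Y x).2.2 x := fun x => (hY x).snd.fst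
    have d3 : ∀ x, HasDerivAt (fun x => (Y x).2.2) (p₂ x * (Y x).2.2 + p₁ x * (Y x).2.1
      + p₀ x * (Y x).1 + r x) x := fun x => (hY x).snd.snd
    obtain ⟨c, e1, e2, e3⟩ := contDiff_of_hasDerivAt_chain d1 d2 d3 (by fun_prop)
    refine ⟨⟨fun x => by simp only [pY x], c⟩, fun x => ?_, e1, e2⟩
    rw [e1, e2, e3]
  choose S hS0 hS using hex (fun _ => 0) 0 continuous_const (by simp)
  have hVadd : ∀ (r r' : ℝ → ℝ) x y z, V r x y + V r' x z = V (fun x => r x + r' x) x (y + z) := by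
    intro r r' x y z
    simp only [hV]
    ext <;> simp <;> ring
  have hVsmul : ∀ (c : ℝ) x y, c • V (fun _ => 0) x y = V (fun _ => 0) x (c • y) := by
    intro c x y
    simp only [hV]
    ext <;> simp <;> ring
  let T : (ℝ × ℝ × ℝ) →ₗ[ℝ] (ℝ × ℝ × ℝ) :=
    { toFun := fun y => S y M
      map_add' := fun y z => by
        have := huni (fun _ => 0) (S (y + z)) (fun x => S y x + S z x) (hS _) (fun x =>
          ((hS y x).add (hS z x)).congr_deriv (by
            have := hVadd (fun _ => 0) (fun _ => 0) x (S y x) (S z x)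
            simpa only [add_zero] using this)) (by simp [hS0])
        exact congrFun this M
      map_smul' := fun c y => by
        have := huni (fun _ => 0) (S (c • y)) (fun x => c • S y x) (hS _) (fun x =>
          ((hS y x).const_smul c).congr_deriv (hVsmul c x (S y x))) (by simp [hS0])
        exact congrFun this M }
  -- A fixed vector of the monodromy map `T` launches a periodic solution of the homogeneous
  -- equation, which `huniq` makes zero. In finite dimension injectivity of `id - T` gives
  -- surjectivity.
  have hinj : Function.Injective (LinearMap.id - T : (ℝ × ℝ × ℝ) →ₗ[ℝ] (ℝ × ℝ × ℝ)) := by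
    refine (injective_iff_map_eq_zero _).2 fun y hy => ?_
    have hy' : S y M = S y 0 := by
      rw [hS0]
      exact (sub_eq_zero.1 hy).symm
    obtain ⟨q1, q2, q3, q4⟩ := hext (fun _ => 0) (PerC.const 0) (S y) (hS y) hy'
    have hz := huniq _ q1 fun x => by simpa using q2 x
    have hz' : (fun x => (S y x).1) = fun _ => 0 := funext hz
    have z1 : iteratedDeriv 1 (fun x => (S y x).1) 0 = 0 := by rw [hz']; simp
    have z2 : iteratedDeriv 2 (fun x => (S y x).1) 0 = 0 := by
      rw [hz', iteratedDeriv_const]; simp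
    rw [q3] at z1
    rw [q4] at z2
    have z0 := hz 0
    simp only [hS0] at z0 z1 z2
    exact Prod.ext z0 (Prod.ext z1 z2)
  obtain ⟨Yp, hYp0, hYp⟩ := hex r Cr hr.cont br 0
  -- `y` is the initial vector for which the homogeneous solution plus the particular solution `Yp`,
  -- started at zero, returns to `y` after one period.
  obtain ⟨y, hy⟩ := (LinearMap.injective_iff_surjective.1 hinj) (Yp M)
  have hy' : S y M + Yp M = y := by
    have : y - S y M = Yp M := hy
    rw [← this]; abel
  obtain ⟨q1, q2, -, -⟩ := hext r hr (fun x => S y x + Yp x) (fun x =>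
    ((hS y x).add (hYp x)).congr_deriv (by
      have := hVadd (fun _ => 0) r x (S y x) (Yp x)
      simpa only [zero_add] using this)) (by simp only [hS0, hYp0, add_zero]; exact hy')
  exact ⟨_, q1, q2⟩

/-- Bootstrap: the equation expresses `u'''` through at most two derivatives of `u`, so each pass
gains one derivative until the coefficients run out. -/
theorem perC_of_third_order {n : ℕ} {p₀ p₁ p₂ r u : ℝ → ℝ} (h₀ : PerC M n p₀) (h₁ : PerC M n p₁)
    (h₂ : PerC M n p₂) (hr : PerC M n r) (hu : PerC M 3 u)
    (heq : ∀ x, iteratedDeriv 3 u x =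
      p₂ x * iteratedDeriv 2 u x + p₁ x * iteratedDeriv 1 u x + p₀ x * u x + r x) :
    PerC M (n + 3) u := by
  have key : ∀ m ≤ n, PerC M (m + 3) u := by
    intro m
    induction m with
    | zero => intro _; simpa using hu
    | succ m ih =>
      intro hm
      have hu' := ih (by lia)
      have hE : iteratedDeriv 3 u = fun x =>
        p₂ x * iteratedDeriv 2 u x + p₁ x * iteratedDeriv 1 u x + p₀ x * u x + r x := funext heq
      have h3 : ContDiff ℝ ((m + 1 : ℕ) : ℕ∞) (iteratedDeriv 3 u) := by
        rw [hE]
        exact (((((h₂.mono hm).mul (hu'.iter (j := 2) (by lia))).add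
          ((h₁.mono hm).mul (hu'.iter (j := 1) (by lia)))).add
          ((h₀.mono hm).mul (hu'.mono (by lia)))).add (hr.mono hm)).smooth
      have h3' := contDiff_nat_iff_iteratedDeriv.1 h3
      have hu3 := contDiff_nat_iff_iteratedDeriv.1 hu.smooth
      have hcomp : ∀ m, iteratedDeriv m (iteratedDeriv 3 u) = iteratedDeriv (m + 3) u := fun m => by
        simp only [iteratedDeriv_eq_iterate, Function.iterate_add_apply]
      refine ⟨hu.per, contDiff_nat_iff_iteratedDeriv.2 ⟨fun j hj => ?_, fun j hj => ?_⟩⟩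
      · rcases le_total j 3 with hj3 | hj3
        · exact hu3.1 j hj3
        · have := h3'.1 (j - 3) (by lia)
          rwa [hcomp, Nat.sub_add_cancel hj3] at this
      · rcases lt_or_ge j 3 with hj3 | hj3
        · exact hu3.2 j hj3
        · have := h3'.2 (j - 3) (by lia)
          rwa [hcomp, Nat.sub_add_cancel hj3] at this
  exact key n le_rfl

end PeriodicODE

/-! ### The backward Euler scheme and its stability in `H^n` -/

section BackwardEuler

variable {M : ℝ} [hM : Fact (0 < M)]

/-- The unweighted energy of order `n`. -/
def plainEnergy (M : ℝ) (n : ℕ) (φ : ℝ → ℝ) : ℝ :=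
  (∫ x in (0 : ℝ)..M, φ x ^ 2) + ∫ x in (0 : ℝ)..M, iteratedDeriv n φ x ^ 2

/-- The weighted energy of order `n`. -/
def wtEnergy (M : ℝ) (n : ℕ) (a b φ : ℝ → ℝ) : ℝ :=
  (∫ x in (0 : ℝ)..M, wt M n a b x * iteratedDeriv n φ x ^ 2)
    + ∫ x in (0 : ℝ)..M, wt M 0 a b x * φ x ^ 2

theorem intervalIntegral_mono_of_continuous {f g : ℝ → ℝ} (hf : Continuous f) (hg : Continuous g)
    (h : ∀ x, f x ≤ g x) : ∫ x in (0 : ℝ)..M, f x ≤ ∫ x in (0 : ℝ)..M, g x :=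
  intervalIntegral.integral_mono_on hM.out.le (hf.intervalIntegrable _ _) (hg.intervalIntegrable _ _)
    fun x _ => h x

theorem plainEnergy_nonneg (n : ℕ) (φ : ℝ → ℝ) : 0 ≤ plainEnergy M n φ :=
  add_nonneg (intervalIntegral.integral_nonneg hM.out.le fun _ _ => sq_nonneg _)
    (intervalIntegral.integral_nonneg hM.out.le fun _ _ => sq_nonneg _)

namespace Coeffs

variable {n : ℕ} {R : ℝ} {a b c d a' b' c' d' : ℝ → ℝ}

theorem wtEnergy_le (h : Coeffs M n R a b c d) {φ : ℝ → ℝ} (hφ : PerC M n φ) :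
    wtEnergy M n a b φ ≤ Real.exp (logBound R) * plainEnergy M n φ := by
  have c0 := (h.perC_one_wt (p := 0)).cont
  have cn := (h.perC_one_wt (p := n)).cont
  have cφ := hφ.cont
  have cφn := (hφ.iter (l := 0) (j := n) (by lia)).cont
  rw [wtEnergy, plainEnergy, mul_add, add_comm, ← intervalIntegral.integral_const_mul,
    ← intervalIntegral.integral_const_mul]
  exact add_le_add
    (intervalIntegral_mono_of_continuous (by fun_prop) (by fun_prop) fun x =>
      mul_le_mul_of_nonneg_right (h.wt_le (Nat.zero_le n) x) (sq_nonneg _))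
    (intervalIntegral_mono_of_continuous (by fun_prop) (by fun_prop) fun x =>
      mul_le_mul_of_nonneg_right (h.wt_le le_rfl x) (sq_nonneg _))

theorem plainEnergy_le (h : Coeffs M n R a b c d) {φ : ℝ → ℝ} (hφ : PerC M n φ) :
    plainEnergy M n φ ≤ Real.exp (logBound R) * wtEnergy M n a b φ := by
  have c0 := (h.perC_one_wt (p := 0)).cont
  have cn := (h.perC_one_wt (p := n)).cont
  have cφ := hφ.cont
  have cφn := (hφ.iter (l := 0) (j := n) (by lia)).cont
  have one_le : ∀ {p : ℕ}, p ≤ n → ∀ x, 1 ≤ Real.exp (logBound R) * wt M p a b x := fun hp x => by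
    have := mul_le_mul_of_nonneg_left (h.le_wt hp x) (Real.exp_pos (logBound R)).le
    rwa [← Real.exp_add, add_neg_cancel, Real.exp_zero] at this
  rw [wtEnergy, plainEnergy, mul_add, add_comm, ← intervalIntegral.integral_const_mul,
    ← intervalIntegral.integral_const_mul]
  refine add_le_add
    (intervalIntegral_mono_of_continuous (by fun_prop) (by fun_prop) fun x => ?_)
    (intervalIntegral_mono_of_continuous (by fun_prop) (by fun_prop) fun x => ?_)
  · rw [← mul_assoc]
    exact le_mul_of_one_le_left (sq_nonneg _) (one_le le_rfl x)
  · rw [← mul_assoc]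
    exact le_mul_of_one_le_left (sq_nonneg _) (one_le (Nat.zero_le n) x)

/-- The Lipschitz constant of the logarithm of the weights. -/
def lipConst (R : ℝ) : ℝ := R * R + 4 * (R * R * R * R)

theorem wt_le_exp_mul (h : Coeffs M n R a b c d) (h' : Coeffs M n R a' b' c' d') {p : ℕ}
    (hp : p ≤ n) {δ : ℝ} (hab : ∀ x, |a x - a' x| ≤ δ) (hbb : ∀ x, |b x - b' x| ≤ δ) (x : ℝ) :
    wt M p a b x ≤ Real.exp (lipConst R * δ) * wt M p a' b' x := by
  rw [wt, wt, ← Real.exp_add]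
  refine Real.exp_le_exp.2 ?_
  have := (le_abs_self _).trans (h.abs_wtLog_sub_le h' hp hab hbb x)
  rw [lipConst]
  linarith

/-- The cost of changing the weight from one time to the next is a factor exponential in the change
of the coefficients. Along the scheme these factors multiply to an exponential of the elapsed time.
-/
theorem wtEnergy_le_exp_mul (h : Coeffs M n R a b c d) (h' : Coeffs M n R a' b' c' d')
    {δ : ℝ} (hab : ∀ x, |a x - a' x| ≤ δ) (hbb : ∀ x, |b x - b' x| ≤ δ) {φ : ℝ → ℝ}
    (hφ : PerC M n φ) :
    wtEnergy M n a b φ ≤ Real.exp (lipConst R * δ) * wtEnergy M n a' b' φ := by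
  have c0 := (h.perC_one_wt (p := 0)).cont
  have cn := (h.perC_one_wt (p := n)).cont
  have c0' := (h'.perC_one_wt (p := 0)).cont
  have cn' := (h'.perC_one_wt (p := n)).cont
  have cφ := hφ.cont
  have cφn := (hφ.iter (l := 0) (j := n) (by lia)).cont
  rw [wtEnergy, wtEnergy, mul_add, ← intervalIntegral.integral_const_mul,
    ← intervalIntegral.integral_const_mul]
  refine add_le_add
    (intervalIntegral_mono_of_continuous (by fun_prop) (by fun_prop) fun x => ?_)
    (intervalIntegral_mono_of_continuous (by fun_prop) (by fun_prop) fun x => ?_)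
  · rw [← mul_assoc]
    exact mul_le_mul_of_nonneg_right (h.wt_le_exp_mul h' le_rfl hab hbb x) (sq_nonneg _)
  · rw [← mul_assoc]
    exact mul_le_mul_of_nonneg_right (h.wt_le_exp_mul h' (Nat.zero_le n) hab hbb x) (sq_nonneg _)

/-- Pointwise `(x + τ y)² ≤ (1 + τ) x² + τ (1 + τ) y²`, and `1 + τ ≤ 2`. -/
theorem wtEnergy_add_le (h : Coeffs M n R a b c d) {φ ψ : ℝ → ℝ} (hφ : PerC M n φ)
    (hψ : PerC M n ψ) {τ : ℝ} (h0 : 0 ≤ τ) (h1 : τ ≤ 1) :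
    wtEnergy M n a b (fun x => φ x + τ * ψ x) ≤
      (1 + τ) * wtEnergy M n a b φ + 2 * τ * wtEnergy M n a b ψ := by
  have c0 := (h.perC_one_wt (p := 0)).cont
  have cn := (h.perC_one_wt (p := n)).cont
  have cφ := hφ.cont
  have cφn := (hφ.iter (l := 0) (j := n) (by lia)).cont
  have cψ := hψ.cont
  have cψn := (hψ.iter (l := 0) (j := n) (by lia)).cont
  have hD : ∀ x, iteratedDeriv n (fun x => φ x + τ * ψ x) x
      = iteratedDeriv n φ x + τ * iteratedDeriv n ψ x := fun x => by
    rw [iteratedDeriv_fun_add hφ.smooth.contDiffAt (hψ.const_mul τ).smooth.contDiffAt,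
      iteratedDeriv_const_mul_field]
  have key : ∀ w x y : ℝ, 0 ≤ w → w * (x + τ * y) ^ 2 ≤ (1 + τ) * (w * x ^ 2) + 2 * τ * (w * y ^ 2) := by
    intro w x y hw
    have h2 : (x + τ * y) ^ 2 ≤ (1 + τ) * x ^ 2 + 2 * τ * y ^ 2 := by
      nlinarith [mul_nonneg h0 (sq_nonneg (x - y)), mul_nonneg (mul_nonneg h0 (sub_nonneg.2 h1)) (sq_nonneg y)]
    have := mul_le_mul_of_nonneg_left h2 hw
    linarith
  have lin : ∀ f g : ℝ → ℝ, Continuous f → Continuous g →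
      ∫ x in (0 : ℝ)..M, ((1 + τ) * f x + 2 * τ * g x) =
      (1 + τ) * (∫ x in (0 : ℝ)..M, f x) + 2 * τ * ∫ x in (0 : ℝ)..M, g x := fun f g hf hg => by
    have i1 : Continuous fun x => (1 + τ) * f x := continuous_const.mul hf
    have i2 : Continuous fun x => 2 * τ * g x := continuous_const.mul hg
    rw [intervalIntegral.integral_add (i1.intervalIntegrable _ _) (i2.intervalIntegrable _ _),
      intervalIntegral.integral_const_mul, intervalIntegral.integral_const_mul]
  have e1 := intervalIntegral_mono_of_continuous (M := M)
    (f := fun x => wt M n a b x * (iteratedDeriv n φ x + τ * iteratedDeriv n ψ x) ^ 2)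
    (g := fun x => (1 + τ) * (wt M n a b x * iteratedDeriv n φ x ^ 2)
      + 2 * τ * (wt M n a b x * iteratedDeriv n ψ x ^ 2))
    (by fun_prop) (by fun_prop) fun x => key _ _ _ (wt_pos x).le
  have e2 := intervalIntegral_mono_of_continuous (M := M)
    (f := fun x => wt M 0 a b x * (φ x + τ * ψ x) ^ 2)
    (g := fun x => (1 + τ) * (wt M 0 a b x * φ x ^ 2) + 2 * τ * (wt M 0 a b x * ψ x ^ 2))
    (by fun_prop) (by fun_prop) fun x => key _ _ _ (wt_pos x).le
  rw [lin _ _ (by fun_prop) (by fun_prop)] at e1 e2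
  simp only [wtEnergy, hD]
  linarith

theorem levelConst_nonneg {R Q : ℝ} (hR : 0 ≤ R) (hQ : 0 ≤ Q) : 0 ≤ levelConst R Q := by
  have := (Real.exp_pos (logBound R)).le
  rw [levelConst]
  positivity

theorem baseConst_nonneg {R : ℝ} (hR : 0 ≤ R) : 0 ≤ baseConst R :=
  add_nonneg (levelConst_nonneg hR hR) (mul_nonneg (Real.exp_pos _).le hR)

theorem topConst_nonneg {R : ℝ} (hR : 0 ≤ R) : 0 ≤ topConst R n :=
  add_nonneg (levelConst_nonneg hR (by positivity))
    (mul_nonneg (Real.exp_pos _).le (by positivity))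

/-- The growth rate of the energy of order `n`. -/
def stepConst (R : ℝ) (n : ℕ) : ℝ := (topConst R n + baseConst R) * Real.exp (logBound R)

theorem stepConst_nonneg {R : ℝ} (hR : 0 ≤ R) : 0 ≤ stepConst R n :=
  mul_nonneg (add_nonneg (topConst_nonneg hR) (baseConst_nonneg hR)) (Real.exp_pos _).le

theorem perC_inv (h : Coeffs M n R a b c d) : PerC M n (fun x => (a x)⁻¹) :=
  ⟨fun x => by simp only [h.ha.per x], (h.ha.mono (l := n) (by lia)).smooth.inv h.a_ne⟩

/-- The resolvent equation `u - τ L u = f` has a solution if `τ` is small. -/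
theorem exists_resolvent (h : Coeffs M n R a b c d) {τ : ℝ} (hτ : 0 < τ)
    (hτC : τ * stepConst R n ≤ 1 / 4) {f : ℝ → ℝ} (hf : PerC M n f) :
    ∃ u, PerC M (n + 3) u ∧ ∀ x, u x - τ * spatialOp a b c d u x = f x := by
  have hR : 0 ≤ R := zero_le_one.trans h.one_le
  have hi := h.perC_inv
  have q₂ : PerC M n fun x => -1 * (b x * (a x)⁻¹) := ((h.hb.mono (by lia)).mul hi).const_mul _
  have q₁ : PerC M n fun x => -1 * (c x * (a x)⁻¹) := (h.hc.mul hi).const_mul _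
  have q₀ : PerC M n fun x => (τ⁻¹ - d x) * (a x)⁻¹ := ((PerC.const _).sub h.hd).mul hi
  have qr : PerC M n fun x => -τ⁻¹ * (f x * (a x)⁻¹) := (hf.mul hi).const_mul _
  -- The resolvent equation divided by `τ a` and solved for `u'''`.
  have conv : ∀ (u r : ℝ → ℝ) (x : ℝ), (iteratedDeriv 3 u x =
      -1 * (b x * (a x)⁻¹) * iteratedDeriv 2 u x + -1 * (c x * (a x)⁻¹) * iteratedDeriv 1 u x
        + (τ⁻¹ - d x) * (a x)⁻¹ * u x + -τ⁻¹ * (r x * (a x)⁻¹)) →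
      u x - τ * spatialOp a b c d u x = r x := by
    intro u r x hx
    rw [spatialOp, hx]
    have := h.a_ne x
    field_simp
    ring
  obtain ⟨u, hu, heq⟩ := exists_periodic_third_order (q₀.mono (Nat.zero_le n)) (q₁.mono (Nat.zero_le n))
    (q₂.mono (Nat.zero_le n)) (qr.mono (Nat.zero_le n)) fun u hu hu' x => by
      -- For a solution of the homogeneous equation, `τ⁻¹ ∫ w u²` equals `∫ w u L u`, which the base
      -- energy estimate bounds by `baseConst R ∫ u²`. For small `τ` this forces `u = 0`.
      have h0 : ∀ x, u x = τ * spatialOp a b c d u x := fun x => by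
        have := conv u (fun _ => 0) x (by rw [hu' x]; ring)
        linarith
      have cu := hu.cont
      have c0 := (h.perC_one_wt (p := 0)).cont
      have e1 : ∫ x in (0 : ℝ)..M, wt M 0 a b x * (spatialOp a b c d u x * u x) =
          τ⁻¹ * ∫ x in (0 : ℝ)..M, wt M 0 a b x * u x ^ 2 := by
        rw [← intervalIntegral.integral_const_mul]
        refine intervalIntegral.integral_congr fun x _ => ?_
        have : spatialOp a b c d u x = τ⁻¹ * u x := by rw [h0 x]; field_simp
        simp only [this]
        ring
      have e2 := h.base_energy hu
      rw [e1] at e2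
      have e3 : Real.exp (-logBound R) * ∫ x in (0 : ℝ)..M, u x ^ 2 ≤
          ∫ x in (0 : ℝ)..M, wt M 0 a b x * u x ^ 2 := by
        rw [← intervalIntegral.integral_const_mul]
        exact intervalIntegral_mono_of_continuous (by fun_prop) (by fun_prop) fun x =>
          mul_le_mul_of_nonneg_right (h.le_wt (Nat.zero_le n) x) (sq_nonneg _)
      have e4 : 0 ≤ ∫ x in (0 : ℝ)..M, u x ^ 2 :=
        intervalIntegral.integral_nonneg hM.out.le fun _ _ => sq_nonneg _
      have e5 : τ * baseConst R * Real.exp (logBound R) ≤ 1 / 4 := by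
        refine le_trans ?_ hτC
        have := mul_nonneg (mul_nonneg hτ.le (topConst_nonneg (n := n) hR)) (Real.exp_pos (logBound R)).le
        rw [stepConst]
        linarith
      have e6 : ∫ x in (0 : ℝ)..M, u x ^ 2 = 0 := by
        have t1 := (inv_mul_le_iff₀ hτ).1 e2
        have t2 := e3.trans t1
        rw [Real.exp_neg, inv_mul_le_iff₀ (Real.exp_pos _)] at t2
        nlinarith
      have e7 : perL2 M u = 0 := by
        have := norm_sq_perL2 (hu.mono (Nat.zero_le 3))
        rw [e6] at this
        exact norm_eq_zero.1 (by simpa using this)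
      obtain ⟨y, hy, hxy⟩ := hu.per.exists_mem_Ico₀ hM.out x
      rw [hxy]
      have hz := (intervalIntegral.integral_eq_zero_iff_of_le_of_nonneg_ae hM.out.le
        (Eventually.of_forall fun x => sq_nonneg (u x))
        ((cu.pow 2).intervalIntegrable _ _)).1 e6
      have hz2 := Measure.eqOn_Icc_of_ae_eq (μ := volume) (f := fun x => u x ^ 2) (g := 0) hM.out.ne
        (by rw [restrict_Ioc_eq_restrict_Icc] at hz; exact hz) (cu.pow 2).continuousOn continuousOn_const
      have := hz2 ⟨hy.1, hy.2.le⟩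
      simpa using this
  exact ⟨u, perC_of_third_order q₀ q₁ q₂ qr hu heq, fun x => conv u f x (heq x)⟩

/-- From `f = u - τ L u`, `f² = u² - 2 τ u L u + τ² (L u)²`, and the last term has the favourable
sign. This makes the implicit step stable with no restriction tying `τ` to the smoothness of `u`. -/
theorem wtEnergy_resolvent_le (h : Coeffs M n R a b c d) {τ : ℝ} (hτ : 0 < τ)
    (hτC : τ * stepConst R n ≤ 1 / 4) {u f : ℝ → ℝ} (hu : PerC M (n + 3) u) (hf : PerC M n f)
    (heq : ∀ x, u x - τ * spatialOp a b c d u x = f x) :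
    wtEnergy M n a b u ≤ Real.exp (4 * stepConst R n * τ) * wtEnergy M n a b f := by
  have hR : 0 ≤ R := zero_le_one.trans h.one_le
  have c0 := (h.perC_one_wt (p := 0)).cont
  have cn := (h.perC_one_wt (p := n)).cont
  have hL := h.perC_spatialOp le_rfl hu
  have cu := hu.cont
  have cun := (hu.iter (l := 0) (j := n) (by lia)).cont
  have cf := hf.cont
  have cfn := (hf.iter (l := 0) (j := n) (by lia)).cont
  have cL := hL.cont
  have cLn := (hL.iter (l := 0) (j := n) (by lia)).cont
  have e0 : ∀ x, u x = f x + τ * spatialOp a b c d u x := fun x => by linarith [heq x]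
  have en : ∀ x, iteratedDeriv n u x = iteratedDeriv n f x + τ * iteratedDeriv n (spatialOp a b c d u) x := by
    intro x
    conv_lhs => rw [funext e0]
    rw [iteratedDeriv_fun_add hf.smooth.contDiffAt (hL.const_mul τ).smooth.contDiffAt,
      iteratedDeriv_const_mul_field]
  have key : ∀ w u f l : ℝ, 0 ≤ w → u = f + τ * l →
      w * u ^ 2 ≤ w * f ^ 2 + 2 * τ * (w * (l * u)) := by
    intro w u f l hw hu
    have : u ^ 2 ≤ f ^ 2 + 2 * τ * (l * u) := by rw [hu]; nlinarith [sq_nonneg (τ * l)]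
    have := mul_le_mul_of_nonneg_left this hw
    linarith
  have lin : ∀ f g : ℝ → ℝ, Continuous f → Continuous g →
      ∫ x in (0 : ℝ)..M, (f x + 2 * τ * g x) =
      (∫ x in (0 : ℝ)..M, f x) + 2 * τ * ∫ x in (0 : ℝ)..M, g x := fun f g hf hg => by
    have i2 : Continuous fun x => 2 * τ * g x := continuous_const.mul hg
    rw [intervalIntegral.integral_add (hf.intervalIntegrable _ _) (i2.intervalIntegrable _ _),
      intervalIntegral.integral_const_mul]
  have e1 := intervalIntegral_mono_of_continuous (M := M)
    (f := fun x => wt M n a b x * iteratedDeriv n u x ^ 2)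
    (g := fun x => wt M n a b x * iteratedDeriv n f x ^ 2 + 2 * τ *
      (wt M n a b x * (iteratedDeriv n (spatialOp a b c d u) x * iteratedDeriv n u x)))
    (by fun_prop) (by fun_prop) fun x => key _ _ _ _ (wt_pos x).le (en x)
  have e2 := intervalIntegral_mono_of_continuous (M := M)
    (f := fun x => wt M 0 a b x * u x ^ 2)
    (g := fun x => wt M 0 a b x * f x ^ 2 + 2 * τ * (wt M 0 a b x * (spatialOp a b c d u x * u x)))
    (by fun_prop) (by fun_prop) fun x => key _ _ _ _ (wt_pos x).le (e0 x)
  rw [lin _ _ (by fun_prop) (by fun_prop)] at e1 e2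
  have t1 := h.top_energy hu
  have t2 := h.base_energy (hu.mono (l := 3) (by lia))
  have hN := h.plainEnergy_le (hu.mono (l := n) (by lia))
  have hu0 : 0 ≤ ∫ x in (0 : ℝ)..M, iteratedDeriv n u x ^ 2 :=
    intervalIntegral.integral_nonneg hM.out.le fun _ _ => sq_nonneg _
  have t3 : (∫ x in (0 : ℝ)..M, wt M n a b x *
      (iteratedDeriv n (spatialOp a b c d u) x * iteratedDeriv n u x)) +
      (∫ x in (0 : ℝ)..M, wt M 0 a b x * (spatialOp a b c d u x * u x)) ≤
      stepConst R n * wtEnergy M n a b u := by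
    have s1 : (topConst R n + baseConst R) * plainEnergy M n u ≤ stepConst R n * wtEnergy M n a b u := by
      rw [stepConst, mul_assoc]
      exact mul_le_mul_of_nonneg_left hN (add_nonneg (topConst_nonneg hR) (baseConst_nonneg hR))
    refine le_trans ?_ s1
    have := mul_nonneg (baseConst_nonneg hR) hu0
    rw [plainEnergy]
    linarith
  have hE0 : 0 ≤ wtEnergy M n a b u := by
    have := (plainEnergy_nonneg (M := M) n u).trans hN
    exact nonneg_of_mul_nonneg_right this (Real.exp_pos _)
  have main : wtEnergy M n a b u * (1 - 2 * (τ * stepConst R n)) ≤ wtEnergy M n a b f := by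
    have := mul_le_mul_of_nonneg_left t3 hτ.le
    simp only [wtEnergy] at this ⊢
    linarith
  set z := τ * stepConst R n with hz
  have hz0 : 0 ≤ z := mul_nonneg hτ.le (stepConst_nonneg hR)
  have h1 : 1 + 4 * z ≤ Real.exp (4 * z) := by linarith [Real.add_one_le_exp (4 * z)]
  -- `(1 - 2z)(1 + 4z) = 1 + 2z(1 - 4z)`, which is at least `1` for `0 ≤ z ≤ 1/4`; hence the
  -- smallness condition on `τ`.
  have h2 : 1 ≤ (1 - 2 * z) * Real.exp (4 * z) := by nlinarith
  have h3 : 4 * stepConst R n * τ = 4 * z := by rw [hz]; ring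
  rw [h3]
  have h4 := mul_le_mul_of_nonneg_left main (Real.exp_pos (4 * z)).le
  have h5 := mul_le_mul_of_nonneg_left h2 hE0
  linarith

end Coeffs

/-- Time dependent coefficients that satisfy the bounds at each time, with `a` and `b` Lipschitz and
`c` and `d` uniformly continuous in time. -/
structure TimeCoeffs (M : ℝ) (n : ℕ) (R : ℝ) (a b c d : ℝ → ℝ → ℝ) : Prop where
  coeffs : ∀ t, Coeffs M n R (a t) (b t) (c t) (d t)
  a_lip : ∀ t s x, |a t x - a s x| ≤ R * |t - s|
  b_lip : ∀ t s x, |b t x - b s x| ≤ R * |t - s|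
  c_unif : ∀ ε > 0, ∃ δ > 0, ∀ t s, |t - s| < δ → ∀ x, |c t x - c s x| ≤ ε
  d_unif : ∀ ε > 0, ∃ δ > 0, ∀ t s, |t - s| < δ → ∀ x, |d t x - d s x| ≤ ε

namespace TimeCoeffs

variable {n : ℕ} {R : ℝ} {a b c d : ℝ → ℝ → ℝ}

open Coeffs

/-- The growth rate of the energy of the backward Euler scheme. -/
def growth (R : ℝ) (n : ℕ) : ℝ := 4 * stepConst R n + lipConst R * R + 1

/-- The backward Euler scheme for the equation, with its energy bound. -/
theorem exists_scheme (h : TimeCoeffs M n R a b c d) {τ : ℝ} (hτ : 0 < τ) (hτ1 : τ ≤ 1)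
    (hτC : τ * stepConst R n ≤ 1 / 4) {u₀ : ℝ → ℝ} (hu₀ : PerC M (n + 3) u₀) {e : ℕ → ℝ → ℝ}
    (he : ∀ i, PerC M n (e i)) {B : ℝ} (hB : ∀ i, plainEnergy M n (e i) ≤ B) :
    ∃ u : ℕ → ℝ → ℝ, u 0 = u₀ ∧ (∀ i, PerC M (n + 3) (u i)) ∧
      (∀ i x, u (i + 1) x - τ * spatialOp (a ((i + 1 : ℕ) * τ)) (b ((i + 1 : ℕ) * τ))
        (c ((i + 1 : ℕ) * τ)) (d ((i + 1 : ℕ) * τ)) (u (i + 1)) x = u i x + τ * e i x) ∧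
      ∀ i, plainEnergy M n (u i) ≤ Real.exp (logBound R) * (Real.exp (growth R n * (i * τ)) *
        (Real.exp (logBound R) * (plainEnergy M n u₀ + 2 * (i * τ) * B))) := by
  have hstep : ∀ (i : ℕ) (v : {v // PerC M (n + 3) v}), ∃ w : {v // PerC M (n + 3) v},
      ∀ x, w.1 x - τ * spatialOp (a ((i + 1 : ℕ) * τ)) (b ((i + 1 : ℕ) * τ))
        (c ((i + 1 : ℕ) * τ)) (d ((i + 1 : ℕ) * τ)) w.1 x = v.1 x + τ * e i x := by
    intro i v
    obtain ⟨w, hw, hw'⟩ := (h.coeffs ((i + 1 : ℕ) * τ)).exists_resolvent hτ hτC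
      ((v.2.mono (l := n) (by lia)).add ((he i).const_mul τ))
    exact ⟨⟨w, hw⟩, hw'⟩
  choose F hF using hstep
  let U : ℕ → {v // PerC M (n + 3) v} := fun i => Nat.rec ⟨u₀, hu₀⟩ (fun i v => F i v) i
  have hrec : ∀ i x, (U (i + 1)).1 x - τ * spatialOp (a ((i + 1 : ℕ) * τ)) (b ((i + 1 : ℕ) * τ))
      (c ((i + 1 : ℕ) * τ)) (d ((i + 1 : ℕ) * τ)) (U (i + 1)).1 x = (U i).1 x + τ * e i x :=
    fun i x => hF i (U i) x
  have hB0 : 0 ≤ B := (plainEnergy_nonneg n (e 0)).trans (hB 0)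
  set X := Real.exp (logBound R) with hX
  have hX0 : 0 < X := Real.exp_pos _
  -- The energy at node `i` carries the weight of time `i τ`. A step pays for adding the source, for
  -- changing the weight and for the resolvent; these are the summands `1`, `lipConst R * R` and `4
  -- * stepConst R n` of `growth`.
  have hE : ∀ i : ℕ, wtEnergy M n (a (i * τ)) (b (i * τ)) (U i).1 ≤
      Real.exp (growth R n * (i * τ)) * (X * (plainEnergy M n u₀ + 2 * (i * τ) * B)) := by
    intro i
    induction i with
    | zero =>
      simp only [Nat.cast_zero, zero_mul, mul_zero, Real.exp_zero, one_mul, add_zero]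
      exact (h.coeffs 0).wtEnergy_le (hu₀.mono (by lia))
    | succ i ih =>
      have hUi := (U i).2.mono (l := n) (by lia)
      have hf := hUi.add ((he i).const_mul τ)
      have s1 := (h.coeffs ((i + 1 : ℕ) * τ)).wtEnergy_resolvent_le hτ hτC (U (i + 1)).2 hf (hrec i)
      have hd : |((i + 1 : ℕ) : ℝ) * τ - i * τ| = τ := by
        push_cast
        rw [add_mul, one_mul, add_sub_cancel_left, abs_of_pos hτ]
      have s2 := (h.coeffs ((i + 1 : ℕ) * τ)).wtEnergy_le_exp_mul (h.coeffs (i * τ)) (δ := R * τ)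
        (fun x => (h.a_lip _ _ x).trans (by rw [hd])) (fun x => (h.b_lip _ _ x).trans (by rw [hd])) hf
      have s3 := (h.coeffs (i * τ)).wtEnergy_add_le hUi (he i) hτ.le hτ1
      have s4 := ((h.coeffs (i * τ)).wtEnergy_le (he i)).trans (mul_le_mul_of_nonneg_left (hB i) hX0.le)
      have hexpτ : 1 + τ ≤ Real.exp τ := by linarith [Real.add_one_le_exp τ]
      have hexp1 : 1 ≤ Real.exp τ := by linarith
      set G := Real.exp (growth R n * (i * τ)) with hG
      have hG1 : 1 ≤ G := by
        have hR : 0 ≤ R := zero_le_one.trans (h.coeffs 0).one_le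
        refine Real.one_le_exp (mul_nonneg ?_ (by positivity))
        have := stepConst_nonneg (n := n) hR
        rw [growth, lipConst]
        positivity
      set Y := wtEnergy M n (a (i * τ)) (b (i * τ)) (U i).1 with hY
      have hY0 : 0 ≤ G * (X * (plainEnergy M n u₀ + 2 * (i * τ) * B)) := by
        have := plainEnergy_nonneg (M := M) n u₀
        positivity
      have s5 : (1 + τ) * Y + 2 * τ * wtEnergy M n (a (i * τ)) (b (i * τ)) (e i) ≤
          Real.exp τ * (G * (X * (plainEnergy M n u₀ + 2 * ((i + 1 : ℕ) * τ) * B))) := by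
        have t1 : (1 + τ) * Y ≤ Real.exp τ * (G * (X * (plainEnergy M n u₀ + 2 * (i * τ) * B))) :=
          (mul_le_mul_of_nonneg_left ih (by linarith)).trans (mul_le_mul_of_nonneg_right hexpτ hY0)
        have t2 : 2 * τ * wtEnergy M n (a (i * τ)) (b (i * τ)) (e i) ≤ Real.exp τ * (G * (X * (2 * τ * B))) := by
          have t3 := mul_le_mul_of_nonneg_left s4 (by positivity : 0 ≤ 2 * τ)
          have t4 : 0 ≤ X * (2 * τ * B) := by positivity
          have t5 : 1 ≤ Real.exp τ * G := one_le_mul_of_one_le_of_one_le hexp1 hG1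
          have := mul_le_mul_of_nonneg_right t5 t4
          linarith
        push_cast
        linarith
      have hfin : Real.exp (growth R n * ((i + 1 : ℕ) * τ)) =
          Real.exp (4 * stepConst R n * τ) * (Real.exp (lipConst R * (R * τ)) * (Real.exp τ * G)) := by
        rw [hG, ← Real.exp_add, ← Real.exp_add, ← Real.exp_add, growth]
        congr 1
        push_cast
        ring
      rw [hfin]
      refine s1.trans ?_
      rw [mul_assoc (Real.exp (4 * stepConst R n * τ))]
      refine mul_le_mul_of_nonneg_left (s2.trans ?_) (Real.exp_pos _).le
      rw [mul_assoc (Real.exp (lipConst R * (R * τ)))]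
      refine mul_le_mul_of_nonneg_left (s3.trans ?_) (Real.exp_pos _).le
      rw [mul_assoc (Real.exp τ)]
      exact s5
  refine ⟨fun i => (U i).1, rfl, fun i => (U i).2, hrec, fun i => ?_⟩
  exact ((h.coeffs (i * τ)).plainEnergy_le ((U i).2.mono (by lia))).trans
    (mul_le_mul_of_nonneg_left (hE i) hX0.le)

end TimeCoeffs

end BackwardEuler

/-! ### The energy inequality of order zero in `L²` -/

section EnergyInequality

theorem AbsolutelyContinuousOnInterval.of_dist_le {X Y : Type*} [PseudoMetricSpace X]
    [PseudoMetricSpace Y] {f : ℝ → X} {g : ℝ → Y} {a b : ℝ}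
    (hg : AbsolutelyContinuousOnInterval g a b)
    (h : ∀ s ∈ uIcc a b, ∀ t ∈ uIcc a b, dist (f s) (f t) ≤ dist (g s) (g t)) :
    AbsolutelyContinuousOnInterval f a b := by
  rw [absolutelyContinuousOnInterval_iff] at hg ⊢
  intro ε hε
  obtain ⟨δ, hδ, H⟩ := hg ε hε
  refine ⟨δ, hδ, fun E hE hlt => lt_of_le_of_lt (Finset.sum_le_sum fun i hi => ?_) (H E hE hlt)⟩
  exact h _ (hE.1 i hi).1 _ (hE.1 i hi).2

/-- Grönwall's inequality for an absolutely continuous function. -/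
theorem AbsolutelyContinuousOnInterval.le_exp_mul {φ : ℝ → ℝ} {T C ρ : ℝ} (hT : 0 ≤ T)
    (hC : 0 ≤ C) (hρ : 0 ≤ ρ) (hφ : AbsolutelyContinuousOnInterval φ 0 T)
    (h : ∀ᵐ t, t ∈ Ioo 0 T → ∀ φ', HasDerivAt φ φ' t → φ' ≤ C * φ t + ρ) :
    φ T ≤ Real.exp (C * T) * (φ 0 + ρ * T) := by
  have hexp : AbsolutelyContinuousOnInterval (fun t => Real.exp (-C * t)) 0 T :=
    ContDiffOn.absolutelyContinuousOnInterval (by fun_prop)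
  have hψ := hexp.mul hφ
  have h1 := hψ.integral_deriv_eq_sub
  have h2 : ∫ t in (0 : ℝ)..T, deriv ((fun t => Real.exp (-C * t)) * φ) t ≤ ∫ _ in (0 : ℝ)..T, ρ := by
    refine intervalIntegral.integral_mono_ae_restrict hT ?_ intervalIntegrable_const ?_
    · exact hψ.boundedVariationOn.intervalIntegrable_deriv
    · rw [← restrict_Ioo_eq_restrict_Icc]
      refine (ae_restrict_iff' measurableSet_Ioo).2 ?_
      filter_upwards [h, hφ.ae_differentiableAt] with t ht hd htI
      have hd' := (hd (by rw [uIcc_of_le hT]; exact Ioo_subset_Icc_self htI)).hasDerivAt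
      have he : HasDerivAt (fun t => Real.exp (-C * t)) (Real.exp (-C * t) * -C) t := by
        simpa using ((hasDerivAt_id t).const_mul (-C)).exp
      rw [(he.mul hd').deriv]
      have h3 := ht htI _ hd'
      have h4 : Real.exp (-C * t) ≤ 1 := Real.exp_le_one_iff.2 (by nlinarith [htI.1])
      have h5 := mul_le_mul_of_nonneg_left h3 (Real.exp_pos (-C * t)).le
      have h6 := mul_le_mul_of_nonneg_right h4 hρ
      linarith
  rw [h1] at h2
  simp only [Pi.mul_apply, mul_zero, Real.exp_zero, one_mul, intervalIntegral.integral_const, sub_zero,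
    smul_eq_mul] at h2
  have h3 : φ T = Real.exp (C * T) * (Real.exp (-C * T) * φ T) := by
    rw [← mul_assoc, ← Real.exp_add]
    simp
  rw [h3]
  exact mul_le_mul_of_nonneg_left (by linarith) (Real.exp_pos _).le

variable {M : ℝ} [hM : Fact (0 < M)]

/-- `f` has derivatives up to order three in `L²`. -/
def HasFDer (f : L2per M) : Prop := ∀ j ≤ 3, IsFDeriv j f (fder j f)

theorem isFDeriv_zero (f : L2per M) : IsFDeriv 0 f f := fun k => by simp

theorem HasFDer.of_isFDeriv {f f₁ f₂ f₃ : L2per M} (h₁ : IsFDeriv 1 f f₁) (h₂ : IsFDeriv 2 f f₂)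
    (h₃ : IsFDeriv 3 f f₃) : HasFDer f := by
  intro j hj
  interval_cases j
  · rw [(isFDeriv_zero f).fder_eq]; exact isFDeriv_zero f
  · rwa [h₁.fder_eq]
  · rwa [h₂.fder_eq]
  · rwa [h₃.fder_eq]

theorem HasFDer.sub {f g : L2per M} (hf : HasFDer f) (hg : HasFDer g) : HasFDer (f - g) :=
  fun j hj => by
    have := (hf j hj).sub (hg j hj)
    rwa [this.fder_eq]

theorem Sob.hasFDer {s : ℝ} (hs : 3 ≤ s) (g : Sob M s) : HasFDer (toL2 g) := fun j hj =>
  isFDeriv_fder (le_trans (by exact_mod_cast hj) hs) g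

/-- The spatial operator on `L²` functions with three derivatives. -/
def opL2 (a b c d : ℝ → ℝ) (f : L2per M) : L2per M :=
  mulP M a (fder 3 f) + mulP M b (fder 2 f) + mulP M c (fder 1 f) + mulP M d f

theorem opL2_sub (a b c d : ℝ → ℝ) {f g : L2per M} (hf : HasFDer f) (hg : HasFDer g) :
    opL2 a b c d (f - g) = opL2 a b c d f - opL2 a b c d g := by
  have h : ∀ j ≤ 3, fder j (f - g) = fder j f - fder j g := fun j hj =>
    ((hf j hj).sub (hg j hj)).fder_eq
  rw [opL2, opL2, opL2, h 1 (by lia), h 2 (by lia), h 3 le_rfl]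
  simp only [map_sub]
  abel

namespace Coeffs

variable {n : ℕ} {R : ℝ} {a b c d a' b' c' d' : ℝ → ℝ}

theorem opL2_perL2 (h : Coeffs M n R a b c d) {u : ℝ → ℝ} (hu : PerC M 3 u) :
    opL2 a b c d (perL2 M u) = perL2 M (spatialOp a b c d u) := by
  have ha := h.ha.mono (Nat.zero_le _)
  have hb := h.hb.mono (Nat.zero_le _)
  have hc := h.hc.mono (Nat.zero_le _)
  have hd := h.hd.mono (Nat.zero_le _)
  have h3 : PerC M 0 (iteratedDeriv 3 u) := hu.iter (by lia)
  have h2 : PerC M 0 (iteratedDeriv 2 u) := hu.iter (by lia)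
  have h1 : PerC M 0 (iteratedDeriv 1 u) := hu.iter (by lia)
  have h0 : PerC M 0 u := hu.mono (Nat.zero_le _)
  rw [opL2, (isFDeriv_perL2 hu (j := 3) le_rfl).fder_eq, (isFDeriv_perL2 hu (j := 2) (by lia)).fder_eq,
    (isFDeriv_perL2 hu (j := 1) (by lia)).fder_eq, mulP_perL2 ha h3, mulP_perL2 hb h2,
    mulP_perL2 hc h1, mulP_perL2 hd h0, ← perL2_add (ha.mul h3) (hb.mul h2),
    ← perL2_add ((ha.mul h3).add (hb.mul h2)) (hc.mul h1),
    ← perL2_add (((ha.mul h3).add (hb.mul h2)).add (hc.mul h1)) (hd.mul h0)]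
  rfl

/-- The weighted energy inequality of order zero in `L²`. -/
theorem inner_opL2_le (h : Coeffs M n R a b c d) {f : L2per M} (hf : HasFDer f) :
    inner ℝ (mulP M (wt M 0 a b) f) (opL2 a b c d f) ≤ baseConst R * ‖f‖ ^ 2 := by
  have hw := h.perC_one_wt (p := 0)
  have hlim : ∀ j ≤ 3, Tendsto (fun K => perL2 M (iteratedDeriv j (trunc K f))) atTop (𝓝 (fder j f)) :=
    fun j hj => tendsto_perL2_iter_trunc (hf j hj)
  have h0 : Tendsto (fun K => perL2 M (trunc K f)) atTop (𝓝 f) := by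
    simpa using tendsto_perL2_iter_trunc (isFDeriv_zero f)
  have hL : Tendsto (fun K => opL2 a b c d (perL2 M (trunc K f))) atTop (𝓝 (opL2 a b c d f)) := by
    have e : ∀ K, ∀ j ≤ 3, fder j (perL2 M (trunc K f)) = perL2 M (iteratedDeriv j (trunc K f)) :=
      fun K j hj => (isFDeriv_perL2 (perC_trunc 3 K f) hj).fder_eq
    simp only [opL2, e _ 3 le_rfl, e _ 2 (by lia : 2 ≤ 3), e _ 1 (by lia : 1 ≤ 3)]
    exact (((((mulP M a).continuous.tendsto _).comp (hlim 3 le_rfl)).add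
      (((mulP M b).continuous.tendsto _).comp (hlim 2 (by lia)))).add
      (((mulP M c).continuous.tendsto _).comp (hlim 1 (by lia)))).add
      (((mulP M d).continuous.tendsto _).comp h0)
  -- For truncated series the inequality is the classical one; both sides are continuous in `f` and
  -- its first three derivatives in `L²`.
  refine le_of_tendsto_of_tendsto' ((((mulP M (wt M 0 a b)).continuous.tendsto _).comp h0).inner hL)
    ((h0.norm.pow 2).const_mul _) fun K => ?_
  have hK := perC_trunc 3 K f
  have hK0 : PerC M 0 (trunc K f) := hK.mono (Nat.zero_le _)
  have hLK : PerC M 0 (spatialOp a b c d (trunc K f)) := h.perC_spatialOp (Nat.zero_le n) hK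
  simp only [Function.comp_def]
  rw [h.opL2_perL2 hK, mulP_perL2 hw hK0, inner_perL2 (hw.mul hK0) hLK, norm_sq_perL2 hK0]
  refine le_trans (le_of_eq ?_) (h.base_energy hK)
  exact intervalIntegral.integral_congr fun x _ => by ring

theorem abs_wt_sub_le (h : Coeffs M n R a b c d) (h' : Coeffs M n R a' b' c' d') {p : ℕ}
    (hp : p ≤ n) {δ : ℝ} (hab : ∀ x, |a x - a' x| ≤ δ) (hbb : ∀ x, |b x - b' x| ≤ δ) (x : ℝ) :
    |wt M p a b x - wt M p a' b' x| ≤ Real.exp (logBound R) * (lipConst R * δ) := by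
  have hl : |wtLog M p a b x - wtLog M p a' b' x| ≤ lipConst R * δ := by
    have := h.abs_wtLog_sub_le h' hp hab hbb x
    rw [lipConst]
    linarith
  have key : ∀ y z : ℝ, Real.exp y - Real.exp z ≤ Real.exp y * (y - z) := fun y z => by
    have h1 : Real.exp z = Real.exp y * Real.exp (z - y) := by rw [← Real.exp_add]; ring_nf
    have h2 := Real.add_one_le_exp (z - y)
    have h3 := mul_le_mul_of_nonneg_left h2 (Real.exp_pos y).le
    linarith
  have hup : ∀ {y z w : ℝ}, w ≤ Real.exp (logBound R) → Real.exp y = w → |y - z| ≤ lipConst R * δ →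
      Real.exp y - Real.exp z ≤ Real.exp (logBound R) * (lipConst R * δ) := fun {y z w} hw he hyz => by
    refine (key y z).trans ((mul_le_mul_of_nonneg_left ((le_abs_self _).trans hyz)
      (Real.exp_pos y).le).trans ?_)
    exact mul_le_mul_of_nonneg_right (he ▸ hw) ((abs_nonneg _).trans hyz)
  rw [abs_le']
  refine ⟨hup (h.wt_le hp x) rfl hl, ?_⟩
  rw [neg_sub]
  exact hup (h'.wt_le hp x) rfl (by rwa [abs_sub_comm])

theorem norm_sq_le_inner_wt (h : Coeffs M n R a b c d) (f : L2per M) :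
    ‖f‖ ^ 2 ≤ Real.exp (logBound R) * inner ℝ (mulP M (wt M 0 a b) f) f := by
  have := inner_mulP_self_mono (PerC.const (k := 0) _) (h.perC_one_wt (p := 0))
    (h.le_wt (Nat.zero_le n)) f
  rw [inner_mulP_self_const, Real.exp_neg, inv_mul_le_iff₀ (Real.exp_pos _)] at this
  exact this

theorem inner_wt_le (h : Coeffs M n R a b c d) (f : L2per M) :
    inner ℝ (mulP M (wt M 0 a b) f) f ≤ Real.exp (logBound R) * ‖f‖ ^ 2 := by
  have := inner_mulP_self_mono (h.perC_one_wt (p := 0)) (PerC.const (k := 0) _)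
    (h.wt_le (Nat.zero_le n)) f
  rwa [inner_mulP_self_const] at this

theorem inner_wt_le_exp_mul (h : Coeffs M n R a b c d) (h' : Coeffs M n R a' b' c' d')
    {δ : ℝ} (hab : ∀ x, |a x - a' x| ≤ δ) (hbb : ∀ x, |b x - b' x| ≤ δ) (f : L2per M) :
    inner ℝ (mulP M (wt M 0 a b) f) f ≤
      Real.exp (lipConst R * δ) * inner ℝ (mulP M (wt M 0 a' b') f) f := by
  have hw' := h'.perC_one_wt (p := 0)
  have := inner_mulP_self_mono (h.perC_one_wt (p := 0)) (hw'.const_mul (Real.exp (lipConst R * δ)))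
    (h.wt_le_exp_mul h' (Nat.zero_le n) hab hbb) f
  refine this.trans (le_of_eq ?_)
  rw [L2.inner_def, L2.inner_def, ← integral_const_mul]
  refine integral_congr_ae ?_
  filter_upwards [coeFn_mulP (hw'.const_mul (Real.exp (lipConst R * δ))) f, coeFn_mulP hw' f]
    with x h1 h2
  rw [h1, h2]
  simp [onCircle]
  ring

end Coeffs

namespace TimeCoeffs

open Coeffs

variable {n : ℕ} {R : ℝ} {a b c d : ℝ → ℝ → ℝ}

/-- The growth rate of the energy of order zero. -/
def rate (R : ℝ) : ℝ :=
  lipConst R * R + (2 * baseConst R + Real.exp (logBound R)) * Real.exp (logBound R)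

/-- The constant of the energy inequality of order zero on a time interval of length `T`. -/
def energyConst (R T : ℝ) : ℝ :=
  Real.exp (logBound R) * (Real.exp (rate R * T) * (Real.exp (logBound R) * (1 + T)))

theorem lipConst_nonneg {R : ℝ} (hR : 0 ≤ R) : 0 ≤ lipConst R := by
  rw [lipConst]
  positivity

theorem rate_nonneg {R : ℝ} (hR : 0 ≤ R) : 0 ≤ rate R := by
  have := baseConst_nonneg hR
  have := lipConst_nonneg hR
  rw [rate]
  positivity

/-- The weight is only Lipschitz in time, so it is not differentiated. With the weight frozen at
time `t`, `exp (Λ (s - t))` times the frozen energy dominates the true energy for `s > t`, with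
equality at `s = t`, and this orders the derivatives at `t`. -/
theorem hasDerivAt_weighted_le (h : TimeCoeffs M n R a b c d) {ζ : ℝ → L2per M} {F r : L2per M}
    {t : ℝ} (hζ : HasDerivAt ζ F t) (hd : HasFDer (ζ t)) {ρ : ℝ} (hρ : ‖r‖ ≤ ρ)
    (hF : F = opL2 (a t) (b t) (c t) (d t) (ζ t) + r) {φ' : ℝ}
    (hφ : HasDerivAt (fun s => inner ℝ (mulP M (wt M 0 (a s) (b s)) (ζ s)) (ζ s)) φ' t) :
    φ' ≤ rate R * inner ℝ (mulP M (wt M 0 (a t) (b t)) (ζ t)) (ζ t) + Real.exp (logBound R) * ρ ^ 2 := by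
  have ht := h.coeffs t
  have hR : 0 ≤ R := zero_le_one.trans ht.one_le
  set W := mulP M (wt M 0 (a t) (b t)) with hW
  set Λ := lipConst R * R with hΛ
  set X := Real.exp (logBound R) with hX
  have hψ : HasDerivAt (fun s => inner ℝ (W (ζ s)) (ζ s)) (inner ℝ (W (ζ t)) F + inner ℝ (W F) (ζ t)) t :=
    ((W.hasFDerivAt.comp_hasDerivAt t hζ).inner ℝ hζ)
  have hexp : HasDerivAt (fun s => Real.exp (Λ * (s - t))) Λ t := by
    have := (((hasDerivAt_id t).sub_const t).const_mul Λ).exp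
    simpa using this
  have hD := (hexp.mul hψ).sub hφ
  have hD0 : 0 ≤ Λ * inner ℝ (W (ζ t)) (ζ t) + (inner ℝ (W (ζ t)) F + inner ℝ (W F) (ζ t)) - φ' := by
    have h1 := (hasDerivAt_iff_tendsto_slope.1 hD).mono_left
      (nhdsWithin_mono t (fun s (hs : t < s) => ne_of_gt hs) : 𝓝[>] t ≤ 𝓝[≠] t)
    simp only [sub_self, mul_zero, Real.exp_zero, one_mul] at h1
    refine ge_of_tendsto h1 (eventually_mem_nhdsWithin.mono fun s (hs : t < s) => ?_)
    rw [slope_def_field]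
    refine div_nonneg ?_ (sub_pos.2 hs).le
    simp only [Pi.sub_apply, Pi.mul_apply, sub_self, mul_zero, Real.exp_zero, one_mul, ← hW, sub_zero]
    have := (h.coeffs s).inner_wt_le_exp_mul ht (h.a_lip s t) (h.b_lip s t) (ζ s)
    rw [abs_of_pos (sub_pos.2 hs), ← mul_assoc] at this
    linarith
  have h2 : inner ℝ (W F) (ζ t) = inner ℝ (W (ζ t)) F := by
    rw [hW, inner_mulP_comm ht.perC_one_wt, real_inner_comm]
  have h3 : inner ℝ (W (ζ t)) F ≤ baseConst R * ‖ζ t‖ ^ 2 + X * ((‖ζ t‖ ^ 2 + ρ ^ 2) / 2) := by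
    rw [hF, inner_add_right]
    refine add_le_add (ht.inner_opL2_le hd) ((real_inner_le_norm _ _).trans ?_)
    have h4 := norm_mulP_le (ht.perC_one_wt (p := 0)) (ht.abs_wt_le (Nat.zero_le n)) (ζ t)
    have h5 : ‖ζ t‖ * ‖r‖ ≤ (‖ζ t‖ ^ 2 + ρ ^ 2) / 2 := by
      have := mul_le_mul_of_nonneg_left hρ (norm_nonneg (ζ t))
      nlinarith [sq_nonneg (‖ζ t‖ - ρ)]
    have h6 := mul_le_mul_of_nonneg_right h4 (norm_nonneg r)
    have h7 := mul_le_mul_of_nonneg_left h5 (Real.exp_pos (logBound R)).le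
    linarith
  have h8 := ht.norm_sq_le_inner_wt (ζ t)
  have h9 := mul_le_mul_of_nonneg_left h8
    (add_nonneg (mul_nonneg zero_le_two (baseConst_nonneg hR)) (Real.exp_pos (logBound R)).le)
  rw [rate, ← hX, ← hΛ]
  rw [← hX, ← hW] at h9
  linarith

/-- Increments of the energy are dominated by those of the primitive of `C₁ + C₂ ‖F‖`: `C₁` pays for
the moving weight, `C₂ ‖F‖` for the moving function. -/
theorem absolutelyContinuous_weighted (h : TimeCoeffs M n R a b c d) {ζ : ℝ → L2per M}
    {F : ℝ → L2per M} {T : ℝ} (hT : 0 ≤ T) (hF : IntervalIntegrable F volume 0 T)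
    (hζ : ∀ t ∈ Icc 0 T, ζ t = ζ 0 + ∫ s in (0 : ℝ)..t, F s) :
    AbsolutelyContinuousOnInterval
      (fun s => inner ℝ (mulP M (wt M 0 (a s) (b s)) (ζ s)) (ζ s)) 0 T := by
  have hR : 0 ≤ R := zero_le_one.trans (h.coeffs 0).one_le
  set X := Real.exp (logBound R) with hX
  have hsub : ∀ {s t}, s ∈ Icc 0 T → t ∈ Icc 0 T → IntervalIntegrable F volume s t := fun hs ht =>
    hF.mono_set (by rw [uIcc_of_le hT]; exact uIcc_subset_Icc hs ht)
  have hdiff : ∀ {s t}, s ∈ Icc 0 T → t ∈ Icc 0 T → ζ t - ζ s = ∫ r in s..t, F r := fun {s t} hs ht => by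
    rw [hζ t ht, hζ s hs, add_sub_add_left_eq_sub]
    exact intervalIntegral.integral_interval_sub_left (hsub (left_mem_Icc.2 hT) ht)
      (hsub (left_mem_Icc.2 hT) hs)
  set Z := ‖ζ 0‖ + ∫ r in (0 : ℝ)..T, ‖F r‖ with hZ
  have hint : ∀ {s t}, s ∈ Icc 0 T → t ∈ Icc 0 T → s ≤ t → ‖ζ t - ζ s‖ ≤ ∫ r in s..t, ‖F r‖ :=
    fun hs ht hst => by
      rw [hdiff hs ht]
      exact intervalIntegral.norm_integral_le_integral_norm hst
  have hZt : ∀ t ∈ Icc 0 T, ‖ζ t‖ ≤ Z := fun t ht => by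
    have h1 := hint (left_mem_Icc.2 hT) ht ht.1
    have h2 : ∫ r in (0 : ℝ)..t, ‖F r‖ ≤ ∫ r in (0 : ℝ)..T, ‖F r‖ :=
      intervalIntegral.integral_mono_interval le_rfl ht.1 ht.2 (Eventually.of_forall fun _ => norm_nonneg _)
        hF.norm
    have h3 := norm_le_norm_add_norm_sub' (ζ t) (ζ 0)
    linarith
  have hZ0 : 0 ≤ Z := (norm_nonneg _).trans (hZt 0 (left_mem_Icc.2 hT))
  set C₁ := X * (lipConst R * R) * Z ^ 2 with hC₁
  set C₂ := 2 * (X * Z) with hC₂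
  have hgi : IntervalIntegrable (fun r => C₁ + C₂ * ‖F r‖) volume 0 T :=
    intervalIntegrable_const.add (hF.norm.const_mul C₂)
  have hle : ∀ {s t}, s ∈ Icc 0 T → t ∈ Icc 0 T → s ≤ t →
      |inner ℝ (mulP M (wt M 0 (a t) (b t)) (ζ t)) (ζ t) -
        inner ℝ (mulP M (wt M 0 (a s) (b s)) (ζ s)) (ζ s)| ≤
      ∫ r in s..t, (C₁ + C₂ * ‖F r‖) := by
    intro s t hs ht hst
    have i1 : ∫ r in s..t, (C₁ + C₂ * ‖F r‖) = C₁ * (t - s) + C₂ * ∫ r in s..t, ‖F r‖ := by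
      rw [intervalIntegral.integral_add intervalIntegrable_const ((hsub hs ht).norm.const_mul C₂),
        intervalIntegral.integral_const_mul C₂, intervalIntegral.integral_const, smul_eq_mul]
      ring
    have ct := (h.coeffs t).perC_one_wt (p := 0)
    have cs := (h.coeffs s).perC_one_wt (p := 0)
    have hw : ∀ x, |wt M 0 (a t) (b t) x - wt M 0 (a s) (b s) x| ≤ X * (lipConst R * R) * (t - s) := fun x => by
      refine ((h.coeffs t).abs_wt_sub_le (h.coeffs s) (Nat.zero_le n) (h.a_lip t s) (h.b_lip t s) x).trans
        (le_of_eq ?_)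
      rw [abs_of_nonneg (sub_nonneg.2 hst)]
      ring
    have t1 := norm_mulP_le (ct.sub cs) hw (ζ t)
    rw [mulP_sub_left ct cs] at t1
    set Wt := mulP M (wt M 0 (a t) (b t))
    set Ws := mulP M (wt M 0 (a s) (b s)) with hWs
    have t2 : inner ℝ (Wt (ζ t)) (ζ t) - inner ℝ (Ws (ζ s)) (ζ s) =
        inner ℝ (Wt (ζ t) - Ws (ζ t)) (ζ t) +
          (inner ℝ (Ws (ζ t)) (ζ t - ζ s) + inner ℝ (Ws (ζ s)) (ζ t - ζ s)) := by
      have : inner ℝ (Ws (ζ t)) (ζ s) = inner ℝ (Ws (ζ s)) (ζ t) := by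
        rw [hWs, inner_mulP_comm cs, real_inner_comm]
      simp only [inner_sub_left, inner_sub_right, this]
      ring
    have nW : ∀ f, ‖Ws f‖ ≤ X * ‖f‖ := fun f =>
      norm_mulP_le cs ((h.coeffs s).abs_wt_le (Nat.zero_le n)) f
    have hts : 0 ≤ X * (lipConst R * R) * (t - s) := by
      have := sub_nonneg.2 hst
      have := lipConst_nonneg hR
      positivity
    have e1 : |inner ℝ (Wt (ζ t) - Ws (ζ t)) (ζ t)| ≤ C₁ * (t - s) := by
      refine (abs_real_inner_le_norm _ _).trans ?_
      have := mul_le_mul t1 (hZt t ht) (norm_nonneg _) (mul_nonneg hts (norm_nonneg _))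
      refine this.trans ?_
      have := mul_le_mul_of_nonneg_left (hZt t ht) hts
      have := mul_le_mul_of_nonneg_right this hZ0
      rw [hC₁]
      linarith
    have e2 : ∀ v ∈ Icc 0 T, |inner ℝ (Ws (ζ v)) (ζ t - ζ s)| ≤ X * Z * ∫ r in s..t, ‖F r‖ := fun v hv => by
      refine (abs_real_inner_le_norm _ _).trans ?_
      exact mul_le_mul ((nW _).trans (mul_le_mul_of_nonneg_left (hZt v hv) (Real.exp_pos _).le))
        (hint hs ht hst) (norm_nonneg _) (by positivity)
    rw [t2, i1]
    have e3 := e2 t ht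
    have e4 := e2 s hs
    rw [abs_le] at e1 e3 e4 ⊢
    constructor <;> linarith [e1.1, e1.2, e3.1, e3.2, e4.1, e4.2]
  refine (hgi.absolutelyContinuousOnInterval_intervalIntegral (c := 0) left_mem_uIcc).of_dist_le ?_
  rw [uIcc_of_le hT]
  have hwlog : ∀ s ∈ Icc 0 T, ∀ t ∈ Icc 0 T, s ≤ t →
      dist (inner ℝ (mulP M (wt M 0 (a s) (b s)) (ζ s)) (ζ s))
        (inner ℝ (mulP M (wt M 0 (a t) (b t)) (ζ t)) (ζ t)) ≤
      dist (∫ r in (0 : ℝ)..s, (C₁ + C₂ * ‖F r‖)) (∫ r in (0 : ℝ)..t, (C₁ + C₂ * ‖F r‖)) := by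
    intro s hs t ht hst
    have hg : ∀ {v}, v ∈ Icc 0 T → IntervalIntegrable (fun r => C₁ + C₂ * ‖F r‖) volume 0 v := fun hv =>
      hgi.mono_set (by rw [uIcc_of_le hT]; exact uIcc_subset_Icc (left_mem_Icc.2 hT) hv)
    rw [dist_comm, Real.dist_eq, dist_comm, Real.dist_eq,
      intervalIntegral.integral_interval_sub_left (hg ht) (hg hs)]
    exact (hle hs ht hst).trans (le_abs_self _)
  intro s hs t ht
  rcases le_total s t with hst | hst
  · exact hwlog s hs t ht hst
  · rw [dist_comm, dist_comm (∫ r in (0 : ℝ)..s, (C₁ + C₂ * ‖F r‖))]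
    exact hwlog t ht s hs hst

/-- The energy inequality of order zero for approximate solutions. -/
theorem norm_sq_le_of_residual (h : TimeCoeffs M n R a b c d) {z F : ℝ → L2per M} {T : ℝ}
    (hT : 0 ≤ T) (hF : IntervalIntegrable F volume 0 T)
    (hz : ∀ t ∈ Icc 0 T, z t = z 0 + ∫ s in (0 : ℝ)..t, F s) {ρ : ℝ}
    (hres : ∀ᵐ t, t ∈ Ioo 0 T → HasFDer (z t) ∧ ‖F t - opL2 (a t) (b t) (c t) (d t) (z t)‖ ≤ ρ)
    {t : ℝ} (ht : t ∈ Icc 0 T) : ‖z t‖ ^ 2 ≤ energyConst R T * (‖z 0‖ ^ 2 + ρ ^ 2) := by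
  have hR : 0 ≤ R := zero_le_one.trans (h.coeffs 0).one_le
  set X := Real.exp (logBound R) with hX
  have hX0 : 0 < X := Real.exp_pos _
  have hFt : IntervalIntegrable F volume 0 t :=
    hF.mono_set (by rw [uIcc_of_le hT, uIcc_of_le ht.1]; exact Icc_subset_Icc_right ht.2)
  have hzt : ∀ s ∈ Icc 0 t, z s = z 0 + ∫ r in (0 : ℝ)..s, F r := fun s hs => hz s ⟨hs.1, hs.2.trans ht.2⟩
  have hder : ∀ᵐ s, s ∈ Ioo 0 t → HasDerivAt z (F s) s := by
    filter_upwards [hFt.ae_hasDerivAt_integral] with s hs hsI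
    have h1 := hs (by rw [uIcc_of_le ht.1]; exact Ioo_subset_Icc_self hsI) 0 left_mem_uIcc
    refine (h1.const_add (z 0)).congr_of_eventuallyEq ?_
    filter_upwards [Ioo_mem_nhds hsI.1 hsI.2] with r hr
    exact hzt r (Ioo_subset_Icc_self hr)
  have key := (h.absolutelyContinuous_weighted ht.1 hFt hzt).le_exp_mul ht.1 (rate_nonneg hR)
    (mul_nonneg hX0.le (sq_nonneg ρ)) (by
      filter_upwards [hder, hres] with s hs1 hs2 hsI φ' hφ
      obtain ⟨hd, hr⟩ := hs2 ⟨hsI.1, hsI.2.trans_le ht.2⟩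
      exact h.hasDerivAt_weighted_le (hs1 hsI) hd hr (by abel) hφ)
  have h1 := (h.coeffs t).norm_sq_le_inner_wt (z t)
  have h2 := (h.coeffs 0).inner_wt_le (z 0)
  refine h1.trans ?_
  rw [energyConst, ← hX, mul_assoc X, mul_assoc (Real.exp (rate R * T))]
  refine mul_le_mul_of_nonneg_left (key.trans ?_) hX0.le
  have hexp : Real.exp (rate R * t) ≤ Real.exp (rate R * T) :=
    Real.exp_le_exp.2 (mul_le_mul_of_nonneg_left ht.2 (rate_nonneg hR))
  have h3 : inner ℝ (mulP M (wt M 0 (a 0) (b 0)) (z 0)) (z 0) + X * ρ ^ 2 * t ≤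
      X * (1 + T) * (‖z 0‖ ^ 2 + ρ ^ 2) := by
    have p1 : X * ρ ^ 2 * t ≤ X * ρ ^ 2 * T := mul_le_mul_of_nonneg_left ht.2 (by positivity)
    have p2 : 0 ≤ X * T * ‖z 0‖ ^ 2 := by positivity
    have p3 : 0 ≤ X * ρ ^ 2 := by positivity
    linarith
  calc _ ≤ Real.exp (rate R * t) * (X * (1 + T) * (‖z 0‖ ^ 2 + ρ ^ 2)) :=
        mul_le_mul_of_nonneg_left h3 (Real.exp_pos _).le
    _ ≤ _ := mul_le_mul_of_nonneg_right hexp (by positivity)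

end TimeCoeffs

end EnergyInequality

/-! ### Approximate solutions bounded in `H^n` -/

section ApproximateSolutions

/-- The floor selects the value of a step function. Its values at the nodes are immaterial, which is
why `t` may range over the closed step. -/
theorem intervalIntegral_step {E : Type*} [NormedAddCommGroup E] [NormedSpace ℝ E] [CompleteSpace E]
    (G : ℕ → E) {τ : ℝ} (hτ : 0 < τ) (i : ℕ) {t : ℝ} (ht : t ∈ Icc (i * τ) ((i + 1 : ℕ) * τ)) :
    IntervalIntegrable (fun s => G ⌊s / τ⌋₊) volume 0 t ∧
      ∫ s in (0 : ℝ)..t, G ⌊s / τ⌋₊ = τ • ∑ j ∈ Finset.range i, G j + (t - i * τ) • G i := by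
  have hpiece : ∀ {i : ℕ} {t : ℝ}, t ∈ Icc (i * τ) ((i + 1 : ℕ) * τ) →
      IntervalIntegrable (fun s => G ⌊s / τ⌋₊) volume (i * τ) t ∧
        ∫ s in (i * τ)..t, G ⌊s / τ⌋₊ = (t - i * τ) • G i := by
    intro i t ht
    have heq : ∀ s ∈ Ioo (i * τ) t, G ⌊s / τ⌋₊ = G i := fun s hs => by
      congr 1
      rw [Nat.floor_eq_iff (div_nonneg (le_trans (by positivity) hs.1.le) hτ.le), le_div_iff₀ hτ,
        div_lt_iff₀ hτ]
      refine ⟨hs.1.le, hs.2.trans_le (ht.2.trans (le_of_eq ?_))⟩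
      push_cast
      ring
    have hae : (fun _ => G i) =ᵐ[volume.restrict (uIoc (i * τ) t)] fun s => G ⌊s / τ⌋₊ := by
      rw [uIoc_of_le ht.1, ← restrict_Ioo_eq_restrict_Ioc]
      filter_upwards [self_mem_ae_restrict measurableSet_Ioo] with s hs
      exact (heq s hs).symm
    refine ⟨(intervalIntegrable_const (μ := volume)).congr_ae hae, ?_⟩
    rw [← intervalIntegral.integral_const]
    exact intervalIntegral.integral_congr_ae_restrict hae.symm
  induction i generalizing t with
  | zero => simpa using hpiece ht
  | succ i ih =>
    have h1 := ih (t := (i + 1 : ℕ) * τ) ⟨by gcongr; lia, le_rfl⟩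
    have h2 := hpiece ht
    refine ⟨h1.1.trans h2.1, ?_⟩
    rw [← intervalIntegral.integral_add_adjacent_intervals h1.1 h2.1, h1.2, h2.2,
      Finset.sum_range_succ, smul_add]
    congr 3
    push_cast
    ring

variable {M : ℝ} [hM : Fact (0 < M)]

theorem plainEnergy_trunc_le {n : ℕ} (K : ℕ) (g : Sob M n) :
    plainEnergy M n (trunc K (Sob.toL2 g)) ≤ 2 * ‖g‖ ^ 2 := by
  have h := perC_trunc n K (Sob.toL2 g)
  have h0 := norm_perL2_iter_trunc_le (j := 0) (by simp) K g
  have hn := norm_perL2_iter_trunc_le (j := n) le_rfl K g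
  rw [iteratedDeriv_zero] at h0
  rw [plainEnergy, ← norm_sq_perL2 (h.mono (Nat.zero_le n)), ← norm_sq_perL2 (h.iter (l := 0) (by lia))]
  have := pow_le_pow_left₀ (norm_nonneg _) h0 2
  have := pow_le_pow_left₀ (norm_nonneg _) hn 2
  linarith

namespace Coeffs

variable {n : ℕ} {R : ℝ} {a b c d a' b' c' d' : ℝ → ℝ}

theorem norm_opL2_sub_le (h : Coeffs M n R a b c d) (h' : Coeffs M n R a' b' c' d') {θ : ℝ}
    (ha : ∀ x, |a x - a' x| ≤ θ) (hb : ∀ x, |b x - b' x| ≤ θ) (hc : ∀ x, |c x - c' x| ≤ θ)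
    (hd : ∀ x, |d x - d' x| ≤ θ) (g : Sob M n) :
    ‖opL2 a b c d (Sob.toL2 g) - opL2 a' b' c' d' (Sob.toL2 g)‖ ≤ 4 * θ * ‖g‖ := by
  have z : ∀ {k : ℕ} {φ : ℝ → ℝ}, PerC M k φ → PerC M 0 φ := fun hφ => hφ.mono (Nat.zero_le _)
  have hθ : 0 ≤ θ := (abs_nonneg _).trans (ha 0)
  have hn : ∀ j ≤ 3, ‖fder j (Sob.toL2 g)‖ ≤ ‖g‖ := fun j hj =>
    Sob.norm_fder_le (by exact_mod_cast hj.trans (by linarith [h.four_le])) g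
  have h0 : ‖Sob.toL2 g‖ ≤ ‖g‖ := Sob.norm_toL2_le (Nat.cast_nonneg n) g
  have e : opL2 a b c d (Sob.toL2 g) - opL2 a' b' c' d' (Sob.toL2 g) =
      mulP M (fun x => a x - a' x) (fder 3 (Sob.toL2 g)) + mulP M (fun x => b x - b' x) (fder 2 (Sob.toL2 g))
      + mulP M (fun x => c x - c' x) (fder 1 (Sob.toL2 g)) + mulP M (fun x => d x - d' x) (Sob.toL2 g) := by
    rw [mulP_sub_left (z h.ha) (z h'.ha), mulP_sub_left (z h.hb) (z h'.hb),
      mulP_sub_left (z h.hc) (z h'.hc), mulP_sub_left (z h.hd) (z h'.hd), opL2, opL2]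
    abel
  rw [e]
  refine (norm_add₄_le).trans ?_
  have m := fun {φ : ℝ → ℝ} (hφ : PerC M 0 φ) (hb : ∀ x, |φ x| ≤ θ) {f : L2per M} (hf : ‖f‖ ≤ ‖g‖) =>
    (norm_mulP_le hφ hb f).trans (mul_le_mul_of_nonneg_left hf hθ)
  linarith [m ((z h.ha).sub (z h'.ha)) ha (hn 3 le_rfl), m ((z h.hb).sub (z h'.hb)) hb (hn 2 (by lia)),
    m ((z h.hc).sub (z h'.hc)) hc (hn 1 (by lia)), m ((z h.hd).sub (z h'.hd)) hd h0]

theorem norm_opL2_le_of_fder (h : Coeffs M n R a b c d) {f : L2per M} {η : ℝ}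
    (hf : ∀ j ≤ 3, ‖fder j f‖ ≤ η) : ‖opL2 a b c d f‖ ≤ 4 * R * η := by
  have z : ∀ {k : ℕ} {φ : ℝ → ℝ}, PerC M k φ → PerC M 0 φ := fun hφ => hφ.mono (Nat.zero_le _)
  have hR : 0 ≤ R := zero_le_one.trans h.one_le
  have h0 : ‖f‖ ≤ η := by
    have := hf 0 (by lia)
    rwa [(isFDeriv_zero f).fder_eq] at this
  rw [opL2]
  refine (norm_add₄_le).trans ?_
  have m := fun {φ : ℝ → ℝ} (hφ : PerC M 0 φ) (hb : ∀ x, |φ x| ≤ R) {f : L2per M} (hf : ‖f‖ ≤ η) =>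
    (norm_mulP_le hφ hb f).trans (mul_le_mul_of_nonneg_left hf hR)
  linarith [m (z h.ha) (fun x => by simpa using h.a_le 0 (by lia) x) (hf 3 le_rfl),
    m (z h.hb) (fun x => by simpa using h.b_le 0 (by lia) x) (hf 2 (by lia)),
    m (z h.hc) (fun x => by simpa using h.c_le 0 (by lia) x) (hf 1 (by lia)),
    m (z h.hd) (fun x => by simpa using h.d_le 0 (by lia) x) h0]

theorem norm_opL2_le (h : Coeffs M n R a b c d) (g : Sob M n) :
    ‖opL2 a b c d (Sob.toL2 g)‖ ≤ 4 * R * ‖g‖ :=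
  h.norm_opL2_le_of_fder fun j hj =>
    Sob.norm_fder_le (by exact_mod_cast hj.trans (by linarith [h.four_le])) g

end Coeffs

/-- On bounded sets of `H^n`, `n ≥ 4`, the first three derivatives are small in `L²` where the
function is. -/
theorem Sob.exists_fder_le {n : ℕ} (hn : 4 ≤ n) (B : ℝ) {η : ℝ} (hη : 0 < η) :
    ∃ δ > 0, ∀ g : Sob M n, ‖g‖ ≤ B → ‖toL2 g‖ ≤ δ → ∀ j ≤ 3, ‖fder j (toL2 g)‖ ≤ η := by
  have hε : 0 < η ^ 2 / (2 * (B ^ 2 + 1)) := by positivity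
  have key : ∀ j : ℕ, ∃ δ > 0, j ≤ 3 → ∀ g : Sob M n, ‖g‖ ≤ B → ‖toL2 g‖ ≤ δ → ‖fder j (toL2 g)‖ ≤ η := by
    intro j
    by_cases hj : j ≤ 3
    · obtain ⟨C, hC, H⟩ := fder_interpolation (M := M) (s := n) (j := j)
        (by exact_mod_cast (by lia : j < n)) hε
      refine ⟨Real.sqrt (η ^ 2 / (2 * (C + 1))), Real.sqrt_pos.2 (by positivity), fun _ g hg hg' => ?_⟩
      refine le_of_sq_le_sq ((H g).trans ?_) hη.le
      have h1 := pow_le_pow_left₀ (norm_nonneg _) hg 2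
      have h2 := pow_le_pow_left₀ (norm_nonneg _) hg' 2
      rw [Real.sq_sqrt (by positivity)] at h2
      have h3 : η ^ 2 / (2 * (B ^ 2 + 1)) * ‖g‖ ^ 2 ≤ η ^ 2 / 2 := by
        calc _ ≤ η ^ 2 / (2 * (B ^ 2 + 1)) * (B ^ 2 + 1) := by gcongr; linarith
          _ = _ := by field_simp
      have h4 : C * ‖toL2 g‖ ^ 2 ≤ η ^ 2 / 2 := by
        calc _ ≤ (C + 1) * (η ^ 2 / (2 * (C + 1))) := by gcongr; linarith
          _ = _ := by field_simp
      linarith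
    · exact ⟨1, one_pos, fun h => absurd h hj⟩
  choose δ hδ H using key
  refine ⟨min (min (δ 0) (δ 1)) (min (δ 2) (δ 3)), by simp [hδ], fun g hg hg' j hj => H j hj g hg ?_⟩
  simp only [le_min_iff] at hg'
  interval_cases j <;> tauto

namespace TimeCoeffs

open Coeffs

variable {n : ℕ} {R : ℝ} {a b c d : ℝ → ℝ → ℝ}

/-- As `n > 3`, interpolation makes the operator continuous for the `L²` norm on bounded sets of
`H^n`, uniformly in time because the coefficients are bounded by `R` at every time. -/
theorem exists_opL2_le (h : TimeCoeffs M n R a b c d) (B : ℝ) {ε : ℝ} (hε : 0 < ε) :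
    ∃ δ > 0, ∀ t, ∀ g : Sob M n, ‖g‖ ≤ B → ‖Sob.toL2 g‖ ≤ δ →
      ‖opL2 (a t) (b t) (c t) (d t) (Sob.toL2 g)‖ ≤ ε := by
  have hR : 0 < R := zero_lt_one.trans_le (h.coeffs 0).one_le
  obtain ⟨δ, hδ, H⟩ := Sob.exists_fder_le (M := M) (h.coeffs 0).four_le B (η := ε / (4 * R)) (by positivity)
  refine ⟨δ, hδ, fun t g hg hg' => ((h.coeffs t).norm_opL2_le_of_fder (H g hg hg')).trans (le_of_eq ?_)⟩
  field_simp

theorem exists_opL2_sub_le (h : TimeCoeffs M n R a b c d) {B : ℝ} (hB : 0 ≤ B) {ε : ℝ} (hε : 0 < ε) :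
    ∃ δ > 0, ∀ t s, |t - s| < δ → ∀ g : Sob M n, ‖g‖ ≤ B →
      ‖opL2 (a t) (b t) (c t) (d t) (Sob.toL2 g) - opL2 (a s) (b s) (c s) (d s) (Sob.toL2 g)‖ ≤ ε := by
  have hR : 0 < R := zero_lt_one.trans_le (h.coeffs 0).one_le
  set θ := ε / (4 * (B + 1)) with hθ
  have hθ0 : 0 < θ := by positivity
  obtain ⟨δ₁, hδ₁, H₁⟩ := h.c_unif θ hθ0
  obtain ⟨δ₂, hδ₂, H₂⟩ := h.d_unif θ hθ0
  refine ⟨min (θ / R) (min δ₁ δ₂), by positivity, fun t s hts g hg => ?_⟩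
  simp only [lt_min_iff] at hts
  have hlip : R * |t - s| ≤ θ := by
    have := (lt_div_iff₀ hR).1 hts.1
    linarith
  refine ((h.coeffs t).norm_opL2_sub_le (h.coeffs s) (fun x => (h.a_lip t s x).trans hlip)
    (fun x => (h.b_lip t s x).trans hlip) (H₁ t s hts.2.1) (H₂ t s hts.2.2) g).trans ?_
  calc 4 * θ * ‖g‖ ≤ 4 * θ * (B + 1) := by gcongr; linarith
    _ = ε := by rw [hθ]; field_simp

/-- The constant in the bound for the solution in `H^n`. -/
def solConst (R : ℝ) (n : ℕ) (T : ℝ) : ℝ :=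
  Real.sqrt (2 ^ n * (Real.exp (logBound R) * (Real.exp (growth R n * (T + 1)) *
    (Real.exp (logBound R) * (4 * (T + 1)))))) + 2

theorem growth_nonneg {R : ℝ} (hR : 0 ≤ R) : 0 ≤ growth R n := by
  have := stepConst_nonneg (n := n) hR
  have := lipConst_nonneg hR
  rw [growth]
  positivity

set_option maxHeartbeats 1600000 in
/-- The backward Euler scheme gives approximate solutions that are bounded in `H^n`. -/
theorem exists_approx (h : TimeCoeffs M n R a b c d) {T : ℝ} (hT : 0 < T) (u₀ : Sob M n)
    {e : ℝ → Sob M n} (he : StronglyMeasurable e) {E : ℝ} (hE : ∀ t, ‖e t‖ ≤ E) {ε : ℝ} (hε : 0 < ε) :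
    ∃ z F : ℝ → L2per M, IntervalIntegrable F volume 0 T ∧
      (∀ t ∈ Icc 0 T, z t = z 0 + ∫ s in (0 : ℝ)..t, F s) ∧
      (∀ t ∈ Icc 0 T, ∃ g : Sob M n, Sob.toL2 g = z t ∧ ‖g‖ ≤ solConst R n T * (‖u₀‖ + E)) ∧
      ‖z 0 - Sob.toL2 u₀‖ ≤ ε ∧
      ∀ t ∈ Icc 0 T, ‖F t - opL2 (a t) (b t) (c t) (d t) (z t) - Sob.toL2 (e t)‖ ≤ ε := by
  have hn4 : 4 ≤ n := (h.coeffs 0).four_le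
  have : CompleteSpace (Sob M n) := Sob.completeSpace (Nat.cast_nonneg n)
  have hR : 0 ≤ R := zero_le_one.trans (h.coeffs 0).one_le
  have hM0 : 0 < M := hM.out
  have hE0 : 0 ≤ E := (norm_nonneg _).trans (hE 0)
  set S := ‖u₀‖ + E with hS
  have hS0 : 0 ≤ S := by positivity
  set Q := Real.sqrt (2 ^ n * (Real.exp (logBound R) * (Real.exp (growth R n * (T + 1)) *
    (Real.exp (logBound R) * (4 * (T + 1)))))) with hQ
  have hQ0 : 0 ≤ Q := Real.sqrt_nonneg _
  have hsol : solConst R n T = Q + 2 := rfl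
  set B := (Q + 2) * S with hB
  have hB0 : 0 ≤ B := by positivity
  -- The residual has three parts of size `ε / 3`: coefficients taken at the next node (`δ₁`), the
  -- function replaced by its value at the next node (`δ₂`), and truncation of the forcing (`K`).
  obtain ⟨δ₁, hδ₁, H₁⟩ := h.exists_opL2_sub_le hB0 (ε := ε / 3) (by positivity)
  obtain ⟨δ₂, hδ₂, H₂⟩ := h.exists_opL2_le (2 * B) (ε := ε / 3) (by positivity)
  obtain ⟨K, hKe⟩ := exists_nat_gt (M * (S + 1) / (ε / 3))
  have hK1 : (0 : ℝ) < K := lt_of_le_of_lt (by positivity) hKe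
  have hK : 0 < K := by exact_mod_cast hK1
  have htr : ∀ g : Sob M n, ‖g‖ ≤ S → ‖truncL M K (Sob.toL2 g) - Sob.toL2 g‖ ≤ ε / 3 := fun g hg => by
    refine (norm_truncL_sub_le (by exact_mod_cast (by lia : 1 ≤ n)) hK g).trans ?_
    rw [div_mul_eq_mul_div, div_le_iff₀ hK1]
    rw [div_lt_iff₀ (by positivity)] at hKe
    have : M * ‖g‖ ≤ M * (S + 1) := by gcongr; linarith
    linarith
  -- `D` bounds the speed of the approximation in `L²`, so `τ D ≤ δ₂` keeps it within `δ₂` of the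
  -- next node.
  set D := 4 * R * B + E with hD
  have hD0 : 0 ≤ D := by positivity
  have hst := stepConst_nonneg (n := n) hR
  obtain ⟨τ, hτ, hτ1, hτC, hτδ₁, hτδ₂⟩ : ∃ τ : ℝ, 0 < τ ∧ τ ≤ 1 ∧ τ * stepConst R n ≤ 1 / 4 ∧
      τ < δ₁ ∧ τ * D ≤ δ₂ := by
    refine ⟨min (min 1 (1 / (4 * (stepConst R n + 1)))) (min (δ₁ / 2) (δ₂ / (D + 1))), by positivity,
      (min_le_left _ _).trans (min_le_left _ _), ?_, ?_, ?_⟩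
    · calc _ ≤ 1 / (4 * (stepConst R n + 1)) * (stepConst R n + 1) :=
          mul_le_mul ((min_le_left _ _).trans (min_le_right _ _)) (by linarith) hst (by positivity)
        _ = 1 / 4 := by field_simp
    · exact ((min_le_right _ _).trans (min_le_left _ _)).trans_lt (by linarith)
    · calc _ ≤ δ₂ / (D + 1) * (D + 1) :=
          mul_le_mul ((min_le_right _ _).trans (min_le_right _ _)) (by linarith) hD0 (by positivity)
        _ = δ₂ := by field_simp
  have hei : ∀ r s, IntervalIntegrable e volume r s := fun r s =>
    (intervalIntegrable_const (c := E)).mono_fun he.aestronglyMeasurable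
      (Eventually.of_forall fun t => (hE t).trans (le_abs_self E))
  set v : ℝ → Sob M n := fun t => ∫ s in (0 : ℝ)..t, e s with hv
  have hvsub : ∀ r s, v s - v r = ∫ t in r..s, e t := fun r s =>
    intervalIntegral.integral_interval_sub_left (hei _ _) (hei _ _)
  have hvn : ∀ r s, r ≤ s → ‖v s - v r‖ ≤ E * (s - r) := fun r s hrs => by
    rw [hvsub]
    have := intervalIntegral.norm_integral_le_of_norm_le_const (a := r) (b := s) (f := e) fun x _ => hE x
    rwa [abs_of_nonneg (sub_nonneg.2 hrs)] at this
  set L : Sob M n →L[ℝ] L2per M := (truncL M K).comp (Sob.toL2L (Nat.cast_nonneg n)) with hL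
  have hLapp : ∀ g, L g = perL2 M (trunc K (Sob.toL2 g)) := fun g => rfl
  have hLn : ∀ g, ‖L g‖ ≤ ‖g‖ := fun g => by
    obtain ⟨g', hg', hn'⟩ := exists_truncL K g
    have : L g = Sob.toL2 g' := hg'.symm
    rw [this]
    exact (Sob.norm_toL2_le (Nat.cast_nonneg n) g').trans hn'
  -- The scheme is fed the mean of the forcing over each step. The discrete sums then telescope to
  -- its primitive `v`, and the interpolation in time passes exactly through the nodes. Truncation
  -- makes the sources smooth enough for the scheme.
  set ei : ℕ → Sob M n := fun i => τ⁻¹ • (v ((i + 1 : ℕ) * τ) - v (i * τ)) with hei'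
  have hstep : ∀ i : ℕ, ((i + 1 : ℕ) : ℝ) * τ - i * τ = τ := fun i => by push_cast; ring
  have hein : ∀ i, ‖ei i‖ ≤ E := fun i => by
    have := hvn (i * τ) ((i + 1 : ℕ) * τ) (by linarith [hstep i])
    rw [hstep] at this
    rw [hei', norm_smul, norm_inv, Real.norm_of_nonneg hτ.le, inv_mul_le_iff₀ hτ]
    linarith
  obtain ⟨u, hu0, hu, hueq, hubd⟩ := h.exists_scheme hτ hτ1 hτC (perC_trunc (n + 3) K (Sob.toL2 u₀))
    (e := fun i => trunc K (Sob.toL2 (ei i))) (fun i => perC_trunc n K _) (B := 2 * E ^ 2) fun i =>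
      (plainEnergy_trunc_le K _).trans
        (mul_le_mul_of_nonneg_left (pow_le_pow_left₀ (norm_nonneg _) (hein i) 2) zero_le_two)
  set U : ℕ → L2per M := fun i => perL2 M (u i) with hU
  set G : ℕ → L2per M := fun i => opL2 (a ((i + 1 : ℕ) * τ)) (b ((i + 1 : ℕ) * τ))
    (c ((i + 1 : ℕ) * τ)) (d ((i + 1 : ℕ) * τ)) (U (i + 1)) with hG
  have hUG : ∀ i, U (i + 1) - τ • G i = U i + L (v ((i + 1 : ℕ) * τ) - v (i * τ)) := fun i => by
    have hui := (hu (i + 1)).mono (l := 3) (by lia)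
    have hs := (h.coeffs ((i + 1 : ℕ) * τ)).perC_spatialOp (Nat.zero_le n) hui
    have e1 : L (v ((i + 1 : ℕ) * τ) - v (i * τ)) = τ • L (ei i) := by
      rw [hei', map_smul, smul_inv_smul₀ hτ.ne']
    rw [e1, hLapp, hG, hU]
    simp only
    rw [(h.coeffs ((i + 1 : ℕ) * τ)).opL2_perL2 hui, ← perL2_const_mul hs, ← perL2_const_mul (perC_trunc 0 K _),
      ← perL2_sub (hui.mono (Nat.zero_le _)) (hs.const_mul τ),
      ← perL2_add ((hu i).mono (Nat.zero_le _)) ((perC_trunc 0 K _).const_mul τ)]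
    congr 1
    funext x
    exact hueq i x
  have hsum : ∀ i : ℕ, τ • ∑ j ∈ Finset.range i, G j = U i - U 0 - L (v (i * τ)) := fun i => by
    induction i with
    | zero => simp [hv]
    | succ i ih =>
      rw [Finset.sum_range_succ, smul_add, ih]
      have := hUG i
      rw [map_sub, sub_eq_iff_eq_add] at this
      rw [this]
      abel
  -- The bound extends to `T + 1` because the implicit step refers to the node after `t`, and `τ ≤
  -- 1`.
  have hUs : ∀ i : ℕ, i * τ ≤ T + 1 → ∃ g : Sob M n, Sob.toL2 g = U i ∧ ‖g‖ ≤ Q * S := fun i hi => by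
    obtain ⟨g, hg, hg'⟩ := exists_sob_perL2 ((hu i).mono (l := n) (by lia))
    refine ⟨g, hg, le_of_sq_le_sq (hg'.trans ?_) (by positivity)⟩
    rw [mul_pow, hQ, Real.sq_sqrt (by positivity)]
    have p1 := hubd i
    rw [plainEnergy] at p1
    have p2 := plainEnergy_trunc_le K u₀
    have p3 : plainEnergy M n (trunc K (Sob.toL2 u₀)) + 2 * (i * τ) * (2 * E ^ 2) ≤ 4 * (T + 1) * S ^ 2 := by
      have q1 : (i * τ) * E ^ 2 ≤ (T + 1) * E ^ 2 := by gcongr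
      have q2 : 0 ≤ T * ‖u₀‖ ^ 2 := by positivity
      have q3 : ‖u₀‖ ^ 2 + E ^ 2 ≤ S ^ 2 := by
        rw [hS]
        nlinarith [norm_nonneg u₀]
      have q4 : (T + 1) * (‖u₀‖ ^ 2 + E ^ 2) ≤ (T + 1) * S ^ 2 := by gcongr
      linarith [sq_nonneg ‖u₀‖]
    have p4 : Real.exp (growth R n * (i * τ)) ≤ Real.exp (growth R n * (T + 1)) :=
      Real.exp_le_exp.2 (mul_le_mul_of_nonneg_left hi (growth_nonneg hR))
    calc _ ≤ 2 ^ n * (Real.exp (logBound R) * (Real.exp (growth R n * (i * τ)) *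
          (Real.exp (logBound R) * (plainEnergy M n (trunc K (Sob.toL2 u₀)) + 2 * (i * τ) * (2 * E ^ 2))))) := by
          gcongr
      _ ≤ 2 ^ n * (Real.exp (logBound R) * (Real.exp (growth R n * (T + 1)) *
          (Real.exp (logBound R) * (4 * (T + 1) * S ^ 2)))) := by
          have := plainEnergy_nonneg (M := M) n (trunc K (Sob.toL2 u₀))
          gcongr
      _ = _ := by ring
  have hLi : ∀ t, ∫ s in (0 : ℝ)..t, L (e s) = L (v t) := fun t =>
    L.intervalIntegral_comp_comm (hei 0 t)
  have hLint : ∀ t, IntervalIntegrable (fun s => L (e s)) volume 0 t := fun t =>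
    ⟨L.integrable_comp (hei 0 t).1, L.integrable_comp (hei 0 t).2⟩
  -- The forcing enters `F` at its actual value and not as a mean over the step, so that the
  -- residual compares it with `e t` itself even though `e` is only measurable in time.
  set F : ℝ → L2per M := fun t => G ⌊t / τ⌋₊ + L (e t) with hF
  set z : ℝ → L2per M := fun t => U 0 + ∫ s in (0 : ℝ)..t, F s with hz
  have hz0 : z 0 = U 0 := by simp [hz]
  have hmem : ∀ t, 0 ≤ t → t ∈ Icc (⌊t / τ⌋₊ * τ) ((⌊t / τ⌋₊ + 1 : ℕ) * τ) := fun t ht => by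
    refine ⟨(le_div_iff₀ hτ).1 (Nat.floor_le (div_nonneg ht hτ.le)), ?_⟩
    have := (Nat.lt_floor_add_one (t / τ)).le
    rw [div_le_iff₀ hτ] at this
    exact_mod_cast this
  have hFint : ∀ t, 0 ≤ t → IntervalIntegrable F volume 0 t := fun t ht =>
    (intervalIntegral_step G hτ _ (hmem t ht)).1.add (hLint t)
  have hzt : ∀ t, 0 ≤ t → z t = U ⌊t / τ⌋₊ + (t - ⌊t / τ⌋₊ * τ) • G ⌊t / τ⌋₊ +
      L (v t - v (⌊t / τ⌋₊ * τ)) := fun t ht => by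
    have := intervalIntegral_step G hτ _ (hmem t ht)
    rw [hz]
    simp only [hF]
    rw [intervalIntegral.integral_add this.1 (hLint t), this.2, hsum, hLi, map_sub]
    abel
  have hzb : ∀ t ∈ Icc 0 T, ∃ g : Sob M n, Sob.toL2 g = z t ∧ ‖g‖ ≤ B := by
    intro t ht
    set i := ⌊t / τ⌋₊ with hi
    have hm := hmem t ht.1
    rw [← hi] at hm
    have hsi := hstep i
    obtain ⟨g₁, hg₁, hn₁⟩ := hUs i (by linarith [hm.1, ht.2])
    obtain ⟨g₂, hg₂, hn₂⟩ := hUs (i + 1) (by linarith [hm.1, ht.2])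
    obtain ⟨g₃, hg₃, hn₃⟩ := exists_truncL K (v ((i + 1 : ℕ) * τ) - v (i * τ))
    obtain ⟨g₄, hg₄, hn₄⟩ := exists_truncL K (v t - v (i * τ))
    -- Between nodes `z t` is the convex combination of `U i` and `U (i + 1)` with parameter `s`,
    -- plus a correction from the forcing inside the step. The correction has norm at most `2 E`,
    -- which accounts for the `+ 2` in `solConst`.
    set s := (t - i * τ) / τ with hs
    have hs0 : 0 ≤ s := div_nonneg (by linarith [hm.1]) hτ.le
    have hs1 : s ≤ 1 := (div_le_one₀ hτ).2 (by linarith [hm.2])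
    refine ⟨((1 - s) • g₁ + s • g₂) + (g₄ - s • g₃), ?_, ?_⟩
    · rw [hzt t ht.1, ← hi]
      have e1 : (t - i * τ) • G i = s • (τ • G i) := by
        rw [smul_smul, hs]
        congr 1
        field_simp
      have e2 : τ • G i = U (i + 1) - U i - L (v ((i + 1 : ℕ) * τ) - v (i * τ)) := by
        rw [sub_sub, ← hUG i]
        abel
      have e3 : Sob.toL2 g₃ = L (v ((i + 1 : ℕ) * τ) - v (i * τ)) := hg₃
      have e4 : Sob.toL2 g₄ = L (v t - v (i * τ)) := hg₄
      rw [e1, e2]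
      simp only [map_add, map_sub, map_smul, hg₁, hg₂, e3, e4]
      module
    · have k3 : ‖g₃‖ ≤ E := by
        have := hn₃.trans (hvn _ _ (by linarith))
        rw [hsi] at this
        nlinarith
      have k4 : ‖g₄‖ ≤ E := by
        have := hn₄.trans (hvn _ _ hm.1)
        nlinarith [hm.2]
      have k1 : ‖(1 - s) • g₁ + s • g₂‖ ≤ Q * S := by
        refine (norm_add_le _ _).trans ?_
        rw [norm_smul, norm_smul, Real.norm_of_nonneg hs0, Real.norm_of_nonneg (sub_nonneg.2 hs1)]
        nlinarith
      have k2 : ‖g₄ - s • g₃‖ ≤ 2 * E := by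
        refine (norm_sub_le _ _).trans ?_
        rw [norm_smul, Real.norm_of_nonneg hs0]
        nlinarith [norm_nonneg g₃]
      refine (norm_add_le _ _).trans ?_
      rw [hB, hS]
      rw [hS] at k1
      nlinarith [norm_nonneg u₀]
  refine ⟨z, F, hFint T hT.le, fun t _ => by rw [hz0], hzb, ?_, fun t ht => ?_⟩
  · have : z 0 = truncL M K (Sob.toL2 u₀) := by
      rw [hz0, hU]
      simp only [hu0]
      rfl
    rw [this]
    exact (htr u₀ (by linarith)).trans (by linarith)
  · set i := ⌊t / τ⌋₊ with hi
    have hm := hmem t ht.1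
    rw [← hi] at hm
    have hsi := hstep i
    obtain ⟨g₂, hg₂, hn₂⟩ := hUs (i + 1) (by linarith [hm.1, ht.2])
    obtain ⟨gz, hgz, hnz⟩ := hzb t ht
    have hn₂' : ‖g₂‖ ≤ B := hn₂.trans (by rw [hB]; nlinarith)
    have hGn : ‖G i‖ ≤ 4 * R * B := by
      rw [hG]
      simp only
      rw [← hg₂]
      exact ((h.coeffs _).norm_opL2_le g₂).trans (by gcongr)
    have hdiff : ‖Sob.toL2 (g₂ - gz)‖ ≤ δ₂ := by
      have e1 : Sob.toL2 (g₂ - gz) = ((i + 1 : ℕ) * τ - t) • G i + L (v ((i + 1 : ℕ) * τ) - v t) := by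
        rw [map_sub, hg₂, hgz, hzt t ht.1, ← hi]
        have e2 : U (i + 1) = τ • G i + U i + L (v ((i + 1 : ℕ) * τ) - v (i * τ)) := by
          rw [add_assoc, ← hUG i]
          abel
        rw [e2]
        simp only [map_sub]
        push_cast
        module
      rw [e1]
      refine (norm_add_le _ _).trans (le_trans ?_ hτδ₂)
      rw [norm_smul, Real.norm_of_nonneg (sub_nonneg.2 hm.2)]
      have k1 := (hLn (v ((i + 1 : ℕ) * τ) - v t)).trans (hvn _ _ hm.2)
      have k2 : (i + 1 : ℕ) * τ - t ≤ τ := by linarith [hm.1]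
      have k3 : ((i + 1 : ℕ) * τ - t) * ‖G i‖ ≤ τ * (4 * R * B) :=
        mul_le_mul k2 hGn (norm_nonneg _) hτ.le
      have k4 : E * ((i + 1 : ℕ) * τ - t) ≤ E * τ := mul_le_mul_of_nonneg_left k2 hE0
      rw [hD]
      linarith
    have r1 : ‖G i - opL2 (a t) (b t) (c t) (d t) (Sob.toL2 g₂)‖ ≤ ε / 3 := by
      rw [hG]
      simp only
      rw [← hg₂]
      refine H₁ _ _ ?_ g₂ hn₂'
      rw [abs_of_nonneg (sub_nonneg.2 hm.2)]
      linarith [hm.1]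
    have r2 := H₂ t (g₂ - gz) ((norm_sub_le _ _).trans (by linarith)) hdiff
    have h3n : (3 : ℝ) ≤ n := by exact_mod_cast (by lia : 3 ≤ n)
    rw [map_sub, opL2_sub _ _ _ _ (Sob.hasFDer h3n g₂) (Sob.hasFDer h3n gz), hgz] at r2
    have r3 : ‖L (e t) - Sob.toL2 (e t)‖ ≤ ε / 3 := htr (e t) ((hE t).trans (by linarith [norm_nonneg u₀]))
    have e1 : F t - opL2 (a t) (b t) (c t) (d t) (z t) - Sob.toL2 (e t) =
        (G i - opL2 (a t) (b t) (c t) (d t) (Sob.toL2 g₂)) +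
        (opL2 (a t) (b t) (c t) (d t) (Sob.toL2 g₂) - opL2 (a t) (b t) (c t) (d t) (z t)) +
        (L (e t) - Sob.toL2 (e t)) := by
      rw [hF]
      simp only [← hi]
      abel
    rw [e1]
    refine (norm_add₃_le).trans ?_
    linarith

end TimeCoeffs

end ApproximateSolutions

/-! ### Uniqueness, and passage to the limit -/

section LimitOfApproximations

variable {M : ℝ} [hM : Fact (0 < M)]

namespace TimeCoeffs

open Coeffs

variable {n : ℕ} {R : ℝ} {a b c d : ℝ → ℝ → ℝ}

/-- Two approximate solutions are close if their initial data and their residuals are. -/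
theorem norm_sub_sq_le (h : TimeCoeffs M n R a b c d) {z F z' F' r : ℝ → L2per M} {T : ℝ}
    (hT : 0 ≤ T) (hF : IntervalIntegrable F volume 0 T) (hF' : IntervalIntegrable F' volume 0 T)
    (hz : ∀ t ∈ Icc 0 T, z t = z 0 + ∫ s in (0 : ℝ)..t, F s)
    (hz' : ∀ t ∈ Icc 0 T, z' t = z' 0 + ∫ s in (0 : ℝ)..t, F' s) {ε ε' : ℝ}
    (hres : ∀ᵐ t, t ∈ Ioo 0 T → HasFDer (z t) ∧ ‖F t - opL2 (a t) (b t) (c t) (d t) (z t) - r t‖ ≤ ε)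
    (hres' : ∀ᵐ t, t ∈ Ioo 0 T →
      HasFDer (z' t) ∧ ‖F' t - opL2 (a t) (b t) (c t) (d t) (z' t) - r t‖ ≤ ε')
    {t : ℝ} (ht : t ∈ Icc 0 T) :
    ‖z t - z' t‖ ^ 2 ≤ energyConst R T * (‖z 0 - z' 0‖ ^ 2 + (ε + ε') ^ 2) := by
  have hsub : ∀ {G : ℝ → L2per M}, IntervalIntegrable G volume 0 T → ∀ s ∈ Icc 0 T,
      IntervalIntegrable G volume 0 s := fun hG s hs =>
    hG.mono_set (by rw [uIcc_of_le hT, uIcc_of_le hs.1]; exact Icc_subset_Icc_right hs.2)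
  refine h.norm_sq_le_of_residual (z := fun t => z t - z' t) (F := fun t => F t - F' t) hT (hF.sub hF')
    (fun s hs => ?_) ?_ ht
  · rw [intervalIntegral.integral_sub (hsub hF s hs) (hsub hF' s hs), hz s hs, hz' s hs]
    abel
  · filter_upwards [hres, hres'] with s h1 h2 hs
    obtain ⟨d1, r1⟩ := h1 hs
    obtain ⟨d2, r2⟩ := h2 hs
    refine ⟨d1.sub d2, ?_⟩
    rw [opL2_sub _ _ _ _ d1 d2]
    have e : F s - F' s - (opL2 (a s) (b s) (c s) (d s) (z s) - opL2 (a s) (b s) (c s) (d s) (z' s)) =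
        (F s - opL2 (a s) (b s) (c s) (d s) (z s) - r s) -
          (F' s - opL2 (a s) (b s) (c s) (d s) (z' s) - r s) := by abel
    rw [e]
    exact (norm_sub_le _ _).trans (add_le_add r1 r2)

/-- The stability estimate with both residuals zero. Three derivatives in `L²` at almost every time
are enough; no bound in `H^n` is needed, so the statement covers every competitor in the uniqueness
claim. -/
theorem eqOn_of_solution (h : TimeCoeffs M n R a b c d) {z F z' F' r : ℝ → L2per M} {T : ℝ}
    (hT : 0 ≤ T) (hF : IntervalIntegrable F volume 0 T) (hF' : IntervalIntegrable F' volume 0 T)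
    (hz : ∀ t ∈ Icc 0 T, z t = z 0 + ∫ s in (0 : ℝ)..t, F s)
    (hz' : ∀ t ∈ Icc 0 T, z' t = z' 0 + ∫ s in (0 : ℝ)..t, F' s)
    (hres : ∀ᵐ t, t ∈ Ioo 0 T → HasFDer (z t) ∧ F t = opL2 (a t) (b t) (c t) (d t) (z t) + r t)
    (hres' : ∀ᵐ t, t ∈ Ioo 0 T → HasFDer (z' t) ∧ F' t = opL2 (a t) (b t) (c t) (d t) (z' t) + r t)
    (h0 : z 0 = z' 0) : EqOn z z' (Icc 0 T) := by
  intro t ht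
  have := h.norm_sub_sq_le (r := r) (ε := 0) (ε' := 0) hT hF hF' hz hz'
    (by filter_upwards [hres] with s hs hsI using ⟨(hs hsI).1, by rw [(hs hsI).2]; simp⟩)
    (by filter_upwards [hres'] with s hs hsI using ⟨(hs hsI).1, by rw [(hs hsI).2]; simp⟩) ht
  rw [h0] at this
  simp only [sub_self, norm_zero, add_zero, ne_eq, OfNat.ofNat_ne_zero, not_false_eq_true, zero_pow,
    mul_zero] at this
  have := pow_eq_zero_iff (two_ne_zero) |>.1 (le_antisymm this (sq_nonneg _))
  exact sub_eq_zero.1 (norm_eq_zero.1 this)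

/-- Existence of a solution that is bounded in `H^n`. -/
theorem exists_solution (h : TimeCoeffs M n R a b c d) {T : ℝ} (hT : 0 < T) (u₀ : Sob M n)
    {e : ℝ → Sob M n} (he : StronglyMeasurable e) {E : ℝ} (hE : ∀ t, ‖e t‖ ≤ E) :
    ∃ U : ℝ → Sob M n, (∀ t ∈ Icc 0 T, ‖U t‖ ≤ solConst R n T * (‖u₀‖ + E)) ∧
      Sob.toL2 (U 0) = Sob.toL2 u₀ ∧
      IntervalIntegrable (fun t => opL2 (a t) (b t) (c t) (d t) (Sob.toL2 (U t)) + Sob.toL2 (e t))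
        volume 0 T ∧
      ∀ t ∈ Icc 0 T, Sob.toL2 (U t) = Sob.toL2 (U 0) +
        ∫ s in (0 : ℝ)..t, (opL2 (a s) (b s) (c s) (d s) (Sob.toL2 (U s)) + Sob.toL2 (e s)) := by
  have hn4 : 4 ≤ n := (h.coeffs 0).four_le
  have h3n : (3 : ℝ) ≤ n := by exact_mod_cast (by lia : 3 ≤ n)
  have hR : 0 ≤ R := zero_le_one.trans (h.coeffs 0).one_le
  set B := solConst R n T * (‖u₀‖ + E) with hB
  set δ : ℕ → ℝ := fun m => 1 / ((m : ℝ) + 1) with hδ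
  have hδ0 : ∀ m, 0 < δ m := fun m => Nat.one_div_pos_of_nat
  have hδlim : Tendsto δ atTop (𝓝 0) := tendsto_one_div_add_atTop_nhds_zero_nat
  have hδ1 : ∀ m, δ m ≤ 1 := fun m => by
    rw [hδ]
    exact (div_le_one₀ (by positivity)).2 (by linarith [(Nat.cast_nonneg m : (0 : ℝ) ≤ m)])
  choose z F hF hz hzb hz0 hres using fun m : ℕ => h.exists_approx hT u₀ he hE (hδ0 m)
  have hfd : ∀ m, ∀ t ∈ Icc 0 T, HasFDer (z m t) := fun m t ht => by
    obtain ⟨g, hg, -⟩ := hzb m t ht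
    rw [← hg]
    exact Sob.hasFDer h3n g
  have hC0 : 0 ≤ energyConst R T := by rw [energyConst]; positivity
  -- All approximations share the forcing and have initial errors and residuals tending to zero, so
  -- the `L²` stability estimate compares any two of them.
  have hcau : ∀ t ∈ Icc 0 T, CauchySeq fun m => z m t := fun t ht => by
    have hlim : Tendsto (fun N : ℕ => Real.sqrt (energyConst R T * 2) * (2 * δ N)) atTop (𝓝 0) := by
      simpa using (hδlim.const_mul 2).const_mul (Real.sqrt (energyConst R T * 2))
    refine cauchySeq_of_le_tendsto_0 _ (fun m l N hm hl => ?_) hlim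
    have hanti : ∀ {k}, N ≤ k → δ k ≤ δ N := fun hk => Nat.one_div_le_one_div hk
    have key := h.norm_sub_sq_le (r := fun t => Sob.toL2 (e t)) hT.le (hF m) (hF l) (hz m) (hz l)
      (Eventually.of_forall fun s hs => ⟨hfd m s (Ioo_subset_Icc_self hs), hres m s (Ioo_subset_Icc_self hs)⟩)
      (Eventually.of_forall fun s hs => ⟨hfd l s (Ioo_subset_Icc_self hs), hres l s (Ioo_subset_Icc_self hs)⟩)
      ht
    have h1 : δ m + δ l ≤ 2 * δ N := by linarith [hanti hm, hanti hl]
    have h2 : ‖z m 0 - z l 0‖ ≤ 2 * δ N := by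
      have e1 : z m 0 - z l 0 = (z m 0 - Sob.toL2 u₀) - (z l 0 - Sob.toL2 u₀) := by abel
      rw [e1]
      exact ((norm_sub_le _ _).trans (add_le_add (hz0 m) (hz0 l))).trans h1
    rw [dist_eq_norm]
    have hδN := hδ0 N
    refine le_of_sq_le_sq (key.trans ?_) (by positivity)
    rw [mul_pow, Real.sq_sqrt (by positivity)]
    have h3 := pow_le_pow_left₀ (norm_nonneg _) h2 2
    have h4 := pow_le_pow_left₀ (add_nonneg (hδ0 m).le (hδ0 l).le) h1 2
    nlinarith
  have hlim : ∀ t, ∃ g : Sob M n, t ∈ Icc 0 T →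
      Tendsto (fun m => z m t) atTop (𝓝 (Sob.toL2 g)) ∧ ‖g‖ ≤ B := fun t => by
    by_cases ht : t ∈ Icc 0 T
    · obtain ⟨f, hf⟩ := cauchySeq_tendsto_of_complete (hcau t ht)
      choose g hg hgn using fun m => hzb m t ht
      obtain ⟨g₀, hg₀, hn₀⟩ := Sob.exists_of_tendsto (l := atTop) (g := g) (f := f) (B := B)
        (Eventually.of_forall hgn) (by simpa only [hg] using hf)
      exact ⟨g₀, fun _ => ⟨by rwa [hg₀], hn₀⟩⟩
    · exact ⟨0, fun h => absurd h ht⟩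
  choose U hU using hlim
  have h0T : (0 : ℝ) ∈ Icc 0 T := left_mem_Icc.2 hT.le
  have hU0 : Sob.toL2 (U 0) = Sob.toL2 u₀ := by
    refine tendsto_nhds_unique (hU 0 h0T).1 (tendsto_iff_norm_sub_tendsto_zero.2 ?_)
    exact squeeze_zero (fun _ => norm_nonneg _) hz0 hδlim
  -- Convergence is known only in `L²`, but the differences stay in a ball of radius `B + B` in
  -- `H^n`, where the operator is continuous for the `L²` norm.
  have hop : ∀ t ∈ Icc 0 T, Tendsto (fun m => opL2 (a t) (b t) (c t) (d t) (z m t)) atTop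
      (𝓝 (opL2 (a t) (b t) (c t) (d t) (Sob.toL2 (U t)))) := fun t ht => by
    refine Metric.tendsto_atTop.2 fun ε hε => ?_
    obtain ⟨η, hη, H⟩ := h.exists_opL2_le (B + B) (ε := ε / 2) (by positivity)
    obtain ⟨N, hN⟩ := Metric.tendsto_atTop.1 (hU t ht).1 η hη
    refine ⟨N, fun m hm => ?_⟩
    obtain ⟨g, hg, hgn⟩ := hzb m t ht
    have h1 := H t (g - U t) ((norm_sub_le _ _).trans (add_le_add hgn (hU t ht).2)) (by
      rw [map_sub, hg, ← dist_eq_norm]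
      exact (hN m hm).le)
    rw [map_sub, opL2_sub _ _ _ _ (Sob.hasFDer h3n g) (Sob.hasFDer h3n (U t)), hg, ← dist_eq_norm] at h1
    linarith
  set G : ℝ → L2per M := fun t => opL2 (a t) (b t) (c t) (d t) (Sob.toL2 (U t)) + Sob.toL2 (e t) with hG
  have hFlim : ∀ t ∈ Icc 0 T, Tendsto (fun m => F m t) atTop (𝓝 (G t)) := fun t ht => by
    have h1 : Tendsto (fun m => F m t - opL2 (a t) (b t) (c t) (d t) (z m t) - Sob.toL2 (e t)) atTop (𝓝 0) :=
      squeeze_zero_norm (fun m => hres m t ht) hδlim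
    have h2 := (h1.add (hop t ht)).add_const (Sob.toL2 (e t))
    rw [zero_add] at h2
    refine h2.congr fun m => ?_
    abel
  have hFbd : ∀ m, ∀ t ∈ Icc 0 T, ‖F m t‖ ≤ 1 + 4 * R * B + E := fun m t ht => by
    obtain ⟨g, hg, hgn⟩ := hzb m t ht
    have h1 := (hres m t ht).trans (hδ1 m)
    have h2 := (h.coeffs t).norm_opL2_le g
    rw [hg] at h2
    have h3 := (Sob.norm_toL2_le (Nat.cast_nonneg n) (e t)).trans (hE t)
    have h4 : 4 * R * ‖g‖ ≤ 4 * R * B := by gcongr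
    have e1 : F m t = (F m t - opL2 (a t) (b t) (c t) (d t) (z m t) - Sob.toL2 (e t)) +
        opL2 (a t) (b t) (c t) (d t) (z m t) + Sob.toL2 (e t) := by abel
    rw [e1]
    refine (norm_add₃_le).trans ?_
    linarith
  have hGbd : ∀ t ∈ Icc 0 T, ‖G t‖ ≤ 1 + 4 * R * B + E := fun t ht =>
    le_of_tendsto (hFlim t ht).norm (Eventually.of_forall fun m => hFbd m t ht)
  have hIoc : ∀ {t}, t ∈ Icc 0 T → uIoc 0 t ⊆ Icc 0 T := fun {t} ht => by
    rw [uIoc_of_le ht.1]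
    exact Ioc_subset_Icc_self.trans (Icc_subset_Icc_right ht.2)
  have hFt : ∀ m, ∀ t ∈ Icc 0 T, IntervalIntegrable (F m) volume 0 t := fun m t ht =>
    (hF m).mono_set (by rw [uIcc_of_le hT.le, uIcc_of_le ht.1]; exact Icc_subset_Icc_right ht.2)
  have hGi : IntervalIntegrable G volume 0 T := by
    have hTT : T ∈ Icc 0 T := right_mem_Icc.2 hT.le
    have hmeas : AEStronglyMeasurable G (volume.restrict (uIoc 0 T)) :=
      aestronglyMeasurable_of_tendsto_ae atTop (fun m => (hF m).aestronglyMeasurable_restrict_uIoc) (by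
        filter_upwards [self_mem_ae_restrict measurableSet_uIoc] with t ht
        exact hFlim t (hIoc hTT ht))
    refine (intervalIntegrable_const (c := 1 + 4 * R * B + E)).mono_fun hmeas ?_
    filter_upwards [self_mem_ae_restrict measurableSet_uIoc] with t ht
    exact (hGbd t (hIoc hTT ht)).trans (le_abs_self _)
  refine ⟨U, fun t ht => (hU t ht).2, hU0, hGi, fun t ht => ?_⟩
  refine tendsto_nhds_unique (hU t ht).1 ?_
  have h1 : Tendsto (fun m => ∫ s in (0 : ℝ)..t, F m s) atTop (𝓝 (∫ s in (0 : ℝ)..t, G s)) :=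
    intervalIntegral.tendsto_integral_filter_of_dominated_convergence (fun _ => 1 + 4 * R * B + E)
      (Eventually.of_forall fun m => (hFt m t ht).aestronglyMeasurable_restrict_uIoc)
      (Eventually.of_forall fun m => Eventually.of_forall fun s hs => hFbd m s (hIoc ht hs))
      intervalIntegrable_const (Eventually.of_forall fun s hs => hFlim s (hIoc ht hs))
  refine ((hU 0 h0T).1.add h1).congr fun m => ?_
  rw [← hz m t ht]

end TimeCoeffs

end LimitOfApproximations

/-! ### Measurability in `H^s` from continuity in `L²` -/

section TruncationIntoSobolev

variable {M : ℝ} [hM : Fact (0 < M)]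

/-- Only finitely many frequencies survive, so the sum `W` of their weights bounds the `H^s` norm by
the `L²` norm. -/
theorem Sob.exists_truncSob (s : ℝ) (K : ℕ) :
    ∃ S : L2per M →L[ℝ] Sob M s, ∀ f, Sob.toL2 (S f) = truncL M K f := by
  set W := ∑ k ∈ Finset.Icc (-K : ℤ) K, besselWeight M s k with hW
  have hW0 : 0 ≤ W := Finset.sum_nonneg fun k _ => (besselWeight_pos M s k).le
  have hex : ∀ f : L2per M, ∃ g : Sob M s, Sob.toL2 g = truncL M K f ∧ ‖g‖ ≤ Real.sqrt W * ‖f‖ := fun f => by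
    refine Sob.exists_of_bound (by positivity) fun S => ?_
    rw [mul_pow, Real.sq_sqrt hW0]
    refine le_trans (Finset.sum_le_sum fun k _ => ?_)
      (sum_le_hasSum S (fun k _ => ?_) ((hasSum_norm_sq_fcoef f).mul_left W))
    · rw [truncL_apply, fcoef_trunc]
      split_ifs with hk
      · have h1 : besselWeight M s k ≤ W :=
          Finset.single_le_sum (f := besselWeight M s) (fun k _ => (besselWeight_pos M s k).le) hk
        have h2 : 0 ≤ M * ‖fcoef f k‖ ^ 2 := mul_nonneg hM.out.le (sq_nonneg _)
        have := mul_le_mul_of_nonneg_right h1 h2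
        linarith
      · have := hM.out.le
        simp only [norm_zero, ne_eq, OfNat.ofNat_ne_zero, not_false_eq_true, zero_pow, mul_zero]
        positivity
    · have := hM.out.le
      positivity
  choose S hS hSn using hex
  exact ⟨LinearMap.mkContinuous
    { toFun := S
      map_add' := fun f g => Sob.toL2_injective (by rw [map_add, hS, hS, hS, map_add])
      map_smul' := fun r f => Sob.toL2_injective (by rw [map_smul, hS, hS, map_smul, RingHom.id_apply]) }
    (Real.sqrt W) hSn, hS⟩

theorem Sob.tendsto_of_toL2_eq_truncL {s : ℝ} {g : Sob M s} {S : ℕ → Sob M s}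
    (hS : ∀ K, Sob.toL2 (S K) = truncL M K (Sob.toL2 g)) : Tendsto S atTop (𝓝 g) := by
  rw [tendsto_iff_norm_sub_tendsto_zero]
  have hsq : Tendsto (fun K => ‖S K - g‖ ^ 2) atTop (𝓝 0) := by
    have h1 : ∀ K : ℕ, ‖S K - g‖ ^ 2 = ∑' k, M * (besselWeight M s k *
        ‖if k ∈ Finset.Icc (-K : ℤ) K then 0 else fcoef (Sob.toL2 g) k‖ ^ 2) := fun K => by
      rw [← (Sob.hasSum_norm_sq _).tsum_eq]
      refine tsum_congr fun k => ?_
      rw [map_sub, fcoef_sub, hS, truncL_apply, fcoef_trunc]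
      split_ifs <;> simp
    simp_rw [h1]
    rw [← tsum_zero (α := ℝ) (β := ℤ)]
    refine tendsto_tsum_of_dominated_convergence (bound := fun k =>
      M * (besselWeight M s k * ‖fcoef (Sob.toL2 g) k‖ ^ 2))
      (Sob.hasSum_norm_sq g).summable (fun k => ?_) (Eventually.of_forall fun K k => ?_)
    · refine tendsto_const_nhds.congr' ?_
      filter_upwards [trunc_eventually_mem k] with K hK
      rw [if_pos hK]
      simp
    · have : (0 : ℝ) < M := hM.out
      have := besselWeight_pos M s k
      split_ifs
      · simp; positivity
      · rw [Real.norm_of_nonneg (by positivity)]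
  have := hsq.sqrt
  simpa [Real.sqrt_sq (norm_nonneg _)] using this

/-- A function into `H^s` that is continuous into `L²` on `[0, T]` is strongly measurable. -/
theorem Sob.aestronglyMeasurable_of_continuousOn {s T : ℝ} {U : ℝ → Sob M s}
    (hU : ContinuousOn (fun t => Sob.toL2 (U t)) (Icc 0 T)) :
    AEStronglyMeasurable U (timeMeasure T) := by
  choose S hS using fun K : ℕ => Sob.exists_truncSob (M := M) s K
  exact aestronglyMeasurable_of_tendsto_ae atTop
    (fun K => ((S K).continuous.comp_continuousOn hU).aestronglyMeasurable measurableSet_Icc)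
    (Eventually.of_forall fun t => Sob.tendsto_of_toL2_eq_truncL fun K => hS K _)

end TruncationIntoSobolev

/-! ### From the hypotheses on the data to uniform bounds at all times -/

section Data

variable {M : ℝ} [hM : Fact (0 < M)]

theorem MemCCk.mono {T : ℝ} {k l : ℕ} {f : ℝ → AddCircle M → ℝ} (h : MemCCk T k f) (hl : l ≤ k) :
    MemCCk T l f :=
  ⟨fun t ht => (h.1 t ht).of_le (by exact_mod_cast hl), fun j hj => h.2 j (hj.trans hl)⟩

theorem MemCCk.perC {T : ℝ} {k : ℕ} {f : ℝ → AddCircle M → ℝ} (h : MemCCk T k f) {t : ℝ}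
    (ht : t ∈ Icc 0 T) : PerC M k (circleLift (f t)) := ⟨circleLift_periodic _, h.1 t ht⟩

/-- Near each time the derivative stays within `1` of a bounded periodic function, and `[0, T]` is
compact. The bound is needed for `wNorm` to carry information, since a real supremum over an
unbounded family takes a default value. -/
theorem MemCCk.exists_bound {T : ℝ} {k : ℕ} {f : ℝ → AddCircle M → ℝ} (h : MemCCk T k f) {j : ℕ}
    (hj : j ≤ k) : ∃ C, ∀ t ∈ Icc 0 T, ∀ x, |iteratedDeriv j (circleLift (f t)) x| ≤ C := by
  refine isCompact_Icc.induction_on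
    (p := fun s => ∃ C, ∀ t ∈ s, ∀ x, |iteratedDeriv j (circleLift (f t)) x| ≤ C)
    ⟨0, by simp⟩ (fun s t hst ⟨C, hC⟩ => ⟨C, fun r hr => hC r (hst hr)⟩) ?_ fun t ht => ?_
  · rintro s t ⟨C, hC⟩ ⟨D, hD⟩
    refine ⟨max C D, fun r hr x => ?_⟩
    rcases hr with hr | hr
    · exact (hC r hr x).trans (le_max_left _ _)
    · exact (hD r hr x).trans (le_max_right _ _)
  · have hp := ((h.perC ht).iter (l := 0) (j := j) (by lia))
    obtain ⟨C, -, hC⟩ := exists_bound_of_periodic hp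
    refine ⟨_, Metric.tendstoUniformly_iff.1 (h.2 j hj t ht) 1 one_pos, C + 1, fun s hs x => ?_⟩
    have h1 := hs x
    rw [Real.dist_eq, abs_sub_comm] at h1
    have h2 := abs_add_le (iteratedDeriv j (circleLift (f s)) x - iteratedDeriv j (circleLift (f t)) x)
      (iteratedDeriv j (circleLift (f t)) x)
    rw [sub_add_cancel] at h2
    linarith [hC x]

theorem wNorm_nonneg (T : ℝ) (k : ℕ) (f : ℝ → AddCircle M → ℝ) : 0 ≤ wNorm T k f :=
  Real.iSup_nonneg fun _ => Finset.sum_nonneg fun _ _ => Real.iSup_nonneg fun _ => abs_nonneg _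

theorem abs_iteratedDeriv_le_wNorm {T : ℝ} {k : ℕ} {f : ℝ → AddCircle M → ℝ}
    (h : ∀ j ≤ k, ∃ C, ∀ t ∈ Icc 0 T, ∀ x, |iteratedDeriv j (circleLift (f t)) x| ≤ C) {j : ℕ}
    (hj : j ≤ k) {t : ℝ} (ht : t ∈ Icc 0 T) (x : ℝ) :
    |iteratedDeriv j (circleLift (f t)) x| ≤ wNorm T k f := by
  have hC : ∀ j, ∃ C, j ≤ k → ∀ t ∈ Icc 0 T, ∀ x, |iteratedDeriv j (circleLift (f t)) x| ≤ C := fun j => by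
    by_cases hj : j ≤ k
    · obtain ⟨C, hC⟩ := h j hj
      exact ⟨C, fun _ => hC⟩
    · exact ⟨0, fun h => absurd h hj⟩
  choose C hC using hC
  have hx : |iteratedDeriv j (circleLift (f t)) x| ≤ ⨆ x : ℝ, |iteratedDeriv j (circleLift (f t)) x| :=
    le_ciSup (f := fun x : ℝ => |iteratedDeriv j (circleLift (f t)) x|)
      ⟨C j, by rintro _ ⟨y, rfl⟩; exact hC j hj t ht y⟩ x
  have hsum : (⨆ x : ℝ, |iteratedDeriv j (circleLift (f t)) x|) ≤
      ∑ j ∈ Finset.range (k + 1), ⨆ x : ℝ, |iteratedDeriv j (circleLift (f t)) x| :=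
    Finset.single_le_sum (f := fun j => ⨆ x : ℝ, |iteratedDeriv j (circleLift (f t)) x|)
      (fun _ _ => Real.iSup_nonneg fun _ => abs_nonneg _) (Finset.mem_range.2 (by lia))
  have ht' : (∑ j ∈ Finset.range (k + 1), ⨆ x : ℝ, |iteratedDeriv j (circleLift (f t)) x|) ≤ wNorm T k f :=
    le_ciSup (f := fun t : Icc 0 T =>
      ∑ j ∈ Finset.range (k + 1), ⨆ x : ℝ, |iteratedDeriv j (circleLift (f t)) x|)
      ⟨∑ j ∈ Finset.range (k + 1), C j, by
        rintro _ ⟨s, rfl⟩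
        exact Finset.sum_le_sum fun j hj => ciSup_le fun y =>
          hC j (by have := Finset.mem_range.1 hj; lia) s s.2 y⟩ ⟨t, ht⟩
  exact hx.trans (hsum.trans ht')

theorem IsTimeDeriv.abs_sub_le {T : ℝ} {f f' : ℝ → AddCircle M → ℝ} (h : IsTimeDeriv T f f') {C : ℝ}
    (hC : ∀ t ∈ Icc 0 T, ∀ x, |f' t x| ≤ C) {t s : ℝ} (ht : t ∈ Icc 0 T) (hs : s ∈ Icc 0 T)
    (x : AddCircle M) : |f t x - f s x| ≤ C * |t - s| :=
  (convex_Icc 0 T).norm_image_sub_le_of_norm_hasDerivWithin_le (fun r hr => h r hr x)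
    (fun r hr => hC r hr x) hs ht

/-- Heine–Cantor for the map from `[0, T]` into functions with the uniform structure of uniform
convergence. -/
theorem MemCCk.unif {T : ℝ} {k : ℕ} {f : ℝ → AddCircle M → ℝ} (h : MemCCk T k f) {ε : ℝ} (hε : 0 < ε) :
    ∃ δ > 0, ∀ t ∈ Icc 0 T, ∀ s ∈ Icc 0 T, |t - s| < δ →
      ∀ x, |circleLift (f t) x - circleLift (f s) x| ≤ ε := by
  set Φ : ℝ → UniformFun ℝ ℝ := fun t => UniformFun.ofFun (circleLift (f t)) with hΦ
  have hc : ContinuousOn Φ (Icc 0 T) := fun t ht => by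
    refine UniformFun.tendsto_iff_tendstoUniformly.2 ?_
    simpa [hΦ, Function.comp_def] using h.2 0 (Nat.zero_le k) t ht
  have hu := isCompact_Icc.uniformContinuousOn_of_continuous hc
  have hV := (UniformFun.hasBasis_uniformity ℝ ℝ).mem_of_mem (Metric.dist_mem_uniformity hε)
  obtain ⟨δ, hδ, H⟩ := Metric.mem_uniformity_dist.1 (mem_inf_principal.1 (hu hV))
  refine ⟨δ, hδ, fun t ht s hs hts x => ?_⟩
  have := H (a := t) (b := s) (by rwa [Real.dist_eq]) ⟨ht, hs⟩
  exact (this x).le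

/-- The nearest point of `[0, T]`. -/
def clampTime {T : ℝ} (hT : 0 ≤ T) (t : ℝ) : ℝ := projIcc 0 T hT t

theorem clampTime_mem {T : ℝ} (hT : 0 ≤ T) (t : ℝ) : clampTime hT t ∈ Icc 0 T := (projIcc 0 T hT t).2

theorem clampTime_of_mem {T : ℝ} (hT : 0 ≤ T) {t : ℝ} (ht : t ∈ Icc 0 T) : clampTime hT t = t := by
  rw [clampTime, projIcc_of_mem hT ht]

theorem abs_clampTime_sub_le {T : ℝ} (hT : 0 ≤ T) (t s : ℝ) :
    |clampTime hT t - clampTime hT s| ≤ |t - s| := abs_projIcc_sub_projIcc hT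

theorem sizeOfData_bounds {T : ℝ} {n : ℕ} (hT : 0 < T) (a a' b b' c d : ℝ → AddCircle M → ℝ)
    (e : Lp (Sob M n) ∞ (timeMeasure T)) : T ≤ sizeOfData T n a a' b b' c d e ∧
      (n : ℝ) ≤ sizeOfData T n a a' b b' c d e ∧ ‖e‖ ≤ sizeOfData T n a a' b b' c d e ∧
      M ≤ sizeOfData T n a a' b b' c d e ∧
      wNorm T (n + 3) a ≤ sizeOfData T n a a' b b' c d e ∧
      wNorm T 1 a' ≤ sizeOfData T n a a' b b' c d e ∧
      wNorm T 0 (fun t x => (a t x)⁻¹) ≤ sizeOfData T n a a' b b' c d e ∧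
      wNorm T n b ≤ sizeOfData T n a a' b b' c d e ∧
      wNorm T 0 b' ≤ sizeOfData T n a a' b b' c d e ∧
      wNorm T n c ≤ sizeOfData T n a a' b b' c d e ∧
      wNorm T n d ≤ sizeOfData T n a a' b b' c d e := by
  have h1 := hM.out
  have h2 := wNorm_nonneg T (n + 3) a
  have h3 := wNorm_nonneg T 1 a'
  have h4 := wNorm_nonneg T 0 (fun t x => (a t x)⁻¹)
  have h5 := wNorm_nonneg T n b
  have h6 := wNorm_nonneg T 0 b'
  have h7 := wNorm_nonneg T n c
  have h8 := wNorm_nonneg T n d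
  have h9 := norm_nonneg e
  have h10 : (0 : ℝ) ≤ n := Nat.cast_nonneg n
  unfold sizeOfData
  refine ⟨?_, ?_, ?_, ?_, ?_, ?_, ?_, ?_, ?_, ?_, ?_⟩ <;> linarith

/-- Clamping time to `[0, T]` continues the coefficients as constants beyond both ends. Since the
clamp is `1`-Lipschitz, all bounds and moduli of continuity are kept. The lower bound `a₀` gives
only non-vanishing and finiteness; the quantitative bound on `1/a` is the one in the size of the
data. -/
theorem timeCoeffs_of_data {T : ℝ} {n : ℕ} (hT : 0 < T) (hn : 4 ≤ n)
    {a a' b b' c d : ℝ → AddCircle M → ℝ} (e : Lp (Sob M n) ∞ (timeMeasure T))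
    (ha : MemCCk T (n + 3) a) (hta : IsTimeDeriv T a a') (ha' : MemCCk T n a')
    (hb : MemCCk T (n + 2) b) (htb : IsTimeDeriv T b b') (hb' : MemCCk T n b')
    (hc : MemCCk T n c) (hd : MemCCk T n d)
    (hne : ∃ a₀ : ℝ, 0 < a₀ ∧ ∀ t ∈ Icc 0 T, ∀ x, a₀ ≤ |a t x|)
    (havg : ∀ t ∈ Icc 0 T,
      0 ≤ 1 / M * ∫ y in (0 : ℝ)..M, circleLift (b t) y / |circleLift (a t) y|) :
    TimeCoeffs M n (max 1 (sizeOfData T n a a' b b' c d e))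
      (fun t => circleLift (a (clampTime hT.le t))) (fun t => circleLift (b (clampTime hT.le t)))
      (fun t => circleLift (c (clampTime hT.le t))) (fun t => circleLift (d (clampTime hT.le t))) := by
  obtain ⟨a₀, ha₀, hne⟩ := hne
  obtain ⟨-, sn, -, sM, sa, sa', si, sb, sb', sc, sd⟩ := sizeOfData_bounds hT a a' b b' c d e
  set R := max 1 (sizeOfData T n a a' b b' c d e) with hR
  have hsR : sizeOfData T n a a' b b' c d e ≤ R := le_max_right _ _
  have bd : ∀ {k : ℕ} {f : ℝ → AddCircle M → ℝ}, MemCCk T k f → ∀ {j}, j ≤ k → ∀ t ∈ Icc 0 T, ∀ x,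
      |iteratedDeriv j (circleLift (f t)) x| ≤ wNorm T k f := fun hf _ hj t ht x =>
    abs_iteratedDeriv_le_wNorm (fun j hj => hf.exists_bound hj) hj ht x
  have bd0 : ∀ {k : ℕ} {f : ℝ → AddCircle M → ℝ}, MemCCk T k f → ∀ t ∈ Icc 0 T, ∀ x,
      |f t x| ≤ wNorm T k f := fun {k f} hf t ht x => by
    obtain ⟨y, rfl⟩ := QuotientAddGroup.mk_surjective x
    have := bd hf (Nat.zero_le k) t ht y
    rwa [iteratedDeriv_zero] at this
  have hRt : ∀ {C t s r : ℝ}, C ≤ sizeOfData T n a a' b b' c d e →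
      r ≤ C * |clampTime hT.le t - clampTime hT.le s| → r ≤ R * |t - s| := fun {C t s r} hC hr =>
    hr.trans (mul_le_mul (hC.trans hsR) (abs_clampTime_sub_le hT.le t s) (abs_nonneg _)
      (zero_le_one.trans (le_max_left _ _)))
  have hinv : ∀ t ∈ Icc 0 T, ∀ x, |(circleLift (a t) x)⁻¹| ≤ wNorm T 0 (fun t x => (a t x)⁻¹) := by
    intro t ht x
    have := abs_iteratedDeriv_le_wNorm (T := T) (k := 0) (f := fun t x => (a t x)⁻¹) (fun j hj => by
      refine ⟨a₀⁻¹, fun s hs y => ?_⟩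
      rw [Nat.le_zero.1 hj, iteratedDeriv_zero, circleLift, abs_inv]
      exact inv_anti₀ ha₀ (hne s hs y)) le_rfl ht x
    rwa [iteratedDeriv_zero] at this
  refine ⟨fun t => ?_, fun t s x => ?_, fun t s x => ?_, fun ε hε => ?_, fun ε hε => ?_⟩
  · have ht := clampTime_mem hT.le t
    refine ⟨ha.perC ht, hb.perC ht, hc.perC ht, hd.perC ht,
      fun j hj x => (bd ha hj _ ht x).trans (sa.trans hsR),
      fun j hj x => (bd (hb.mono (l := n) (by lia)) hj _ ht x).trans (sb.trans hsR),
      fun j hj x => (bd hc hj _ ht x).trans (sc.trans hsR),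
      fun j hj x => (bd hd hj _ ht x).trans (sd.trans hsR), fun x => ?_,
      fun x => (hinv _ ht x).trans (si.trans hsR), ?_, le_max_left _ _, sM.trans hsR, hn, sn.trans hsR⟩
    · exact abs_pos.1 (ha₀.trans_le (hne _ ht x))
    · have := havg _ ht
      rwa [one_div, inv_mul_eq_div, le_div_iff₀ hM.out, zero_mul] at this
  · exact hRt sa' (hta.abs_sub_le (bd0 (ha'.mono (l := 1) (by lia))) (clampTime_mem hT.le t)
      (clampTime_mem hT.le s) x)
  · exact hRt sb' (htb.abs_sub_le (bd0 (hb'.mono (l := 0) (by lia))) (clampTime_mem hT.le t)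
      (clampTime_mem hT.le s) x)
  · obtain ⟨δ, hδ, H⟩ := hc.unif hε
    exact ⟨δ, hδ, fun t s hts => H _ (clampTime_mem hT.le t) _ (clampTime_mem hT.le s)
      ((abs_clampTime_sub_le hT.le t s).trans_lt hts)⟩
  · obtain ⟨δ, hδ, H⟩ := hd.unif hε
    exact ⟨δ, hδ, fun t s hts => H _ (clampTime_mem hT.le t) _ (clampTime_mem hT.le s)
      ((abs_clampTime_sub_le hT.le t s).trans_lt hts)⟩

theorem coeFn_opL2 {α β γ δ : AddCircle M → ℝ} (hα : PerC M 0 (circleLift α))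
    (hβ : PerC M 0 (circleLift β)) (hγ : PerC M 0 (circleLift γ)) (hδ : PerC M 0 (circleLift δ))
    (f : L2per M) :
    opL2 (circleLift α) (circleLift β) (circleLift γ) (circleLift δ) f =ᵐ[volume] fun x =>
      α x * fder 3 f x + β x * fder 2 f x + γ x * fder 1 f x + δ x * f x := by
  have h1 := Lp.coeFn_add (mulP M (circleLift α) (fder 3 f)) (mulP M (circleLift β) (fder 2 f))
  have h2 := Lp.coeFn_add (mulP M (circleLift α) (fder 3 f) + mulP M (circleLift β) (fder 2 f))
    (mulP M (circleLift γ) (fder 1 f))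
  have h3 := Lp.coeFn_add (mulP M (circleLift α) (fder 3 f) + mulP M (circleLift β) (fder 2 f) +
    mulP M (circleLift γ) (fder 1 f)) (mulP M (circleLift δ) f)
  filter_upwards [h1, h2, h3, coeFn_mulP hα (fder 3 f), coeFn_mulP hβ (fder 2 f),
    coeFn_mulP hγ (fder 1 f), coeFn_mulP hδ f] with x e1 e2 e3 e4 e5 e6 e7
  rw [opL2, e3, Pi.add_apply, e2, Pi.add_apply, e1, Pi.add_apply, e4, e5, e6, e7]
  simp only [onCircle_circleLift]

end Data

/-! ### The solution operator: Lipschitz dependence and the final constant -/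

section SolutionOperator

variable {M : ℝ} [hM : Fact (0 < M)]

instance (T : ℝ) : IsFiniteMeasure (timeMeasure T) := by
  unfold timeMeasure
  infer_instance

theorem norm_Lp_top_le {E : Type*} [NormedAddCommGroup E] {T : ℝ} {f : Lp E ∞ (timeMeasure T)} {C : ℝ}
    (hC : 0 ≤ C) (h : ∀ᵐ t ∂(timeMeasure T), ‖f t‖ ≤ C) : ‖f‖ ≤ C := by
  simpa using Lp.norm_le_of_ae_bound hC h

theorem integrable_timeMeasure_iff {E : Type*} [NormedAddCommGroup E] {T : ℝ} (hT : 0 ≤ T) {F : ℝ → E} :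
    Integrable F (timeMeasure T) ↔ IntervalIntegrable F volume 0 T :=
  (intervalIntegrable_iff_integrableOn_Icc_of_le hT).symm

theorem ae_Ioo_of_timeMeasure {T : ℝ} {p : ℝ → Prop} (h : ∀ᵐ t ∂(timeMeasure T), p t) :
    ∀ᵐ t, t ∈ Ioo 0 T → p t := by
  filter_upwards [(ae_restrict_iff' measurableSet_Icc).1 h] with t ht htI
  exact ht (Ioo_subset_Icc_self htI)

theorem ae_timeMeasure_mem (T : ℝ) : ∀ᵐ t ∂(timeMeasure T), t ∈ Icc 0 T :=
  self_mem_ae_restrict measurableSet_Icc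

/-- A strongly measurable bounded representative of an essentially bounded function. -/
theorem exists_bounded_representative {E : Type*} [NormedAddCommGroup E] {T : ℝ}
    (e : Lp E ∞ (timeMeasure T)) :
    ∃ f : ℝ → E, StronglyMeasurable f ∧ (∀ t, ‖f t‖ ≤ ‖e‖) ∧ f =ᵐ[timeMeasure T] e := by
  have hm := Lp.stronglyMeasurable e
  refine ⟨{t | ‖e t‖ ≤ ‖e‖}.indicator e, hm.indicator (measurableSet_le hm.norm.measurable measurable_const),
    fun t => ?_, ?_⟩
  · by_cases h : t ∈ {t | ‖e t‖ ≤ ‖e‖}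
    · rw [indicator_of_mem h]
      exact h
    · rw [indicator_of_notMem h, norm_zero]
      exact norm_nonneg e
  · filter_upwards [ae_le_eLpNormEssSup (f := e) (μ := timeMeasure T)] with t ht
    refine indicator_of_mem (s := {t | ‖e t‖ ≤ ‖e‖}) ?_ e
    change ‖e t‖ ≤ ‖e‖
    rw [Lp.norm_def, eLpNorm_exponent_top, ← toReal_enorm (e t)]
    refine ENNReal.toReal_mono ?_ ht
    have := Lp.eLpNorm_ne_top e
    rwa [eLpNorm_exponent_top] at this

namespace TimeCoeffs

open Coeffs

variable {n : ℕ} {R : ℝ} {a b c d : ℝ → ℝ → ℝ}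

theorem solConst_nonneg (R : ℝ) (n : ℕ) (T : ℝ) : 0 ≤ solConst R n T :=
  add_nonneg (Real.sqrt_nonneg _) zero_le_two

theorem solConst_mono {R : ℝ} (hR : 0 ≤ R) (n : ℕ) {T T' : ℝ} (hT : 0 ≤ T) (h : T ≤ T') :
    solConst R n T ≤ solConst R n T' := by
  have := growth_nonneg (n := n) hR
  unfold solConst
  gcongr

/-- `U` is a solution with values in `H^n`, for a right-hand side `e` with values in `H^n`. -/
structure IsSobSolution (a b c d : ℝ → ℝ → ℝ) (T : ℝ) (e U : ℝ → Sob M n) : Prop where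
  integrable : IntervalIntegrable
    (fun t => opL2 (a t) (b t) (c t) (d t) (Sob.toL2 (U t)) + Sob.toL2 (e t)) volume 0 T
  eq_integral : ∀ t ∈ Icc 0 T, Sob.toL2 (U t) = Sob.toL2 (U 0) +
    ∫ s in (0 : ℝ)..t, (opL2 (a s) (b s) (c s) (d s) (Sob.toL2 (U s)) + Sob.toL2 (e s))

theorem IsSobSolution.continuousOn {T : ℝ} (hT : 0 ≤ T) {e U : ℝ → Sob M n}
    (h : IsSobSolution a b c d T e U) : ContinuousOn (fun t => Sob.toL2 (U t)) (Icc 0 T) := by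
  have h1 := intervalIntegral.continuousOn_primitive_interval' h.integrable left_mem_uIcc
  rw [uIcc_of_le hT] at h1
  exact (h1.const_add (Sob.toL2 (U 0))).congr fun t ht => h.eq_integral t ht

/-- The difference of two solutions depends continuously on the difference of the data. -/
theorem norm_sub_le_of_isSobSolution (h : TimeCoeffs M n R a b c d) {T : ℝ} (hT : 0 < T)
    {e U V : ℝ → Sob M n} (hU : IsSobSolution a b c d T e U) (hV : IsSobSolution a b c d T e V)
    {t : ℝ} (ht : t ∈ Icc 0 T) : ‖U t - V t‖ ≤ solConst R n T * ‖U 0 - V 0‖ := by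
  have h3n : (3 : ℝ) ≤ n := by exact_mod_cast (by linarith [(h.coeffs 0).four_le] : 3 ≤ n)
  -- `W` is the constructed solution of the homogeneous problem with the difference of the initial
  -- data. Uniqueness in `L²` identifies it with `U - V`, which thereby inherits the `H^n` bound
  -- without forcing.
  obtain ⟨W, hWn, hW0, hWi, hW⟩ := h.exists_solution hT (U 0 - V 0) (e := fun _ => 0)
    stronglyMeasurable_const (E := 0) (fun _ => by simp)
  have hsub : ∀ {G : ℝ → L2per M}, IntervalIntegrable G volume 0 T → ∀ s ∈ Icc 0 T,
      IntervalIntegrable G volume 0 s := fun hG s hs =>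
    hG.mono_set (by rw [uIcc_of_le hT.le, uIcc_of_le hs.1]; exact Icc_subset_Icc_right hs.2)
  have key := h.eqOn_of_solution (z := fun t => Sob.toL2 (U t - V t)) (z' := fun t => Sob.toL2 (W t))
    (r := fun _ => 0) hT.le (hU.integrable.sub hV.integrable) hWi (fun s hs => by
      rw [intervalIntegral.integral_sub (hsub hU.integrable s hs) (hsub hV.integrable s hs), map_sub,
        hU.eq_integral s hs, hV.eq_integral s hs, map_sub]
      abel) hW
    (Eventually.of_forall fun s _ => ⟨Sob.hasFDer h3n _, by
      rw [map_sub, opL2_sub _ _ _ _ (Sob.hasFDer h3n _) (Sob.hasFDer h3n _)]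
      abel⟩)
    (Eventually.of_forall fun s _ => ⟨Sob.hasFDer h3n _, by rw [map_zero]⟩) hW0.symm ht
  have hUV : U t - V t = W t := Sob.toL2_injective key
  rw [hUV]
  simpa using hWn t ht

end TimeCoeffs

/-- Interpolation: bounded in `H^n` and continuous into `L²` gives continuous into `H^{n'}`,
`n' < n`. -/
theorem Sob.exists_continuousOn_incl {s s' T B : ℝ} (h0 : 0 ≤ s') (h : s' < s) {U : ℝ → Sob M s}
    (hB : ∀ t ∈ Icc 0 T, ‖U t‖ ≤ B) (hc : ContinuousOn (fun t => toL2 (U t)) (Icc 0 T)) :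
    ∃ w : ℝ → Sob M s', ContinuousOn w (Icc 0 T) ∧ ∀ t, toL2 (w t) = toL2 (U t) ∧ ‖w t‖ ≤ ‖U t‖ := by
  choose w hw hwn using fun t => exists_incl h.le (U t)
  refine ⟨w, fun t ht => ?_, fun t => ⟨hw t, hwn t⟩⟩
  refine Metric.tendsto_nhds.2 fun ε hε => ?_
  have hη : 0 < ε ^ 2 / (2 * ((2 * B) ^ 2 + 1)) := by positivity
  obtain ⟨C, hC, H⟩ := interpolation (M := M) h0 h hη
  have hlim : Tendsto (fun s => C * ‖toL2 (U s) - toL2 (U t)‖ ^ 2) (𝓝[Icc 0 T] t) (𝓝 0) := by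
    have := tendsto_iff_norm_sub_tendsto_zero.1 (hc t ht)
    simpa using (this.pow 2).const_mul C
  filter_upwards [hlim.eventually_lt_const (by positivity : 0 < ε ^ 2 / 2), self_mem_nhdsWithin] with r hr hrI
  have h1 := H (U r - U t) (w r - w t) (by rw [map_sub, map_sub, hw, hw])
  have h2 : ‖U r - U t‖ ≤ 2 * B := (norm_sub_le _ _).trans (by linarith [hB r hrI, hB t ht])
  have h3 : ε ^ 2 / (2 * ((2 * B) ^ 2 + 1)) * ‖U r - U t‖ ^ 2 ≤ ε ^ 2 / 2 := by
    have h4 := pow_le_pow_left₀ (norm_nonneg _) h2 2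
    calc _ ≤ ε ^ 2 / (2 * ((2 * B) ^ 2 + 1)) * ((2 * B) ^ 2 + 1) := by gcongr; linarith
      _ = _ := by field_simp
  rw [map_sub] at h1
  rw [dist_eq_norm]
  refine lt_of_pow_lt_pow_left₀ 2 hε.le ?_
  linarith

/-- The constant of the theorem as a function of the size of the data. -/
def boundConst (r : ℝ) : ℝ :=
  1 + (∑ n ∈ Finset.range (⌊r⌋₊ + 1), TimeCoeffs.solConst (max 1 r) n |r|) * (1 + |r|)

theorem boundConst_pos (r : ℝ) : 0 < boundConst r := by
  have : 0 ≤ ∑ n ∈ Finset.range (⌊r⌋₊ + 1), TimeCoeffs.solConst (max 1 r) n |r| :=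
    Finset.sum_nonneg fun n _ => TimeCoeffs.solConst_nonneg _ _ _
  unfold boundConst
  positivity

/-- Both `n` and `T` are at most the size `r` of the data. Replacing `T` by `|r|` and summing over
all `n ≤ ⌊r⌋` removes them, so the constant is a function of `r` alone. -/
theorem solConst_mul_le_boundConst {r T E x : ℝ} {n : ℕ} (hT : 0 ≤ T) (hTr : T ≤ r) (hn : (n : ℝ) ≤ r)
    (hE0 : 0 ≤ E) (hE : E ≤ r) (hx : 0 ≤ x) :
    TimeCoeffs.solConst (max 1 r) n T * (x + E) ≤ boundConst r * (x + 1) := by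
  have hR : (0 : ℝ) ≤ max 1 r := zero_le_one.trans (le_max_left _ _)
  have h1 := TimeCoeffs.solConst_mono hR n hT (hTr.trans (le_abs_self r))
  have h2 : TimeCoeffs.solConst (max 1 r) n |r| ≤
      ∑ n ∈ Finset.range (⌊r⌋₊ + 1), TimeCoeffs.solConst (max 1 r) n |r| :=
    Finset.single_le_sum (f := fun n => TimeCoeffs.solConst (max 1 r) n |r|)
      (fun n _ => TimeCoeffs.solConst_nonneg _ _ _)
      (Finset.mem_range.2 (Nat.lt_succ_of_le (Nat.le_floor hn)))
  have h3 : x + E ≤ (1 + |r|) * (x + 1) := by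
    have := le_abs_self r
    have := mul_nonneg (abs_nonneg r) hx
    linarith
  have h4 := TimeCoeffs.solConst_nonneg (max 1 r) n T
  unfold boundConst
  calc _ ≤ (∑ n ∈ Finset.range (⌊r⌋₊ + 1), TimeCoeffs.solConst (max 1 r) n |r|) * ((1 + |r|) * (x + 1)) :=
        mul_le_mul (h1.trans h2) h3 (by positivity) (h4.trans (h1.trans h2))
    _ ≤ _ := by linarith

end SolutionOperator

end

/-! ### Assembly of the well-posedness theorem -/

theorem theorem2p1 :
    ∃ K : ℝ → ℝ, (∀ r, 0 < K r) ∧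
      ∀ (n : ℕ), 4 ≤ n → ∀ (M : ℝ) [Fact (0 < M)] (T : ℝ), 0 < T →
      ∀ (a a' b b' c d : ℝ → AddCircle M → ℝ) (e : Lp (Sob M n) ∞ (timeMeasure T)),
      -- regularity of the coefficients
      MemCCk T (n + 3) a → IsTimeDeriv T a a' → MemCCk T n a' →
      MemCCk T (n + 2) b → IsTimeDeriv T b b' → MemCCk T n b' →
      MemCCk T n c → MemCCk T n d →
      -- the dispersion does not degenerate
      (∃ a₀ : ℝ, 0 < a₀ ∧ ∀ t ∈ Icc 0 T, ∀ x, a₀ ≤ |a t x|) →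
      -- the average modified diffusion is non-negative
      (∀ t ∈ Icc 0 T, 0 ≤ 1 / M * ∫ y in (0 : ℝ)..M, circleLift (b t) y / |circleLift (a t) y|) →
      ∃ Ψ : Sob M n → Lp (Sob M n) ∞ (timeMeasure T),
        Continuous Ψ ∧
        ∀ u₀ : Sob M n,
          ‖Ψ u₀‖ ≤ K (sizeOfData T n a a' b b' c d e) * (‖u₀‖ + 1) ∧
          -- the representative of `Ψ u₀` that is continuous in time
          ∃ u : ℝ → L2per M,
            (∀ᵐ t ∂(timeMeasure T), u t = (Ψ u₀ t).toL2) ∧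
            (∀ n' : ℝ, 0 ≤ n' → n' < n →
              ∃ w : ℝ → Sob M n', ContinuousOn w (Icc 0 T) ∧
                ∀ t ∈ Icc 0 T, (w t).toL2 = u t ∧
                  ‖w t‖ ≤ K (sizeOfData T n a a' b b' c d e) * (‖u₀‖ + 1)) ∧
            u 0 = u₀.toL2 ∧
            IsSolution T a b c d (fun t => (e t).toL2) u ∧
            ∀ v : ℝ → L2per M, v 0 = u₀.toL2 →
              IsSolution T a b c d (fun t => (e t).toL2) v →
              ∀ t ∈ Icc 0 T, v t = u t := by
  refine ⟨boundConst, boundConst_pos, ?_⟩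
  intro n hn M hM T hT a a' b b' c d e ha hta ha' hb htb hb' hc hd hne havg
  have hTC := timeCoeffs_of_data hT hn e ha hta ha' hb htb hb' hc hd hne havg
  obtain ⟨sT, sn, se, -⟩ := sizeOfData_bounds hT a a' b b' c d e
  set r := sizeOfData T n a a' b b' c d e with hr
  have h3n : (3 : ℝ) ≤ n := by exact_mod_cast (by lia : 3 ≤ n)
  have h0T : (0 : ℝ) ∈ Icc 0 T := left_mem_Icc.2 hT.le
  -- `e` is bounded only almost everywhere, while the construction evaluates the forcing at every
  -- time; `f` is a representative bounded everywhere by the norm of `e`.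
  obtain ⟨f, hf, hfe, hfae⟩ := exists_bounded_representative e
  set A : ℝ → ℝ → ℝ := fun t => circleLift (a (clampTime hT.le t)) with hA
  set B : ℝ → ℝ → ℝ := fun t => circleLift (b (clampTime hT.le t)) with hB
  set C : ℝ → ℝ → ℝ := fun t => circleLift (c (clampTime hT.le t)) with hC
  set D : ℝ → ℝ → ℝ := fun t => circleLift (d (clampTime hT.le t)) with hD
  have hop : ∀ t ∈ Icc 0 T, ∀ g : L2per M, opL2 (A t) (B t) (C t) (D t) g =ᵐ[volume] fun x =>
      a t x * fder 3 g x + b t x * fder 2 g x + c t x * fder 1 g x + d t x * g x := fun t ht g => by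
    simp only [hA, hB, hC, hD, clampTime_of_mem hT.le ht]
    exact coeFn_opL2 ((ha.perC ht).mono (Nat.zero_le _)) ((hb.perC ht).mono (Nat.zero_le _))
      ((hc.perC ht).mono (Nat.zero_le _)) ((hd.perC ht).mono (Nat.zero_le _)) g
  choose U hUn hU0 hUi hUe using fun u₀ : Sob M n => hTC.exists_solution hT u₀ hf hfe
  have hsol : ∀ u₀, TimeCoeffs.IsSobSolution A B C D T f (U u₀) := fun u₀ => ⟨hUi u₀, hUe u₀⟩
  have hU0' : ∀ u₀, U u₀ 0 = u₀ := fun u₀ => Sob.toL2_injective (hU0 u₀)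
  have hbd : ∀ u₀, ∀ t ∈ Icc 0 T, ‖U u₀ t‖ ≤ boundConst r * (‖u₀‖ + 1) := fun u₀ t ht =>
    (hUn u₀ t ht).trans
      (solConst_mul_le_boundConst hT.le sT sn (norm_nonneg e) se (norm_nonneg u₀))
  have hLp : ∀ u₀, MemLp (U u₀) ∞ (timeMeasure T) := fun u₀ =>
    memLp_top_of_bound (Sob.aestronglyMeasurable_of_continuousOn ((hsol u₀).continuousOn hT.le))
      (boundConst r * (‖u₀‖ + 1)) (by
        filter_upwards [ae_timeMeasure_mem T] with t ht
        exact hbd u₀ t ht)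
  have hb0 : ∀ u₀ : Sob M n, 0 ≤ boundConst r * (‖u₀‖ + 1) := fun u₀ => by
    have := boundConst_pos r
    positivity
  refine ⟨fun u₀ => (hLp u₀).toLp, ?_, fun u₀ => ⟨?_, fun t => Sob.toL2 (U u₀ t), ?_, ?_, hU0 u₀, ?_, ?_⟩⟩
  · refine LipschitzWith.continuous (K := (TimeCoeffs.solConst (max 1 r) n T).toNNReal)
      (LipschitzWith.of_dist_le_mul fun u₀ v₀ => ?_)
    have hs0 := TimeCoeffs.solConst_nonneg (max 1 r) n T
    rw [Real.coe_toNNReal _ hs0, dist_eq_norm, dist_eq_norm]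
    refine norm_Lp_top_le (by positivity) ?_
    filter_upwards [ae_timeMeasure_mem T, Lp.coeFn_sub (hLp u₀).toLp (hLp v₀).toLp, (hLp u₀).coeFn_toLp,
      (hLp v₀).coeFn_toLp] with t ht h1 h2 h3
    rw [h1, Pi.sub_apply, h2, h3]
    have := hTC.norm_sub_le_of_isSobSolution hT (hsol u₀) (hsol v₀) ht
    rwa [hU0', hU0'] at this
  · refine norm_Lp_top_le (hb0 u₀) ?_
    filter_upwards [ae_timeMeasure_mem T, (hLp u₀).coeFn_toLp] with t ht h1
    rw [h1]
    exact hbd u₀ t ht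
  · filter_upwards [(hLp u₀).coeFn_toLp] with t h1
    rw [h1]
  · intro n' h0 hn'
    obtain ⟨w, hw, hwU⟩ := Sob.exists_continuousOn_incl h0 hn' (hbd u₀) ((hsol u₀).continuousOn hT.le)
    exact ⟨w, hw, fun t ht => ⟨(hwU t).1, (hwU t).2.trans (hbd u₀ t ht)⟩⟩
  · refine ⟨fun t => fder 1 (Sob.toL2 (U u₀ t)), fun t => fder 2 (Sob.toL2 (U u₀ t)),
      fun t => fder 3 (Sob.toL2 (U u₀ t)), _, ?_, (integrable_timeMeasure_iff hT.le).2 (hUi u₀), hUe u₀⟩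
    filter_upwards [ae_timeMeasure_mem T, hfae] with t ht hft
    have hF := Sob.hasFDer h3n (U u₀ t)
    refine ⟨isWeakDeriv_of_isFDeriv (hF 1 (by lia)), isWeakDeriv_of_isFDeriv (hF 2 (by lia)),
      isWeakDeriv_of_isFDeriv (hF 3 le_rfl), ?_⟩
    filter_upwards [hop t ht (Sob.toL2 (U u₀ t)), Lp.coeFn_add
      (opL2 (A t) (B t) (C t) (D t) (Sob.toL2 (U u₀ t))) (Sob.toL2 (f t))] with x h1 h2
    rw [h2, Pi.add_apply, h1, hft]
  -- The competitor `v` has only its weak derivatives at almost every time. They are translated into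
  -- Fourier form, where they are unique, so `v₁, v₂, v₃` are the derivatives that enter the `L²`
  -- operator.
  · rintro v hv0 ⟨v₁, v₂, v₃, F, hv, hFi, hvF⟩
    refine hTC.eqOn_of_solution (z := v) (F := F) (r := fun t => Sob.toL2 (f t)) hT.le
      ((integrable_timeMeasure_iff hT.le).1 hFi) (hUi u₀) hvF (hUe u₀) ?_
      (Eventually.of_forall fun t _ => ⟨Sob.hasFDer h3n _, rfl⟩) (hv0.trans (hU0 u₀).symm)
    refine ae_Ioo_of_timeMeasure ?_
    filter_upwards [ae_timeMeasure_mem T, hfae, hv] with t ht hft ⟨w1, w2, w3, hx⟩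
    have f1 := isFDeriv_of_isWeakDeriv w1
    have f2 := isFDeriv_of_isWeakDeriv w2
    have f3 := isFDeriv_of_isWeakDeriv w3
    refine ⟨HasFDer.of_isFDeriv f1 f2 f3, Lp.ext ?_⟩
    filter_upwards [hop t ht (v t), Lp.coeFn_add (opL2 (A t) (B t) (C t) (D t) (v t)) (Sob.toL2 (f t)), hx]
      with x h1 h2 h3
    rw [h2, Pi.add_apply, h1, hft, h3, f1.fder_eq, f2.fder_eq, f3.fder_eq]
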